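/- **Setting.** Functions of the times $t_1=x,t_2,\dots$ and $\bar t_1,\bar t_2,\dots$ are elements of a commutative ring with commuting derivations $\partial_{t_r},\partial_{\bar t_s}$ ($r,s\ge1$); $\partial=\partial_{t_1}$, $\bar\partial=\partial_{\bar t_1}$, and $D,\bar D$ are the corresponding operator symbols. $A_\pm$ denotes the differential / purely pseudo-differential part of a pseudo-differential operator $A$. Pseudo-differential operators act on formal oscillating functions $\big(\sum_{j\le N}f_j\lambda^j\big)e^{\xi}$, $\xi=\sum_l t_l\lambda^l$ (resp. $\bar\xi=\sum_l\bar t_l\lambda^l$ for $\bar D$). Let $\{\mathcal L(n),\Phi^{(n)}_j,\Psi^{(n)}_j\}_{n\in\mathbb Z,\,j\ge1}$ be given, with inverse derivatives $S^{(n)}_{kj}=\partial^{-1}(\Phi^{(n)}_k\Psi^{(n)}_j)$, all $\Phi_1^{(n)}$ being invertible. At the site $n=0$ (index omitted), for all $r,s,k,j\ge1$: $\mathcal L=D+\sum_{i\ge1}u_iD^{-i}$, $$\partial_{t_r}\mathcal L=[(\mathcal L^r)_+,\mathcal L],\quad \partial_{t_r}\Phi_k=(\mathcal L^r)_+(\Phi_k),\quad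 \partial_{t_r}\Psi_k=-((\mathcal L^{*})^r)_+(\Psi_k),\quad \partial_{t_r}S_{kj}=\mathrm{Res}\big(D^{-1}\Psi_j(\mathcal L^r)_+\Phi_kD^{-1}\big)$$ and, with $\mathcal M_s=\sum_{j=1}^s\Phi_{s-j+1}D^{-1}\Psi_j$, $$\partial_{\bar t_s}\mathcal L=[\mathcal M_s,\mathcal L],\quad \partial_{\bar t_s}\Phi_k=\sum_{j=1}^s\Phi_{s-j+1}S_{kj}-\Phi_{k+s},\quad \partial_{\bar t_s}\Psi_k=\sum_{j=1}^s\Psi_jS_{s-j+1,k}+\Psi_{k+s},$$ $$\partial_{\bar t_s}S_{kj}=\sum_{i=1}^sS_{s-i+1,j}S_{ki}-S_{k+s,j}+S_{k,j+s}.$$ For all $n\in\mathbb Z$ the data form a Darboux–Bäcklund (DB) orbit: with $T_n=\Phi_1^{(n)}D\,(\Phi_1^{(n)})^{-1}$ and $k,j\ge1$, $$\mathcal L(n+1)T_n=T_n\mathcal L(n),\quad \Phi_k^{(n+1)}=\Phi_1^{(n)}\partial\Big(\frac{\Phi^{(n)}_{k+1}}{\Phi_1^{(n)}}\Big),\quad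 \Psi_1^{(n+1)}=\frac1{\Phi_1^{(n)}},\quad \Psi_{j+1}^{(n+1)}=-\frac{S^{(n)}_{1j}}{\Phi_1^{(n)}},$$ $$\Phi_{k+1}^{(n)}=\frac{S^{(n+1)}_{k1}}{\Psi_1^{(n+1)}},\quad \Psi_j^{(n)}=-\Psi_1^{(n+1)}\partial\Big(\frac{\Psi_{j+1}^{(n+1)}}{\Psi_1^{(n+1)}}\Big),\quad S^{(n+1)}_{k,j+1}=S^{(n)}_{k+1,j}-\frac{\Phi^{(n)}_{k+1}}{\Phi^{(n)}_1}S^{(n)}_{1j}.$$ The ghost Lax operators are $\bar{\mathcal L}(n)=\bar W_n\bar D\bar W_n^{-1}$, $\bar W_n=1+\sum_{s\ge1}\frac{\Phi_{s+1}^{(n)}}{\Phi_1^{(n)}}\bar D^{-s}$; put $\bar\Phi_1^{(n)}=1/\Phi_1^{(n)}$. A generic eigenfunction of $\mathcal L$ is an orbit $F^{(n)}$ of oscillating functions with $\partial_{t_r}F=(\mathcal L^r)_+(F)$, $\partial_{\bar t_s}F=\mathcal M_s(F)$ at $n=0$ and $F^{(n+1)}=T_n(F^{(n)})$ for all $n$.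 A generic eigenfunction of $\bar{\mathcal L}$ is an orbit $\bar F^{(n)}$ with $\partial_{\bar t_s}\bar F=(\bar{\mathcal L}^s)_+(\bar F)$ at $n=0$ and $\bar F^{(n-1)}=\bar\Phi_1^{(n)}\bar\partial(\bar F^{(n)}/\bar\Phi_1^{(n)})$ for all $n$. **Theorem.** The operators $\bar{\mathcal L}(n)$ exist and are unique, and there are unique $a_k(n),b_k(n)$, $k\ge1$, with $$\mathcal L(n)=D+\sum_{k\ge1}a_k(n)\big(D-\partial\ln\Phi_1^{(n-k)}\big)^{-1}\cdots\big(D-\partial\ln\Phi_1^{(n-1)}\big)^{-1},$$ $$\bar{\mathcal L}(n)=\bar D+\sum_{k\ge1}b_k(n)\big(\bar D-\bar\partial\ln\bar\Phi_1^{(n+k)}\big)^{-1}\cdots\big(\bar D-\bar\partial\ln\bar\Phi_1^{(n+1)}\big)^{-1}.$$ Define infinite matrices $Q,\bar Q$ by ($k\ge1$) $$Q_{n,n+k}=\delta_{k1},\quad Q_{nn}=\partial\ln\Phi_1^{(n)},\quad Q_{n,n-k}=a_k(n),$$ $$\bar Q_{n,n-k}=\delta_{k1}\frac{\Phi_1^{(n)}}{\Phi_1^{(n-1)}},\quad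 \bar Q_{nn}=-\bar\partial\ln\Phi_1^{(n)},\quad \bar Q_{n,n+k}=b_k(n)\frac{\Phi_1^{(n)}}{\Phi_1^{(n+k)}}.$$ Then $\bar Q_{n,n-1}=\Phi_1^{(n)}\Psi_1^{(n)}$ and $\bar Q_{n,n+k}=b_k(n)\Phi^{(n)}_1W_k/W_{k+1}$, where $W_k=\det(\partial^{\alpha-1}\Phi^{(n)}_\beta)_{\alpha,\beta=1}^k$ (and $W_{k+1}$ is invertible). Moreover: 1. For all generic eigenfunctions $F,\bar F$ and all $n$: $\mathcal L(n)(F^{(n)})=\sum_mQ_{nm}F^{(m)}$, $\ \bar{\mathcal L}(n)(\bar F^{(n)})=\sum_m\frac1{\Phi_1^{(n)}}\bar Q_{nm}\Phi_1^{(m)}\bar F^{(m)}$ (sums converging $\lambda^{-1}$-adically), and $\partial_{\bar t_s}(F^{(n)}/\Phi_1^{(n)})=(\bar{\mathcal L}(n)^s)_+(F^{(n)}/\Phi_1^{(n)})$ for $s\ge1$. 2. Let $\psi_0=W(e^{\xi})$ be a Baker–Akhiezer function of $\mathcal L(0)$: $W=1+\sum_{i\ge1}w_iD^{-i}$, $\mathcal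 L W=WD$, $\partial_{t_r}W=-(\mathcal L^r)_-W$, $\partial_{\bar t_s}W=\mathcal M_sW$; and let $\psi_{n+1}=T_n(\psi_n)$ for all $n\in\mathbb Z$. Then for $r,s\ge1$ $$\sum_mQ_{nm}\psi_m=\lambda\psi_n,\quad \partial_{t_r}\psi_n=\sum_m\big((Q^r)_+\big)_{nm}\psi_m,\quad \partial_{\bar t_s}\psi_n=\sum_m\big((\bar Q^s)_-\big)_{nm}\psi_m .$$ 3. For $r,s\ge1$ the 2D Toda lattice Lax equations hold: $$\partial_{t_r}Q=[(Q^r)_+,Q],\quad \partial_{\bar t_s}Q=[(\bar Q^s)_-,Q],\quad \partial_{\bar t_s}\bar Q=[(\bar Q^s)_-,\bar Q],\quad \partial_{t_r}\bar Q=[(Q^r)_+,\bar Q].$$ For matrices, $(\cdot)_+$ is the upper triangular part including the diagonal and $(\cdot)_-$ the strictly lower triangular part. -/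

import Mathlib

/-
Functions of the times `t₁ = x, t₂, …` and `t̄₁, t̄₂, …` are elements of a commutative ring `R` with
commuting derivations `dt r = ∂/∂t_r` and `dtb s = ∂/∂t̄_s` (`r, s ≥ 1`), `∂ = dt 1`, `∂̄ = dtb 1`.
The value at `0` of a family that is indexed from `1` is never used.
-/

noncomputable section

namespace DoubleKP

/-- Series `∑_{j ≤ N} a_j z^j` in one symbol `z`, infinite only in the negative direction. -/
def upSeries (R : Type*) [CommRing R] : Submodule R (ℤ → R) where
  carrier := {a | ∃ N : ℤ, ∀ j, N < j → a j = 0}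
  zero_mem' := ⟨0, fun _ _ => rfl⟩
  add_mem' := by
    rintro a b ⟨N, hN⟩ ⟨M, hM⟩
    refine ⟨max N M, fun j hj => ?_⟩
    have h1 := hN j (lt_of_le_of_lt (le_max_left _ _) hj)
    have h2 := hM j (lt_of_le_of_lt (le_max_right _ _) hj)
    simp [h1, h2]
  smul_mem' := by
    rintro c a ⟨N, hN⟩
    exact ⟨N, fun j hj => by simp [hN j hj]⟩

/-- Pseudo-differential operators `∑_{j ≤ N} a_j D^j`, coefficients on the left. The symbol `D` is
`∂/∂x` or `∂/∂t̄₁`; which of the two is said by the derivation given to `mul`, `act`, etc. -/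
abbrev PDO (R : Type*) [CommRing R] := upSeries R

/-- Formal oscillating functions `(∑_{j ≤ N} f_j λ^j) e^{ξ}` with `ξ = ∑_l t_l λ^l`
(or `ξ̄ = ∑_l t̄_l λ^l`), given by the coefficients `f_j`. -/
abbrev Osc (R : Type*) [CommRing R] := upSeries R

variable {R : Type*} [CommRing R]

/-- The Leibniz rule `D^i ∘ b = ∑_k (i choose k) (d^k b) D^{i-k}`, `i ∈ ℤ`, extended to series. -/
def leibniz (d : Derivation ℤ R R) (A B : upSeries R) : upSeries R :=
  ⟨fun m => ∑ᶠ p : ℤ × ℕ, (Ring.choose p.1 p.2 : ℤ) •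
      (A.1 p.1 * (⇑d)^[p.2] (B.1 (m - p.1 + p.2))), by
    obtain ⟨N, hN⟩ := A.2
    obtain ⟨M, hM⟩ := B.2
    refine ⟨N + M, fun m hm => ?_⟩
    refine (finsum_congr fun p => ?_).trans finsum_zero
    by_cases h : N < p.1
    · simp [hN _ h]
    · have h2 : B.1 (m - p.1 + p.2) = 0 := hM _ (by omega)
      have h3 : (⇑d)^[p.2] (0 : R) = 0 := Function.iterate_fixed (map_zero d) _
      rw [h2, h3]; simp⟩

/-- Product of pseudo-differential operators. -/
def mul (d : Derivation ℤ R R) (A B : PDO R) : PDO R := leibniz d A B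

/-- Action of an operator on an oscillating function:
`D^i (f λ^j e^ξ) = ∑_k (i choose k) (∂^k f) λ^{i-k+j} e^ξ` for every integer `i`. -/
def act (d : Derivation ℤ R R) (A : PDO R) (F : Osc R) : Osc R := leibniz d A F

/-- `c z^i`. -/
def mono (i : ℤ) (c : R) : upSeries R :=
  ⟨fun j => if j = i then c else 0, i, fun j hj => by simp [hj.ne']⟩

/-- Multiplication by a function, as an operator. -/
def C (f : R) : PDO R := mono 0 f

/-- The operator `D`. -/
def D : PDO R := mono 1 1

/-- The operator `D⁻¹`. -/
def Dinv : PDO R := mono (-1) 1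

/-- `A^r`. -/
def pow (d : Derivation ℤ R R) (A : PDO R) : ℕ → PDO R
  | 0 => C 1
  | r + 1 => mul d A (pow d A r)

/-- `[A, B]`. -/
def comm (d : Derivation ℤ R R) (A B : PDO R) : PDO R := mul d A B - mul d B A

/-- The purely differential part `A₊`. -/
def plusPart (A : PDO R) : PDO R :=
  ⟨fun j => if 0 ≤ j then A.1 j else 0, by
    obtain ⟨N, hN⟩ := A.2
    exact ⟨N, fun j hj => by simp [hN j hj]⟩⟩

/-- The purely pseudo-differential part `A₋`. -/
def minusPart (A : PDO R) : PDO R := A - plusPart A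

/-- The residue, i.e. the coefficient of `D⁻¹`. -/
def res (A : PDO R) : R := A.1 (-1)

/-- The formal adjoint `(∑ a_j D^j)^* = ∑ (-D)^j a_j`. -/
def adjoint (d : Derivation ℤ R R) (A : PDO R) : PDO R :=
  ⟨fun m => ∑ᶠ k : ℕ, ((m + k).negOnePow : ℤ) • (Ring.choose (m + k) k : ℤ) •
      (⇑d)^[k] (A.1 (m + k)), by
    obtain ⟨N, hN⟩ := A.2
    refine ⟨N, fun m hm => ?_⟩
    refine (finsum_congr fun k => ?_).trans finsum_zero
    have h3 : (⇑d)^[k] (0 : R) = 0 := Function.iterate_fixed (map_zero d) _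
    rw [hN _ (by omega), h3]; simp⟩

/-- Action of a differential operator on a function; only the coefficients of `D^i`, `i ≥ 0`,
are used. -/
def applyFun (d : Derivation ℤ R R) (A : PDO R) (f : R) : R :=
  ∑ᶠ i : ℕ, A.1 i * (⇑d)^[i] f

/-- A derivation applied to all coefficients: the derivative of an operator, or the derivative of
an oscillating function along a time that does not occur in its exponential. -/
def coeffDeriv (d : Derivation ℤ R R) (A : upSeries R) : upSeries R :=
  ⟨fun j => d (A.1 j), by
    obtain ⟨N, hN⟩ := A.2
    exact ⟨N, fun j hj => by simp [hN j hj]⟩⟩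

/-- Multiplication of an oscillating function by `λ^r`. -/
def lam (r : ℕ) (F : Osc R) : Osc R :=
  ⟨fun j => F.1 (j - r), by
    obtain ⟨N, hN⟩ := F.2
    exact ⟨N + r, fun j hj => hN _ (by omega)⟩⟩

/-- The derivative `(∂f + λ^r f) e^ξ` of `f e^ξ` along the `r`-th time of the exponential. -/
def oscDeriv (d : Derivation ℤ R R) (r : ℕ) (F : Osc R) : Osc R := coeffDeriv d F + lam r F

/-- Action of a differential operator in a time that does not occur in the exponential. -/
def actCoeff (d : Derivation ℤ R R) (A : PDO R) (F : Osc R) : Osc R :=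
  ∑ᶠ i : ℕ, A.1 i • (coeffDeriv d)^[i] F

/-- The formal series `∑ f_i` of series in `z` converges `z⁻¹`-adically to `g`. -/
def IsSum {ι : Type*} (f : ι → upSeries R) (g : upSeries R) : Prop :=
  (∀ N : ℤ, {i | ∃ j, N ≤ j ∧ (f i).1 j ≠ 0}.Finite) ∧ ∀ j, ∑ᶠ i, (f i).1 j = g.1 j

/-- The operator `u D u⁻¹ = D - ∂ ln u`, for an invertible function `u`. -/
def darboux (d : Derivation ℤ R R) (u : R) : PDO R := mul d (mul d (C u) D) (C (Ring.inverse u))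

/-- Its inverse `(D - ∂ ln u)⁻¹ = u D⁻¹ u⁻¹`. -/
def darbouxInv (d : Derivation ℤ R R) (u : R) : PDO R :=
  mul d (mul d (C u) Dinv) (C (Ring.inverse u))

/-- The Wronskian `det (∂^{α-1} f_β)`, `α, β = 1, …, k`. -/
def wronskian (d : Derivation ℤ R R) (f : ℕ → R) (k : ℕ) : R :=
  (Matrix.of fun α β : Fin k => (⇑d)^[(α : ℕ)] (f ((β : ℕ) + 1))).det

/-- A Lax operator `L`, functions `Φ_j`, `Ψ_j` (`j ≥ 1`), and the inverse derivatives
`S k j = ∂⁻¹(Φ_k Ψ_j)`. -/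
structure KPData (R : Type*) [CommRing R] where
  L : PDO R
  Φ : ℕ → R
  Ψ : ℕ → R
  S : ℕ → ℕ → R

/-- The ghost symmetry generator `M_s = ∑_{j=1}^s Φ_{s-j+1} D⁻¹ Ψ_j`. -/
def KPData.M (X : KPData R) (d : Derivation ℤ R R) (s : ℕ) : PDO R :=
  ∑ j ∈ Finset.Icc 1 s, mul d (mul d (C (X.Φ (s + 1 - j))) Dinv) (C (X.Ψ j))

/-- The Darboux–Bäcklund operator `T = Φ₁ D Φ₁⁻¹`. -/
def KPData.T (X : KPData R) (d : Derivation ℤ R R) : PDO R := darboux d (X.Φ 1)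

/-- The KP hierarchy with eigenfunctions `Φ_j`, adjoint eigenfunctions `Ψ_j`, squared
eigenfunction potentials `S k j = ∂⁻¹(Φ_k Ψ_j)`, and the ghost flows `∂/∂t̄_s`. -/
structure IsGhostKP (dt dtb : ℕ → Derivation ℤ R R) (X : KPData R) : Prop where
  /-- `L = D + ∑_{i ≥ 1} u_i D^{-i}` -/
  lead : X.L.1 1 = 1 ∧ X.L.1 0 = 0 ∧ ∀ j, 1 < j → X.L.1 j = 0
  lax : ∀ r, 1 ≤ r →
    coeffDeriv (dt r) X.L = comm (dt 1) (plusPart (pow (dt 1) X.L r)) X.L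
  eigen : ∀ r k, 1 ≤ r → 1 ≤ k →
    dt r (X.Φ k) = applyFun (dt 1) (plusPart (pow (dt 1) X.L r)) (X.Φ k)
  adjEigen : ∀ r k, 1 ≤ r → 1 ≤ k →
    dt r (X.Ψ k) = - applyFun (dt 1) (plusPart (pow (dt 1) (adjoint (dt 1) X.L) r)) (X.Ψ k)
  /-- `∂S/∂t_r = Res (D⁻¹ Ψ (L^r)₊ Φ D⁻¹)`; for `r = 1` this is `∂S = Φ Ψ`. -/
  pot : ∀ r k j, 1 ≤ r → 1 ≤ k → 1 ≤ j →
    dt r (X.S k j) = res (mul (dt 1) (mul (dt 1) Dinv (C (X.Ψ j)))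
      (mul (dt 1) (plusPart (pow (dt 1) X.L r)) (mul (dt 1) (C (X.Φ k)) Dinv)))
  ghost : ∀ s, 1 ≤ s → coeffDeriv (dtb s) X.L = comm (dt 1) (X.M (dt 1) s) X.L
  ghostEigen : ∀ s k, 1 ≤ s → 1 ≤ k →
    dtb s (X.Φ k) = (∑ j ∈ Finset.Icc 1 s, X.Φ (s + 1 - j) * X.S k j) - X.Φ (k + s)
  ghostAdj : ∀ s k, 1 ≤ s → 1 ≤ k →
    dtb s (X.Ψ k) = (∑ j ∈ Finset.Icc 1 s, X.Ψ j * X.S (s + 1 - j) k) + X.Ψ (k + s)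
  /-- the same flow on `∂⁻¹(Φ_k Ψ_j)`: `∂⁻¹` of the derivative of `Φ_k Ψ_j`, by parts -/
  ghostPot : ∀ s k j, 1 ≤ s → 1 ≤ k → 1 ≤ j →
    dtb s (X.S k j) = (∑ i ∈ Finset.Icc 1 s, X.S (s + 1 - i) j * X.S k i)
      - X.S (k + s) j + X.S k (j + s)

/-- `Y` is the (non-standard) Darboux–Bäcklund transform of `X`, and `X` the adjoint transform
of `Y`. -/
structure IsDB (d : Derivation ℤ R R) (X Y : KPData R) : Prop where
  /-- `L_Y = T L_X T⁻¹` -/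
  lax : mul d Y.L (X.T d) = mul d (X.T d) X.L
  phi : ∀ l, 1 ≤ l → Y.Φ l = X.Φ 1 * d (X.Φ (l + 1) * Ring.inverse (X.Φ 1))
  psi_one : Y.Ψ 1 = Ring.inverse (X.Φ 1)
  psi : ∀ j, 1 ≤ j → Y.Ψ (j + 1) = - (Ring.inverse (X.Φ 1) * X.S 1 j)
  phi_back : ∀ l, 1 ≤ l → X.Φ (l + 1) = Ring.inverse (Y.Ψ 1) * Y.S l 1
  psi_back : ∀ j, 1 ≤ j → X.Ψ j = - (Y.Ψ 1 * d (Y.Ψ (j + 1) * Ring.inverse (Y.Ψ 1)))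
  /-- `∂⁻¹(Φ_k Ψ_{j+1})` at `Y`, integrated by parts -/
  pot : ∀ k j, 1 ≤ k → 1 ≤ j →
    Y.S k (j + 1) = X.S (k + 1) j - X.Φ (k + 1) * Ring.inverse (X.Φ 1) * X.S 1 j

/-- The dressing operator `W̄ = 1 + ∑_{s ≥ 1} (Φ_{s+1}/Φ₁) D̄^{-s}` of the ghost Lax operator. -/
def KPData.Wbar (X : KPData R) : PDO R :=
  ⟨fun j => if j ≤ 0 then X.Φ ((-j).toNat + 1) * Ring.inverse (X.Φ 1) else 0, 0,
    fun j hj => by simp [not_le.mpr hj]⟩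

/-- `L̄ = W̄ D̄ W̄⁻¹`. -/
def IsGhostLax (db : Derivation ℤ R R) (X : KPData R) (Lb : PDO R) : Prop :=
  mul db Lb X.Wbar = mul db X.Wbar D

/-- A generic eigenfunction with its Darboux–Bäcklund orbit `F^{(n)}`: the isospectral and the
ghost flows at the initial site, and `F^{(n+1)} = Φ₁^{(n)} ∂ (F^{(n)} / Φ₁^{(n)})`. -/
structure IsGenericEF (dt dtb : ℕ → Derivation ℤ R R) (X : ℤ → KPData R) (F : ℤ → Osc R) :
    Prop where
  flow : ∀ r, 1 ≤ r →
    oscDeriv (dt r) r (F 0) = act (dt 1) (plusPart (pow (dt 1) (X 0).L r)) (F 0)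
  ghost : ∀ s, 1 ≤ s → coeffDeriv (dtb s) (F 0) = act (dt 1) ((X 0).M (dt 1) s) (F 0)
  db : ∀ n, F (n + 1) = act (dt 1) ((X n).T (dt 1)) (F n)

/-- A generic eigenfunction of the ghost Lax operators with its Darboux–Bäcklund orbit:
`∂F̄/∂t̄_s = (L̄^s)₊ F̄` at the initial site, and
`F̄^{(n-1)} = Φ̄₁^{(n)} ∂̄ (F̄^{(n)} / Φ̄₁^{(n)})` with `Φ̄₁^{(n)} = 1/Φ₁^{(n)}`. -/
structure IsGenericEFBar (dtb : ℕ → Derivation ℤ R R) (X : ℤ → KPData R) (Lb : ℤ → PDO R)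
    (G : ℤ → Osc R) : Prop where
  flow : ∀ s, 1 ≤ s →
    oscDeriv (dtb s) s (G 0) = act (dtb 1) (plusPart (pow (dtb 1) (Lb 0) s)) (G 0)
  db : ∀ n, G (n - 1) = act (dtb 1) (darboux (dtb 1) (Ring.inverse ((X n).Φ 1))) (G n)

/-- The orbit `ψ_n` of the Baker–Akhiezer function `ψ_0 = W(e^ξ)` of the initial site. -/
def IsBakerAkhiezer (dt dtb : ℕ → Derivation ℤ R R) (X : ℤ → KPData R) (ψ : ℤ → Osc R) : Prop :=
  (∃ W : PDO R, (W.1 0 = 1 ∧ ∀ j, 0 < j → W.1 j = 0) ∧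
    mul (dt 1) (X 0).L W = mul (dt 1) W D ∧
    (∀ r, 1 ≤ r →
      coeffDeriv (dt r) W = - mul (dt 1) (minusPart (pow (dt 1) (X 0).L r)) W) ∧
    (∀ s, 1 ≤ s → coeffDeriv (dtb s) W = mul (dt 1) ((X 0).M (dt 1) s) W) ∧
    ψ 0 = act (dt 1) W (mono 0 1)) ∧
  ∀ n, ψ (n + 1) = act (dt 1) ((X n).T (dt 1)) (ψ n)

/-- `(D - ∂ ln Φ₁^{(n-k)})⁻¹ ⋯ (D - ∂ ln Φ₁^{(n-1)})⁻¹`. -/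
def word (d : Derivation ℤ R R) (X : ℤ → KPData R) (n : ℤ) : ℕ → PDO R
  | 0 => C 1
  | k + 1 => mul d (darbouxInv d ((X (n - (k + 1))).Φ 1)) (word d X n k)

/-- `(D̄ - ∂̄ ln Φ̄₁^{(n+k)})⁻¹ ⋯ (D̄ - ∂̄ ln Φ̄₁^{(n+1)})⁻¹`, `Φ̄₁ = 1/Φ₁`. -/
def wordBar (db : Derivation ℤ R R) (X : ℤ → KPData R) (n : ℤ) : ℕ → PDO R
  | 0 => C 1
  | k + 1 => mul db (darbouxInv db (Ring.inverse ((X (n + (k + 1))).Φ 1))) (wordBar db X n k)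

/-- `L(n) = D + ∑_{k ≥ 1} a_k(n) (D - ∂ ln Φ₁^{(n-k)})⁻¹ ⋯ (D - ∂ ln Φ₁^{(n-1)})⁻¹` for all `n`. -/
def IsExpansion (d : Derivation ℤ R R) (X : ℤ → KPData R) (a : ℤ → ℕ → R) : Prop :=
  ∀ n, IsSum (fun k : ℕ => a n (k + 1) • word d X n (k + 1)) ((X n).L - D)

/-- `L̄(n) = D̄ + ∑_{k ≥ 1} b_k(n) (D̄ - ∂̄ ln Φ̄₁^{(n+k)})⁻¹ ⋯ (D̄ - ∂̄ ln Φ̄₁^{(n+1)})⁻¹` for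
all `n`. -/
def IsExpansionBar (db : Derivation ℤ R R) (X : ℤ → KPData R) (Lb : ℤ → PDO R)
    (b : ℤ → ℕ → R) : Prop :=
  ∀ n, IsSum (fun k : ℕ => b n (k + 1) • wordBar db X n (k + 1)) (Lb n - D)

/-- The matrix `Q`. -/
def matQ (d : Derivation ℤ R R) (X : ℤ → KPData R) (a : ℤ → ℕ → R) : Matrix ℤ ℤ R := fun n m =>
  if m = n + 1 then 1
  else if m = n then d ((X n).Φ 1) * Ring.inverse ((X n).Φ 1)
  else if m < n then a n (n - m).toNat
  else 0

/-- The matrix `Q̄`. -/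
def matQbar (db : Derivation ℤ R R) (X : ℤ → KPData R) (b : ℤ → ℕ → R) : Matrix ℤ ℤ R :=
  fun n m =>
  if m = n - 1 then (X n).Φ 1 * Ring.inverse ((X (n - 1)).Φ 1)
  else if m = n then - (db ((X n).Φ 1) * Ring.inverse ((X n).Φ 1))
  else if n < m then b n (m - n).toNat * ((X n).Φ 1 * Ring.inverse ((X m).Φ 1))
  else 0

/-- Product of infinite matrices (used only where every entry is a finite sum). -/
def matMul (A B : Matrix ℤ ℤ R) : Matrix ℤ ℤ R := fun n m => ∑ᶠ l, A n l * B l m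

/-- Powers of an infinite matrix. -/
def matPow (A : Matrix ℤ ℤ R) : ℕ → Matrix ℤ ℤ R
  | 0 => 1
  | r + 1 => matMul A (matPow A r)

/-- Commutator of infinite matrices. -/
def matComm (A B : Matrix ℤ ℤ R) : Matrix ℤ ℤ R := matMul A B - matMul B A

/-- Upper triangular part, with the diagonal. -/
def matUpper (A : Matrix ℤ ℤ R) : Matrix ℤ ℤ R := fun n m => if n ≤ m then A n m else 0

/-- Strictly lower triangular part. -/
def matLower (A : Matrix ℤ ℤ R) : Matrix ℤ ℤ R := fun n m => if m < n then A n m else 0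

end DoubleKP

end

open DoubleKP

/-! Iterating the Darboux operators from the identity gives operators `V n` of order n with leading
coefficient 1. Every orbit is F^{(n)} = V_n F^{(0)} (`IsOrbit.eq_mul`), and L(n) V_n = V_n L(0)
(`lax_mul`). On the ghost side the series χ_n = ∑ Φ_k^{(n)} z^{1-k-n} has order -n and leading
coefficient Φ_1^{(n)}. Divided by Φ_1^{(n)} it is W̄_n z^{-n}, so L̄(n) acts on the quotient as
right multiplication by z.

The heart of the proof is that the R-module spanned by the pairs (V_n, χ_n) is stable under every
flow: ∂_{t_r} + ·(L^r)_+ on operators with ∂_{t_r} on series, and ∂_{t̄_s} + ·M_s on operators with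
∂_{t̄_s} + z^s on series (`flow_pair_mem`, `ghost_pair_mem`). These flows commute with D, and D
sends (V_n, χ_n) to (V_{n+1}, χ_{n+1}) plus a multiple of (V_n, χ_n). Hence the hypotheses at site 0
suffice for n ≥ 0. For n < 0 the pairs are combinations of the potential pairs (D⁻¹Ψ_j, σ_j) at site
0, and the equations for Ψ_j and S_{kj} say how those move.

The flow of (V_n, χ_n) is therefore a finite combination ∑ c_m (V_m, χ_m), with the same c_m in both
components. Since V_m has order m and χ_m has order -m, the first component determines c_m for m ≥ n
and the second for m < n. For t_r the first component agrees with V_n L^r = ∑ (Q^r)_{nm} V_m in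
degrees ≥ n, and the second forces c_m = 0 below n, so c is the row of (Q^r)_+. For t̄_s the first
component forces c_m = 0 for m ≥ n, and the second agrees with z^s χ_n = ∑ (Q̄^s)_{nm} χ_m in
degrees > -n, so c is the row of (Q̄^s)_- (`exists_flow_comb`, `exists_ghost_comb'`).

Multiplying by F^{(0)} on the right gives the linear system. The Lax equations are the compatibility
of these flows with Q V = V L(0) and Q̄ χ = χ z, where V and χ can be cancelled because they are
triangular with invertible diagonal (`lax_of_dressing`). -/

noncomputable section
namespace DoubleKP

variable {R : Type*} [CommRing R]

/-! ### Finite sums over integer intervals and the ring of matrices bounded above -/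

lemma finsum_eq_sum_Icc {M : Type*} [AddCommMonoid M] {f : ℤ → M} (a b : ℤ)
    (h : ∀ i, f i ≠ 0 → a ≤ i ∧ i ≤ b) : ∑ᶠ i, f i = ∑ i ∈ Finset.Icc a b, f i :=
  finsum_eq_sum_of_support_subset f fun i hi => by
    simpa using h i hi

/-- The entries vanish above some diagonal. -/
def UB (A : Matrix ℤ ℤ R) : Prop := ∃ r : ℤ, ∀ n m, n + r < m → A n m = 0

lemma matMul_eq_sum {A B : Matrix ℤ ℤ R} {r s : ℤ} {n m a b : ℤ}
    (hA : ∀ n m, n + r < m → A n m = 0) (hB : ∀ n m, n + s < m → B n m = 0)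
    (ha : a ≤ m - s) (hb : n + r ≤ b) :
    matMul A B n m = ∑ l ∈ Finset.Icc a b, A n l * B l m := by
  refine finsum_eq_sum_Icc a b fun l hl => ⟨?_, ?_⟩
  · by_contra h
    exact hl (by rw [hB l m (by omega), mul_zero])
  · by_contra h
    exact hl (by rw [hA n l (by omega), zero_mul])

lemma matMul_bound {A B : Matrix ℤ ℤ R} {r s : ℤ}
    (hA : ∀ n m, n + r < m → A n m = 0) (hB : ∀ n m, n + s < m → B n m = 0) :
    ∀ n m, n + (r + s) < m → matMul A B n m = 0 := by
  intro n m h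
  rw [matMul_eq_sum hA hB le_rfl le_rfl, Finset.Icc_eq_empty (by omega), Finset.sum_empty]

variable (R) in
/-- Infinite matrices whose entries vanish above some diagonal. -/
structure UBMat where
  val : Matrix ℤ ℤ R
  ub : UB val

namespace UBMat

@[ext] lemma ext {A B : UBMat R} (h : ∀ n m, A.1 n m = B.1 n m) : A = B := by
  cases A
  cases B
  congr
  exact Matrix.ext h

instance : Zero (UBMat R) := ⟨⟨0, 0, fun _ _ _ => rfl⟩⟩
instance : One (UBMat R) := ⟨⟨1, 0, fun _ _ h => Matrix.one_apply_ne (by omega)⟩⟩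
instance : Add (UBMat R) := ⟨fun A B => ⟨A.1 + B.1, by
  obtain ⟨r, hr⟩ := A.2
  obtain ⟨s, hs⟩ := B.2
  refine ⟨max r s, fun n m h => ?_⟩
  rw [Matrix.add_apply, hr n m (by omega), hs n m (by omega), add_zero]⟩⟩
instance : Neg (UBMat R) := ⟨fun A => ⟨-A.1, by
  obtain ⟨r, hr⟩ := A.2
  exact ⟨r, fun n m h => by rw [Matrix.neg_apply, hr n m h, neg_zero]⟩⟩⟩
instance : Mul (UBMat R) := ⟨fun A B => ⟨matMul A.1 B.1, by
  obtain ⟨r, hr⟩ := A.2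
  obtain ⟨s, hs⟩ := B.2
  exact ⟨r + s, matMul_bound hr hs⟩⟩⟩

@[simp] lemma zero_apply (n m : ℤ) : (0 : UBMat R).1 n m = 0 := rfl
lemma one_val : (1 : UBMat R).1 = 1 := rfl
@[simp] lemma add_apply (A B : UBMat R) (n m : ℤ) : (A + B).1 n m = A.1 n m + B.1 n m := rfl
@[simp] lemma neg_apply (A : UBMat R) (n m : ℤ) : (-A).1 n m = -A.1 n m := rfl
lemma mul_val (A B : UBMat R) : (A * B).1 = matMul A.1 B.1 := rfl

/-- The bounds on the diagonals confine both intermediate indices to intervals depending only on the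
outer indices, so both bracketings are sums over one finite box. -/
lemma mul_assoc' (A B C : UBMat R) : A * B * C = A * (B * C) := by
  obtain ⟨r, hr⟩ := A.2
  obtain ⟨s, hs⟩ := B.2
  obtain ⟨t, ht⟩ := C.2
  ext n m
  have e1 : ∀ l ∈ Finset.Icc (m - t) (n + (r + s)), matMul A.1 B.1 n l * C.1 l m =
      ∑ k ∈ Finset.Icc (m - (s + t)) (n + r), A.1 n k * B.1 k l * C.1 l m := by
    intro l hl
    rw [Finset.mem_Icc] at hl
    rw [matMul_eq_sum hr hs (a := m - (s + t)) (by omega) le_rfl, Finset.sum_mul]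
  have e2 : ∀ k ∈ Finset.Icc (m - (s + t)) (n + r), A.1 n k * matMul B.1 C.1 k m =
      ∑ l ∈ Finset.Icc (m - t) (n + (r + s)), A.1 n k * B.1 k l * C.1 l m := by
    intro k hk
    rw [Finset.mem_Icc] at hk
    rw [matMul_eq_sum hs ht (b := n + (r + s)) le_rfl (by omega), Finset.mul_sum]
    simp only [mul_assoc]
  rw [mul_val, mul_val, mul_val, mul_val,
    matMul_eq_sum (matMul_bound hr hs) ht le_rfl le_rfl, Finset.sum_congr rfl e1,
    matMul_eq_sum hr (matMul_bound hs ht) le_rfl le_rfl, Finset.sum_congr rfl e2, Finset.sum_comm]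

instance : AddCommGroup (UBMat R) where
  add_assoc A B C := by ext; simp [add_assoc]
  zero_add A := by ext; simp
  add_zero A := by ext; simp
  add_comm A B := by ext; simp [add_comm]
  neg_add_cancel A := by ext; simp
  nsmul := nsmulRec
  zsmul := zsmulRec

lemma bounds₃ (A B C : UBMat R) : ∃ r, (∀ n m, n + r < m → A.1 n m = 0) ∧
    (∀ n m, n + r < m → B.1 n m = 0) ∧ (∀ n m, n + r < m → C.1 n m = 0) ∧
    (∀ n m, n + r < m → (A + B).1 n m = 0) := by
  obtain ⟨r, hr⟩ := A.2
  obtain ⟨s, hs⟩ := B.2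
  obtain ⟨t, ht⟩ := C.2
  refine ⟨max r (max s t), fun n m h => hr _ _ (by omega), fun n m h => hs _ _ (by omega),
    fun n m h => ht _ _ (by omega), fun n m h => ?_⟩
  rw [add_apply, hr _ _ (by omega), hs _ _ (by omega), add_zero]

instance : Ring (UBMat R) :=
  { (inferInstance : AddCommGroup (UBMat R)) with
    mul := (· * ·)
    one := 1
    mul_assoc := mul_assoc'
    left_distrib := fun A B C => by
      obtain ⟨r, h1, h2, h3, h4⟩ := bounds₃ B C A
      ext n m
      rw [add_apply, mul_val, mul_val, mul_val, matMul_eq_sum h3 h4 le_rfl le_rfl,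
        matMul_eq_sum h3 h1 le_rfl le_rfl, matMul_eq_sum h3 h2 le_rfl le_rfl,
        ← Finset.sum_add_distrib]
      simp [mul_add]
    right_distrib := fun A B C => by
      obtain ⟨r, h1, h2, h3, h4⟩ := bounds₃ A B C
      ext n m
      rw [add_apply, mul_val, mul_val, mul_val, matMul_eq_sum h4 h3 le_rfl le_rfl,
        matMul_eq_sum h1 h3 le_rfl le_rfl, matMul_eq_sum h2 h3 le_rfl le_rfl,
        ← Finset.sum_add_distrib]
      simp [add_mul]
    zero_mul := fun A => by
      ext n m
      rw [mul_val]
      simp [matMul]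
    mul_zero := fun A => by
      ext n m
      rw [mul_val]
      simp [matMul]
    one_mul := fun A => by
      ext n m
      refine (finsum_eq_single _ n fun l hl => ?_).trans ?_
      · rw [one_val, Matrix.one_apply_ne hl.symm, zero_mul]
      · rw [one_val, Matrix.one_apply_eq, one_mul]
    mul_one := fun A => by
      ext n m
      refine (finsum_eq_single _ m fun l hl => ?_).trans ?_
      · rw [one_val, Matrix.one_apply_ne hl, mul_zero]
      · rw [one_val, Matrix.one_apply_eq, mul_one] }

@[simp] lemma sub_apply (A B : UBMat R) (n m : ℤ) : (A - B).1 n m = A.1 n m - B.1 n m := by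
  rw [sub_eq_add_neg, add_apply, neg_apply, sub_eq_add_neg]

lemma pow_val (A : UBMat R) (r : ℕ) : (A ^ r).1 = matPow A.1 r := by
  induction r with
  | zero => rw [pow_zero]; rfl
  | succ r ih => rw [pow_succ', mul_val, ih]; rfl

/-- A derivation applied to all entries. -/
def deriv (e : Derivation ℤ R R) (A : UBMat R) : UBMat R := ⟨A.1.map e, by
  obtain ⟨r, hr⟩ := A.2
  exact ⟨r, fun n m h => by rw [Matrix.map_apply, hr n m h, map_zero]⟩⟩

lemma deriv_apply (e : Derivation ℤ R R) (A : UBMat R) (n m : ℤ) :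
    (A.deriv e).1 n m = e (A.1 n m) := rfl

lemma deriv_mul (e : Derivation ℤ R R) (A B : UBMat R) :
    (A * B).deriv e = A.deriv e * B + A * B.deriv e := by
  obtain ⟨r, hr⟩ := A.2
  obtain ⟨s, hs⟩ := B.2
  have hr' : ∀ n m, n + r < m → (A.deriv e).1 n m = 0 := fun n m h => by
    rw [deriv_apply, hr n m h, map_zero]
  have hs' : ∀ n m, n + s < m → (B.deriv e).1 n m = 0 := fun n m h => by
    rw [deriv_apply, hs n m h, map_zero]
  ext n m
  rw [add_apply, deriv_apply, mul_val, mul_val, mul_val, matMul_eq_sum hr hs le_rfl le_rfl,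
    matMul_eq_sum hr' hs le_rfl le_rfl, matMul_eq_sum hr hs' le_rfl le_rfl, map_sum,
    ← Finset.sum_add_distrib]
  refine Finset.sum_congr rfl fun l _ => ?_
  rw [Derivation.leibniz, deriv_apply, deriv_apply, smul_eq_mul, smul_eq_mul]
  ring

/-- If `V` diagonalizes `Q` to `L`, and `V` and `L` evolve by gauge equivalent flows, then `Q`
satisfies a Lax equation. -/
lemma lax_of_dressing (e : Derivation ℤ R R) {Q V L N B : UBMat R} (hQ : Q * V = V * L)
    (hV : V.deriv e = N * V - V * B) (hL : L.deriv e = B * L - L * B)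
    (hcancel : ∀ A : UBMat R, A * V = 0 → A = 0) : Q.deriv e = N * Q - Q * N := by
  -- In the differentiated relation Q V = V L the terms V B L cancel. What remains is (Q' - [N, Q])
  -- V = (Q V - V L) B = 0.
  have h := congrArg (deriv e) hQ
  rw [deriv_mul, deriv_mul, hV, hL] at h
  refine sub_eq_zero.1 (hcancel _ ?_)
  have e1 : Q.deriv e * V = (N * V - V * B) * L + V * (B * L - L * B) - Q * (N * V - V * B) :=
    eq_sub_of_add_eq h
  have e2 : Q * V * B = V * L * B := by rw [hQ]
  have e3 : N * (Q * V) = N * (V * L) := by rw [hQ]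
  calc (Q.deriv e - (N * Q - Q * N)) * V
      = Q.deriv e * V - N * (Q * V) + Q * N * V := by noncomm_ring
    _ = Q * V * B - V * L * B := by rw [e1, e3]; noncomm_ring
    _ = 0 := by rw [e2, sub_self]

end UBMat
end DoubleKP
end

noncomputable section
namespace DoubleKP

variable {R : Type*} [CommRing R]

/-! ### The Leibniz product -/

/-- The coefficients of `z^j`, `j > N`, vanish. -/
def OrdLE (A : upSeries R) (N : ℤ) : Prop := ∀ j, N < j → A.1 j = 0

lemma OrdLE.mono {A : upSeries R} {N M : ℤ} (h : OrdLE A N) (hNM : N ≤ M) : OrdLE A M :=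
  fun j hj => h j (by omega)

lemma exists_ordLE (A : upSeries R) : ∃ N, OrdLE A N := A.2

lemma OrdLE.add {A B : upSeries R} {N : ℤ} (hA : OrdLE A N) (hB : OrdLE B N) :
    OrdLE (A + B) N := fun j hj => by
  change A.1 j + B.1 j = 0
  rw [hA j hj, hB j hj, add_zero]

lemma OrdLE.neg {A : upSeries R} {N : ℤ} (hA : OrdLE A N) : OrdLE (-A) N := fun j hj => by
  change -A.1 j = 0
  rw [hA j hj, neg_zero]

lemma OrdLE.sub {A B : upSeries R} {N : ℤ} (hA : OrdLE A N) (hB : OrdLE B N) :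
    OrdLE (A - B) N := by
  rw [sub_eq_add_neg]
  exact hA.add hB.neg

lemma OrdLE.smul {A : upSeries R} {N : ℤ} (hA : OrdLE A N) (c : R) : OrdLE (c • A) N :=
  fun j hj => by
    change c * A.1 j = 0
    rw [hA j hj, mul_zero]

lemma ordLE_mono (i : ℤ) (c : R) : OrdLE (mono i c) i := fun j hj => by simp [DoubleKP.mono, hj.ne']

lemma ordLE_coeffDeriv {A : upSeries R} {N : ℤ} (hA : OrdLE A N) (e : Derivation ℤ R R) :
    OrdLE (coeffDeriv e A) N := fun j hj => by
  change e (A.1 j) = 0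
  rw [hA j hj, map_zero]

lemma upSeries.ext {A B : upSeries R} (h : ∀ j, A.1 j = B.1 j) : A = B :=
  Subtype.ext (funext h)

@[simp] lemma add_coeff (A B : upSeries R) (j : ℤ) : (A + B).1 j = A.1 j + B.1 j := rfl
@[simp] lemma sub_coeff (A B : upSeries R) (j : ℤ) : (A - B).1 j = A.1 j - B.1 j := rfl
@[simp] lemma smul_coeff (c : R) (A : upSeries R) (j : ℤ) : (c • A).1 j = c * A.1 j := rfl
@[simp] lemma zero_coeff (j : ℤ) : (0 : upSeries R).1 j = 0 := rfl
@[simp] lemma coeffDeriv_coeff (e : Derivation ℤ R R) (A : upSeries R) (j : ℤ) :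
    (coeffDeriv e A).1 j = e (A.1 j) := rfl
lemma mono_coeff (i : ℤ) (c : R) (j : ℤ) : (mono i c).1 j = if j = i then c else 0 := rfl
@[simp] lemma lam_coeff (r : ℕ) (A : upSeries R) (j : ℤ) : (lam r A).1 j = A.1 (j - r) := rfl
@[simp] lemma mono_self (i : ℤ) (c : R) : (mono i c).1 i = c := if_pos rfl

lemma sum_coeff {ι : Type*} (s : Finset ι) (f : ι → upSeries R) (j : ℤ) :
    (∑ i ∈ s, f i).1 j = ∑ i ∈ s, (f i).1 j := by
  rw [AddSubmonoidClass.coe_finsetSum, Finset.sum_apply]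

variable (d : Derivation ℤ R R)

@[simp] lemma iterate_zero' (k : ℕ) : (⇑d)^[k] (0 : R) = 0 := iterate_map_zero d k

/-- The composition of `z^i` with a series. -/
def zpowMul (i : ℤ) (F : upSeries R) : upSeries R :=
  ⟨fun m => ∑ᶠ k : ℕ, (Ring.choose i k : ℤ) • (⇑d)^[k] (F.1 (m - i + k)), by
    obtain ⟨M, hM⟩ := F.2
    refine ⟨M + i, fun m hm => (finsum_congr fun k => ?_).trans finsum_zero⟩
    rw [hM _ (by omega), iterate_zero', smul_zero]⟩

/-- Any sufficiently large `K` is allowed, so that several such sums can be given a common range. -/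
lemma zpowMul_coeff (i : ℤ) {F : upSeries R} {M m : ℤ} (hM : OrdLE F M) {K : ℕ}
    (hK : M < m - i + K) : (zpowMul d i F).1 m =
      ∑ k ∈ Finset.range K, (Ring.choose i k : ℤ) • (⇑d)^[k] (F.1 (m - i + k)) := by
  refine finsum_eq_sum_of_support_subset _ fun k hk => ?_
  by_contra h
  simp only [Finset.coe_range, Set.mem_Iio, not_lt] at h
  exact hk (by simp only; rw [hM _ (by omega), iterate_zero', smul_zero])

lemma ordLE_zpowMul (i : ℤ) {F : upSeries R} {M : ℤ} (hM : OrdLE F M) :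
    OrdLE (zpowMul d i F) (i + M) := fun m hm => by
  rw [zpowMul_coeff d i hM (K := 0) (by push_cast; omega), Finset.range_zero, Finset.sum_empty]

lemma zpowMul_lead (i : ℤ) {F : upSeries R} {M : ℤ} (hM : OrdLE F M) :
    (zpowMul d i F).1 (i + M) = F.1 M := by
  rw [zpowMul_coeff d i hM (K := 1) (by push_cast; omega), Finset.sum_range_one]
  simp

/-- Summing over k first splits the product into compositions with single powers of z, on which
associativity can be proved by induction. -/
lemma leibniz_coeff (A F : upSeries R) (m : ℤ) :
    (leibniz d A F).1 m = ∑ᶠ i, A.1 i * (zpowMul d i F).1 m := by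
  obtain ⟨N, hN⟩ := exists_ordLE A
  obtain ⟨M, hM⟩ := exists_ordLE F
  change ∑ᶠ p : ℤ × ℕ, _ = _
  -- A nonzero term needs i ≤ N and m - i + k ≤ M. This gives m - M ≤ i and k ≤ M - m + N.
  rw [finsum_eq_sum_of_support_subset
      (s := Finset.Icc (m - M) N ×ˢ Finset.range ((M - m + N).toNat + 1)),
    Finset.sum_product, finsum_eq_sum_Icc (m - M) N]
  · refine Finset.sum_congr rfl fun i hi => ?_
    rw [Finset.mem_Icc] at hi
    rw [zpowMul_coeff d i hM (K := (M - m + N).toNat + 1) (by omega), Finset.mul_sum]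
    refine Finset.sum_congr rfl fun k _ => ?_
    rw [mul_smul_comm]
  · intro i hi
    constructor
    · by_contra h
      exact hi (by rw [ordLE_zpowMul d i hM _ (by omega), mul_zero])
    · by_contra h
      exact hi (by rw [hN _ (by omega), zero_mul])
  · rintro ⟨i, k⟩ hp
    have h1 : i ≤ N := by
      by_contra h
      exact hp (by simp only; rw [hN _ (by omega), zero_mul, smul_zero])
    have h2 : m - i + k ≤ M := by
      by_contra h
      exact hp (by simp only; rw [hM _ (by omega), iterate_zero', mul_zero, smul_zero])
    simp only [Finset.coe_product, Finset.coe_Icc, Finset.coe_range, Set.mem_prod, Set.mem_Icc,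
      Set.mem_Iio]
    omega

lemma leibniz_coeff_sum {A F : upSeries R} {N M m a b : ℤ} (hN : OrdLE A N) (hM : OrdLE F M)
    (ha : a ≤ m - M) (hb : N ≤ b) :
    (leibniz d A F).1 m = ∑ i ∈ Finset.Icc a b, A.1 i * (zpowMul d i F).1 m := by
  rw [leibniz_coeff]
  refine finsum_eq_sum_Icc a b fun i hi => ⟨?_, ?_⟩
  · by_contra h
    exact hi (by rw [ordLE_zpowMul d i hM _ (by omega), mul_zero])
  · by_contra h
    exact hi (by rw [hN _ (by omega), zero_mul])

lemma OrdLE.leibniz {A F : upSeries R} {N M : ℤ} (hN : OrdLE A N) (hM : OrdLE F M) :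
    OrdLE (leibniz d A F) (N + M) := fun m hm => by
  rw [leibniz_coeff_sum d hN hM le_rfl le_rfl, Finset.Icc_eq_empty (by omega), Finset.sum_empty]

lemma leibniz_lead {A F : upSeries R} {N M : ℤ} (hN : OrdLE A N) (hM : OrdLE F M) :
    (leibniz d A F).1 (N + M) = A.1 N * F.1 M := by
  rw [leibniz_coeff_sum d hN hM (a := N) (b := N) (by omega) le_rfl, Finset.Icc_self,
    Finset.sum_singleton, zpowMul_lead d N hM]

/-- The composition of `z` with a series. -/
def zMul (F : upSeries R) : upSeries R := coeffDeriv d F + lam 1 F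

/-- Pascal's rule for binomial coefficients with integer upper entry. It reduces every power of z to
the single map ∂ + (shift by one). -/
lemma zpowMul_succ (i : ℤ) (F : upSeries R) : zpowMul d (i + 1) F = zMul d (zpowMul d i F) := by
  obtain ⟨M, hM⟩ := exists_ordLE F
  refine upSeries.ext fun m => ?_
  obtain ⟨K, hK⟩ : ∃ K : ℕ, M < m - i + K := ⟨(M - m + i).toNat + 1, by omega⟩
  change _ = d ((zpowMul d i F).1 m) + (zpowMul d i F).1 (m - (1 : ℕ))
  rw [zpowMul_coeff d (i + 1) hM (K := K + 1) (by push_cast; omega), zpowMul_coeff d i hM hK,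
    zpowMul_coeff d i hM (K := K + 1) (by push_cast; omega), Finset.sum_range_succ',
    Finset.sum_range_succ', map_sum, ← add_assoc, ← Finset.sum_add_distrib]
  congr 1
  · refine Finset.sum_congr rfl fun k _ => ?_
    have e1 : m - (i + 1) + ((k + 1 : ℕ) : ℤ) = m - i + k := by push_cast; ring
    have e2 : m - ((1 : ℕ) : ℤ) - i + ((k + 1 : ℕ) : ℤ) = m - i + k := by push_cast; ring
    rw [e1, e2, Ring.choose_succ_succ, map_zsmul, ← Function.iterate_succ_apply' (⇑d), add_smul]
  · simp only [Ring.choose_zero_right, Function.iterate_zero, id]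
    congr 3
    push_cast
    ring_nf

lemma zpowMul_zero (F : upSeries R) : zpowMul d 0 F = F := by
  refine upSeries.ext fun m => ?_
  refine (finsum_eq_single _ 0 fun k hk => ?_).trans ?_
  · obtain ⟨k, rfl⟩ := Nat.exists_eq_succ_of_ne_zero hk
    rw [Nat.succ_eq_add_one, Ring.choose_zero_succ, zero_smul]
  · simp

/-- Associativity with left factor z: the Leibniz rule produces d(a_i) z^i F + a_i z^{i+1} F, and
the second family is a shift of the index i. -/
lemma zMul_leibniz (A F : upSeries R) : leibniz d (zMul d A) F = zMul d (leibniz d A F) := by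
  obtain ⟨N, hN⟩ := exists_ordLE A
  obtain ⟨M, hM⟩ := exists_ordLE F
  have hlam : OrdLE (lam 1 A) (N + 1) := fun j hj => hN _ (by push_cast; omega)
  have hz : OrdLE (zMul d A) (N + 1) :=
    ((ordLE_coeffDeriv hN d).mono (by omega)).add hlam
  refine upSeries.ext fun m => ?_
  change _ = d ((leibniz d A F).1 m) + (leibniz d A F).1 (m - (1 : ℕ))
  rw [leibniz_coeff_sum d hz hM (a := m - M - 1) (b := N + 1) (by omega) le_rfl,
    leibniz_coeff_sum d hN hM (a := m - M - 1) (b := N + 1) (by omega) (by omega),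
    leibniz_coeff_sum d hN hM (a := m - M - 1) (b := N + 1) (by push_cast; omega) (by omega),
    map_sum, ← Finset.sum_add_distrib]
  have e1 : ∀ i ∈ Finset.Icc (m - M - 1) (N + 1), (zMul d A).1 i * (zpowMul d i F).1 m =
      d (A.1 i) * (zpowMul d i F).1 m + A.1 (i - 1) * (zpowMul d i F).1 m := fun i _ =>
    add_mul _ _ _
  have e2 : ∀ i ∈ Finset.Icc (m - M - 1) (N + 1),
      d (A.1 i * (zpowMul d i F).1 m) + A.1 i * (zpowMul d i F).1 (m - (1 : ℕ)) =
      d (A.1 i) * (zpowMul d i F).1 m + A.1 i * (zpowMul d (i + 1) F).1 m := fun i _ => by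
    have h : (zpowMul d (i + 1) F).1 m = d ((zpowMul d i F).1 m) +
        (zpowMul d i F).1 (m - (1 : ℕ)) := by rw [zpowMul_succ]; rfl
    rw [h, Derivation.leibniz, smul_eq_mul, smul_eq_mul]
    ring
  rw [Finset.sum_congr rfl e1, Finset.sum_congr rfl e2, Finset.sum_add_distrib,
    Finset.sum_add_distrib]
  congr 1
  rw [← finsum_eq_sum_Icc, ← finsum_eq_sum_Icc, ← finsum_comp_equiv (Equiv.addRight (1 : ℤ))]
  · refine finsum_congr fun i => ?_
    simp
  · intro i hi
    constructor
    · by_contra h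
      exact hi (by rw [ordLE_zpowMul d _ hM _ (by omega), mul_zero])
    · by_contra h
      exact hi (by rw [hN _ (by omega), zero_mul])
  · intro i hi
    constructor
    · by_contra h
      exact hi (by rw [ordLE_zpowMul d _ hM _ (by omega), mul_zero])
    · by_contra h
      exact hi (by rw [hN _ (by omega), zero_mul])

lemma zMul_sub (A B : upSeries R) : zMul d (A - B) = zMul d A - zMul d B := by
  refine upSeries.ext fun m => ?_
  change d (A.1 m - B.1 m) + (A.1 _ - B.1 _) = (d (A.1 m) + A.1 _) - (d (B.1 m) + B.1 _)
  rw [map_sub]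
  ring

/-- A series killed by z satisfies a_{m-1} = -∂ a_m, and it vanishes in high degrees, hence
everywhere. This is what carries associativity down to negative powers. -/
lemma zMul_injective : Function.Injective (zMul d) := by
  intro A B h
  obtain ⟨N, hN⟩ := exists_ordLE (A - B)
  have h0 : zMul d (A - B) = 0 := by rw [zMul_sub, h, sub_self]
  have h1 : ∀ m, (A - B).1 (m - 1) = -d ((A - B).1 m) := fun m => by
    have := congrArg (fun F : upSeries R => F.1 m) h0
    exact eq_neg_of_add_eq_zero_right this
  have h2 : ∀ k : ℕ, (A - B).1 (N + 1 - k) = 0 := fun k => by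
    induction k with
    | zero => exact hN _ (by push_cast; omega)
    | succ k ih =>
      have e : N + 1 - ((k + 1 : ℕ) : ℤ) = N + 1 - k - 1 := by push_cast; ring
      rw [e, h1, ih, map_zero, neg_zero]
  refine upSeries.ext fun m => sub_eq_zero.1 ?_
  by_cases hm : N < m
  · exact hN m hm
  · have e : m = N + 1 - ((N + 1 - m).toNat : ℤ) := by omega
    rw [e]
    exact h2 _

lemma zpowMul_leibniz (i : ℤ) (A F : upSeries R) :
    leibniz d (zpowMul d i A) F = zpowMul d i (leibniz d A F) := by
  induction i with
  | zero => rw [zpowMul_zero, zpowMul_zero]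
  | succ i ih => rw [zpowMul_succ, zpowMul_succ, zMul_leibniz, ih]
  | pred i ih =>
    refine zMul_injective d ?_
    rw [← zMul_leibniz, ← zpowMul_succ, ← zpowMul_succ, sub_add_cancel, ih]

lemma leibniz_mono (i : ℤ) (c : R) (F : upSeries R) :
    leibniz d (mono i c) F = c • zpowMul d i F := by
  refine upSeries.ext fun m => ?_
  rw [leibniz_coeff, finsum_eq_single _ i fun l hl => by rw [mono_coeff, if_neg hl, zero_mul],
    mono_self, smul_coeff]

/-- The matrix of right multiplication by a series, in the basis `z^i`. -/
def rep (A : upSeries R) : UBMat R := ⟨fun i j => (zpowMul d i A).1 j, by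
  obtain ⟨N, hN⟩ := exists_ordLE A
  exact ⟨N, fun n m h => ordLE_zpowMul d n hN m h⟩⟩

/-- The rows of a matrix are the coefficients of a family of series. -/
def rows (V : ℤ → upSeries R) (h : ∀ n, OrdLE (V n) n) : UBMat R :=
  ⟨fun n j => (V n).1 j, 0, fun n m hm => h n m (by omega)⟩

lemma rep_injective {A B : upSeries R} (h : rep d A = rep d B) : A = B := by
  refine upSeries.ext fun j => ?_
  have := congrArg (fun M : UBMat R => M.1 0 j) h
  change (zpowMul d 0 A).1 j = (zpowMul d 0 B).1 j at this
  rwa [zpowMul_zero, zpowMul_zero] at this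

/-- This is associativity with left factor z^i, read row by row. Through the injective map `rep` the
operators inherit associativity and distributivity from the matrices. -/
lemma rep_leibniz (A B : upSeries R) : rep d (leibniz d A B) = rep d A * rep d B := by
  ext i j
  change (zpowMul d i (leibniz d A B)).1 j = _
  rw [← zpowMul_leibniz, leibniz_coeff]
  rfl

lemma rep_add (A B : upSeries R) : rep d (A + B) = rep d A + rep d B := by
  obtain ⟨N, hN⟩ := exists_ordLE A
  obtain ⟨M, hM⟩ := exists_ordLE B
  ext i j
  obtain ⟨K, hK⟩ : ∃ K : ℕ, max N M < j - i + K := ⟨(max N M - j + i).toNat + 1, by omega⟩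
  change (zpowMul d i (A + B)).1 j = (zpowMul d i A).1 j + (zpowMul d i B).1 j
  rw [zpowMul_coeff d i ((hN.mono (le_max_left _ _)).add (hM.mono (le_max_right _ _))) hK,
    zpowMul_coeff d i (hN.mono (le_max_left _ _)) hK,
    zpowMul_coeff d i (hM.mono (le_max_right _ _)) hK, ← Finset.sum_add_distrib]
  refine Finset.sum_congr rfl fun k _ => ?_
  rw [add_coeff, iterate_map_add, smul_add]

lemma zpowMul_mono (i j : ℤ) : zpowMul d i (mono j (1 : R)) = mono (i + j) 1 := by
  refine upSeries.ext fun m => ?_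
  refine (finsum_eq_single _ 0 fun k hk => ?_).trans ?_
  · obtain ⟨k, rfl⟩ := Nat.exists_eq_succ_of_ne_zero hk
    rw [mono_coeff]
    split_ifs
    · rw [Function.iterate_succ_apply, Derivation.map_one_eq_zero, iterate_zero', smul_zero]
    · rw [iterate_zero', smul_zero]
  · simp only [Ring.choose_zero_right, Function.iterate_zero, id, one_smul, mono_coeff]
    congr 1
    simp only [Nat.cast_zero, add_zero, eq_iff_iff]
    omega

lemma rep_C_one : rep d (C 1) = 1 := by
  ext i j
  change (zpowMul d i (mono 0 1)).1 j = _
  rw [zpowMul_mono, mono_coeff, UBMat.one_val, Matrix.one_apply]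
  simp [eq_comm]

/-! ### The ring of pseudo-differential operators -/

/-- Pseudo-differential operators with symbol `D = d`, as a ring. -/
@[ext] structure Op (d : Derivation ℤ R R) where
  /-- the coefficients -/
  ser : upSeries R

namespace Op

variable {d}

instance : Zero (Op d) := ⟨⟨0⟩⟩
instance : One (Op d) := ⟨⟨C 1⟩⟩
instance : Add (Op d) := ⟨fun A B => ⟨A.ser + B.ser⟩⟩
instance : Neg (Op d) := ⟨fun A => ⟨-A.ser⟩⟩
instance : Sub (Op d) := ⟨fun A B => ⟨A.ser - B.ser⟩⟩
instance : Mul (Op d) := ⟨fun A B => ⟨mul d A.ser B.ser⟩⟩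
instance : SMul R (Op d) := ⟨fun c A => ⟨c • A.ser⟩⟩

@[simp] lemma zero_ser : (0 : Op d).ser = 0 := rfl
@[simp] lemma add_ser (A B : Op d) : (A + B).ser = A.ser + B.ser := rfl
@[simp] lemma sub_ser (A B : Op d) : (A - B).ser = A.ser - B.ser := rfl
@[simp] lemma smul_ser (c : R) (A : Op d) : (c • A).ser = c • A.ser := rfl
lemma mul_ser (A B : Op d) : (A * B).ser = leibniz d A.ser B.ser := rfl

lemma mul_coeff (A B : Op d) (j : ℤ) :
    (A * B).ser.1 j = ∑ᶠ i, A.ser.1 i * (zpowMul d i B.ser).1 j := leibniz_coeff d _ _ j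

instance : AddCommGroup (Op d) where
  add_assoc A B C := Op.ext (add_assoc _ _ _)
  zero_add A := Op.ext (zero_add _)
  add_zero A := Op.ext (add_zero _)
  add_comm A B := Op.ext (add_comm _ _)
  neg_add_cancel A := Op.ext (neg_add_cancel _)
  sub_eq_add_neg A B := Op.ext (sub_eq_add_neg _ _)
  nsmul := nsmulRec
  zsmul := zsmulRec

lemma eq_of_rep {A B : Op d} (h : rep d A.ser = rep d B.ser) : A = B :=
  Op.ext (rep_injective d h)

lemma rep_mul (A B : Op d) : rep d (A * B).ser = rep d A.ser * rep d B.ser := rep_leibniz d _ _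
lemma rep_one : rep d (1 : Op d).ser = 1 := rep_C_one d

instance : Ring (Op d) :=
  { (inferInstance : AddCommGroup (Op d)) with
    mul := (· * ·)
    one := 1
    mul_assoc := fun A B C => eq_of_rep (by simp only [rep_mul, mul_assoc])
    one_mul := fun A => eq_of_rep (by simp only [rep_mul, rep_one, one_mul])
    mul_one := fun A => eq_of_rep (by simp only [rep_mul, rep_one, mul_one])
    left_distrib := fun A B C =>
      eq_of_rep (by simp only [rep_mul, add_ser, rep_add, mul_add])
    right_distrib := fun A B C =>
      eq_of_rep (by simp only [rep_mul, add_ser, rep_add, add_mul])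
    zero_mul := fun A => Op.ext <| upSeries.ext fun j => by
      rw [mul_coeff]
      simp
    mul_zero := fun A => Op.ext <| upSeries.ext fun j => by
      rw [mul_coeff]
      refine (finsum_congr fun i => ?_).trans finsum_zero
      rw [ordLE_zpowMul d i (M := j - i - 1) (fun _ _ => rfl) j (by omega), mul_zero] }

instance : Module R (Op d) where
  one_smul _ := Op.ext (one_smul _ _)
  mul_smul _ _ _ := Op.ext (mul_smul _ _ _)
  smul_zero _ := Op.ext (smul_zero _)
  smul_add _ _ _ := Op.ext (smul_add _ _ _)
  add_smul _ _ _ := Op.ext (add_smul _ _ _)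
  zero_smul _ := Op.ext (zero_smul _ _)

instance : IsScalarTower R (Op d) (Op d) where
  smul_assoc c A B := Op.ext <| upSeries.ext fun j => by
    obtain ⟨N, hN⟩ := exists_ordLE A.ser
    obtain ⟨M, hM⟩ := exists_ordLE B.ser
    change (leibniz d (c • A.ser) B.ser).1 j = c * (leibniz d A.ser B.ser).1 j
    rw [leibniz_coeff_sum d (hN.smul c) hM le_rfl le_rfl, leibniz_coeff_sum d hN hM le_rfl le_rfl,
      Finset.mul_sum]
    simp only [smul_coeff, mul_assoc]

end Op
end DoubleKP
end

/-! ### Calculus of pseudo-differential operators. -/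

noncomputable section
namespace DoubleKP

variable {R : Type*} [CommRing R]

namespace Op

variable {d : Derivation ℤ R R}

lemma sum_ser {ι : Type*} (s : Finset ι) (f : ι → Op d) : (∑ i ∈ s, f i).ser = ∑ i ∈ s, (f i).ser :=
  map_sum (AddMonoidHom.mk' (fun A : Op d => A.ser) add_ser) f s

lemma pow_ser (A : Op d) (r : ℕ) : (A ^ r).ser = pow d A.ser r := by
  induction r with
  | zero => rw [pow_zero]; rfl
  | succ r ih => rw [pow_succ', mul_ser, ih]; rfl

variable (d) in
/-- The monomial `z^i`. -/
def z (i : ℤ) : Op d := ⟨mono i 1⟩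

variable (d) in
/-- A function as an operator. -/
def c (f : R) : Op d := ⟨C f⟩

lemma z_mul (i : ℤ) (A : Op d) : z d i * A = ⟨zpowMul d i A.ser⟩ :=
  Op.ext ((leibniz_mono d i 1 A.ser).trans (one_smul _ _))

lemma z_mul_z (i j : ℤ) : z d i * z d j = z d (i + j) := by
  rw [z_mul]
  exact Op.ext (zpowMul_mono d i j)

lemma z_zero : z d 0 = 1 := rfl

lemma c_mul (f : R) (A : Op d) : c d f * A = f • A :=
  Op.ext ((leibniz_mono d 0 f A.ser).trans (by rw [zpowMul_zero]; rfl))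

lemma c_eq (f : R) : c d f = f • 1 := by rw [← c_mul, mul_one]

lemma z_one_mul (A : Op d) : z d 1 * A = ⟨coeffDeriv d A.ser + lam 1 A.ser⟩ := by
  rw [z_mul, ← zero_add (1 : ℤ), zpowMul_succ, zpowMul_zero]
  rfl

lemma z_one_mul_smul (f : R) (A : Op d) : z d 1 * (f • A) = f • (z d 1 * A) + d f • A := by
  rw [z_one_mul, z_one_mul]
  refine Op.ext (upSeries.ext fun j => ?_)
  simp only [smul_ser, add_ser, add_coeff, coeffDeriv_coeff, smul_coeff, lam_coeff,
    Derivation.leibniz, smul_eq_mul]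
  ring

lemma mul_z_coeff (A : Op d) (r j : ℤ) : (A * z d r).ser.1 j = A.ser.1 (j - r) := by
  rw [mul_coeff, finsum_eq_single _ (j - r)]
  · change _ * (zpowMul d (j - r) (mono r 1)).1 j = _
    rw [zpowMul_mono, sub_add_cancel, mono_self, mul_one]
  · intro i hi
    change _ * (zpowMul d i (mono r 1)).1 j = _
    rw [zpowMul_mono, mono_coeff, if_neg (by omega), mul_zero]

lemma mul_z_nat (A : Op d) (r : ℕ) : A * z d r = ⟨lam r A.ser⟩ :=
  Op.ext (upSeries.ext fun j => mul_z_coeff A r j)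

/-! ### Orders -/

/-- The order is at most `N`. -/
def Ord (A : Op d) (N : ℤ) : Prop := OrdLE A.ser N

lemma exists_ord (A : Op d) : ∃ N, Ord A N := exists_ordLE A.ser

lemma Ord.mono {A : Op d} {N M : ℤ} (h : Ord A N) (hNM : N ≤ M) : Ord A M := OrdLE.mono h hNM
lemma Ord.add {A B : Op d} {N : ℤ} (hA : Ord A N) (hB : Ord B N) : Ord (A + B) N :=
  OrdLE.add hA hB
lemma Ord.sub {A B : Op d} {N : ℤ} (hA : Ord A N) (hB : Ord B N) : Ord (A - B) N :=
  OrdLE.sub hA hB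
lemma Ord.neg {A : Op d} {N : ℤ} (hA : Ord A N) : Ord (-A) N := OrdLE.neg hA
lemma Ord.smul {A : Op d} {N : ℤ} (hA : Ord A N) (f : R) : Ord (f • A) N := OrdLE.smul hA f
lemma Ord.mul {A B : Op d} {N M : ℤ} (hA : Ord A N) (hB : Ord B M) : Ord (A * B) (N + M) :=
  OrdLE.leibniz d hA hB
lemma mul_lead {A B : Op d} {N M : ℤ} (hA : Ord A N) (hB : Ord B M) :
    (A * B).ser.1 (N + M) = A.ser.1 N * B.ser.1 M := leibniz_lead d hA hB
lemma ord_z (i : ℤ) : Ord (z d i) i := ordLE_mono i 1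
lemma ord_c (f : R) : Ord (c d f) 0 := ordLE_mono 0 f

/-- Order `N` with leading coefficient one. -/
def Monic (A : Op d) (N : ℤ) : Prop := Ord A N ∧ A.ser.1 N = 1

lemma Monic.mul {A B : Op d} {N M : ℤ} (hA : Monic A N) (hB : Monic B M) :
    Monic (A * B) (N + M) :=
  ⟨hA.1.mul hB.1, by rw [mul_lead hA.1 hB.1, hA.2, hB.2, one_mul]⟩

lemma monic_z (i : ℤ) : Monic (z d i) i := ⟨ord_z i, mono_self i 1⟩
lemma monic_one : Monic (1 : Op d) 0 := monic_z 0

/-! ### Derivations acting on the coefficients -/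

/-- A derivation applied to all coefficients. -/
def deriv (e : Derivation ℤ R R) (A : Op d) : Op d := ⟨coeffDeriv e A.ser⟩

lemma deriv_add (e : Derivation ℤ R R) (A B : Op d) :
    (A + B).deriv e = A.deriv e + B.deriv e :=
  Op.ext (upSeries.ext fun _ => map_add e _ _)

lemma deriv_smul (e : Derivation ℤ R R) (f : R) (A : Op d) :
    (f • A).deriv e = f • A.deriv e + e f • A :=
  Op.ext (upSeries.ext fun j => by
    change e (f * A.ser.1 j) = f * e (A.ser.1 j) + e f * A.ser.1 j
    rw [Derivation.leibniz, smul_eq_mul, smul_eq_mul]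
    ring)

lemma Monic.ord_deriv {A : Op d} {N : ℤ} (hA : Monic A N) (e : Derivation ℤ R R) :
    Ord (A.deriv e) (N - 1) := fun j hj => by
  change e (A.ser.1 j) = 0
  obtain rfl | h : j = N ∨ N < j := by omega
  · rw [hA.2, Derivation.map_one_eq_zero]
  · rw [hA.1 j h, map_zero]

lemma deriv_z (e : Derivation ℤ R R) (i : ℤ) : (z d i).deriv e = 0 :=
  Op.ext (upSeries.ext fun j => by
    change e ((DoubleKP.mono i 1).1 j) = 0
    rw [mono_coeff]
    split_ifs <;> simp)

lemma deriv_c (e : Derivation ℤ R R) (f : R) : (c d f).deriv e = c d (e f) :=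
  Op.ext (upSeries.ext fun j => by
    change e ((DoubleKP.mono 0 f).1 j) = (DoubleKP.mono 0 (e f)).1 j
    rw [mono_coeff, mono_coeff]
    split_ifs <;> simp)

lemma zpowMul_coeffDeriv {e : Derivation ℤ R R} (he : ∀ f, e (d f) = d (e f)) (i : ℤ)
    (F : upSeries R) (m : ℤ) : e ((zpowMul d i F).1 m) = (zpowMul d i (coeffDeriv e F)).1 m := by
  obtain ⟨M, hM⟩ := exists_ordLE F
  obtain ⟨K, hK⟩ : ∃ K : ℕ, M < m - i + K := ⟨(M - m + i).toNat + 1, by omega⟩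
  rw [zpowMul_coeff d i hM hK, zpowMul_coeff d i (ordLE_coeffDeriv hM e) hK, map_sum]
  refine Finset.sum_congr rfl fun k _ => ?_
  have hc : Function.Commute (⇑e) (⇑d) := he
  rw [map_zsmul, (hc.iterate_right k).eq]
  rfl

lemma deriv_mul {e : Derivation ℤ R R} (he : ∀ f, e (d f) = d (e f)) (A B : Op d) :
    (A * B).deriv e = A.deriv e * B + A * B.deriv e := by
  obtain ⟨N, hN⟩ := exists_ordLE A.ser
  obtain ⟨M, hM⟩ := exists_ordLE B.ser
  refine Op.ext (upSeries.ext fun j => ?_)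
  change e ((leibniz d A.ser B.ser).1 j) =
    (leibniz d (coeffDeriv e A.ser) B.ser).1 j + (leibniz d A.ser (coeffDeriv e B.ser)).1 j
  rw [leibniz_coeff_sum d hN hM le_rfl le_rfl,
    leibniz_coeff_sum d (ordLE_coeffDeriv hN e) hM le_rfl le_rfl,
    leibniz_coeff_sum d hN (ordLE_coeffDeriv hM e) le_rfl le_rfl, map_sum,
    ← Finset.sum_add_distrib]
  refine Finset.sum_congr rfl fun i _ => ?_
  rw [Derivation.leibniz, smul_eq_mul, smul_eq_mul, zpowMul_coeffDeriv he, coeffDeriv_coeff]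
  ring

lemma z_one_mul_sub (A : Op d) : z d 1 * A - A * z d 1 = A.deriv d := by
  have h := mul_z_nat A 1
  rw [Nat.cast_one] at h
  rw [z_one_mul, h]
  exact Op.ext (add_sub_cancel_right _ _)

/-! ### Darboux operators -/

/-- The operator `u D u⁻¹`. -/
def darboux (d : Derivation ℤ R R) (u : R) : Op d := ⟨DoubleKP.darboux d u⟩

/-- The operator `u D⁻¹ u⁻¹`. -/
def darbouxInv (d : Derivation ℤ R R) (u : R) : Op d := ⟨DoubleKP.darbouxInv d u⟩

lemma darboux_eq (u : R) : darboux d u = c d u * z d 1 * c d (Ring.inverse u) := rfl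
lemma darbouxInv_eq (u : R) : darbouxInv d u = c d u * z d (-1) * c d (Ring.inverse u) := rfl

lemma c_mul_c (f g : R) : c d f * c d g = c d (f * g) := by
  rw [c_mul, c_eq, c_eq, smul_smul]

lemma c_one : c d (1 : R) = 1 := rfl

lemma darboux_mul_darbouxInv {u : R} (hu : IsUnit u) : darboux d u * darbouxInv d u = 1 := by
  rw [darboux_eq, darbouxInv_eq]
  calc _ = c d u * z d 1 * (c d (Ring.inverse u) * c d u) * z d (-1) * c d (Ring.inverse u) := by
        simp only [mul_assoc]
    _ = 1 := by
        rw [c_mul_c, Ring.inverse_mul_cancel _ hu, c_one, mul_one, mul_assoc (c d u), z_mul_z,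
          add_neg_cancel, z_zero, mul_one, c_mul_c, Ring.mul_inverse_cancel _ hu, c_one]

lemma darbouxInv_mul_darboux {u : R} (hu : IsUnit u) : darbouxInv d u * darboux d u = 1 := by
  rw [darboux_eq, darbouxInv_eq]
  calc _ = c d u * z d (-1) * (c d (Ring.inverse u) * c d u) * z d 1 * c d (Ring.inverse u) := by
        simp only [mul_assoc]
    _ = 1 := by
        rw [c_mul_c, Ring.inverse_mul_cancel _ hu, c_one, mul_one, mul_assoc (c d u), z_mul_z,
          neg_add_cancel, z_zero, mul_one, c_mul_c, Ring.mul_inverse_cancel _ hu, c_one]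

lemma monic_darboux {u : R} (hu : IsUnit u) : Monic (darboux d u) 1 := by
  have h1 : Ord (c d u * z d 1) (0 + 1) := (ord_c u).mul (ord_z 1)
  refine ⟨h1.mul (ord_c _), ?_⟩
  have h := mul_lead h1 (ord_c (Ring.inverse u))
  rw [mul_lead (ord_c u) (ord_z 1)] at h
  refine h.trans ?_
  change (mono 0 u).1 0 * (mono 1 1).1 1 * (mono 0 (Ring.inverse u)).1 0 = 1
  rw [mono_self, mono_self, mono_self, mul_one, Ring.mul_inverse_cancel _ hu]

lemma monic_darbouxInv {u : R} (hu : IsUnit u) : Monic (darbouxInv d u) (-1) := by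
  have h1 : Ord (c d u * z d (-1)) (0 + -1) := (ord_c u).mul (ord_z _)
  refine ⟨h1.mul (ord_c _), ?_⟩
  have h := mul_lead h1 (ord_c (Ring.inverse u))
  rw [mul_lead (ord_c u) (ord_z _)] at h
  refine h.trans ?_
  change (mono 0 u).1 0 * (mono (-1) 1).1 (-1) * (mono 0 (Ring.inverse u)).1 0 = 1
  rw [mono_self, mono_self, mono_self, mul_one, Ring.mul_inverse_cancel _ hu]

end Op

lemma mul_deriv_inverse (d : Derivation ℤ R R) {u : R} (hu : IsUnit u) :
    u * d (Ring.inverse u) = -(d u * Ring.inverse u) := by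
  have h := congrArg d (Ring.mul_inverse_cancel u hu)
  rw [Derivation.leibniz, Derivation.map_one_eq_zero, smul_eq_mul, smul_eq_mul] at h
  linear_combination h

namespace Op
variable {d : Derivation ℤ R R}

lemma darboux_mul {u : R} (hu : IsUnit u) (A : Op d) :
    darboux d u * A = z d 1 * A - (d u * Ring.inverse u) • A := by
  rw [darboux_eq, mul_assoc, mul_assoc, c_mul, c_mul, z_one_mul_smul, smul_add, smul_smul,
    smul_smul, Ring.mul_inverse_cancel _ hu, one_smul, mul_deriv_inverse d hu, neg_smul,
    sub_eq_add_neg]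

/-! ### Convergent sums -/

/-- Right multiplication is continuous: z^l F has order at most l + M, so only the coefficients of A
with l ≥ j - M reach degree j. -/
lemma mul_coeff_congr {A B F : Op d} {M j : ℤ} (hF : Ord F M)
    (h : ∀ l, j - M ≤ l → A.ser.1 l = B.ser.1 l) : (A * F).ser.1 j = (B * F).ser.1 j := by
  rw [mul_coeff, mul_coeff]
  refine finsum_congr fun l => ?_
  by_cases hl : j - M ≤ l
  · rw [h l hl]
  · rw [ordLE_zpowMul d l hF j (by omega), mul_zero, mul_zero]

end Op

lemma IsSum.coeff_eq_sum {ι : Type*} {f : ι → upSeries R} {g : upSeries R} (h : IsSum f g) (a : ℤ) :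
    ∃ s : Finset ι, ∀ t : Finset ι, s ⊆ t → ∀ j, a ≤ j → g.1 j = ∑ i ∈ t, (f i).1 j := by
  refine ⟨(h.1 a).toFinset, fun t ht j hj => ?_⟩
  rw [← h.2 j]
  refine finsum_eq_sum_of_support_subset _ fun i hi => ht ?_
  rw [Set.Finite.mem_toFinset]
  exact ⟨j, hj, hi⟩

lemma IsSum.congr {ι : Type*} {f f' : ι → upSeries R} {g g' : upSeries R} (h : IsSum f g)
    (hf : ∀ i, f i = f' i) (hg : g = g') : IsSum f' g' := by
  obtain rfl : f = f' := funext hf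
  rwa [← hg]

lemma IsSum.add {ι : Type*} {f f' : ι → upSeries R} {g g' : upSeries R} (h : IsSum f g)
    (h' : IsSum f' g') : IsSum (fun i => f i + f' i) (g + g') := by
  have hfin : ∀ {f : ι → upSeries R} {g : upSeries R}, IsSum f g → ∀ j,
      (Function.support fun i => (f i).1 j).Finite := fun h j =>
    (h.1 j).subset fun i hi => ⟨j, le_rfl, hi⟩
  refine ⟨fun N => ((h.1 N).union (h'.1 N)).subset ?_, fun j => ?_⟩
  · rintro i ⟨j, hj, hi⟩
    by_cases h0 : (f i).1 j = 0
    · exact Or.inr ⟨j, hj, fun h1 => hi (by rw [add_coeff, h0, h1, add_zero])⟩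
    · exact Or.inl ⟨j, hj, h0⟩
  · rw [add_coeff, ← h.2, ← h'.2, ← finsum_add_distrib (hfin h j) (hfin h' j)]
    rfl

lemma IsSum.smul {ι : Type*} {f : ι → upSeries R} {g : upSeries R} (h : IsSum f g) (a : R) :
    IsSum (fun i => a • f i) (a • g) := by
  refine ⟨fun N => (h.1 N).subset ?_, fun j => ?_⟩
  · rintro i ⟨j, hj, hi⟩
    exact ⟨j, hj, fun h0 => hi (by rw [smul_coeff, h0, mul_zero])⟩
  · rw [smul_coeff, ← h.2, mul_finsum']
    · rfl
    · exact (h.1 j).subset fun i hi => ⟨j, le_rfl, hi⟩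

lemma isSum_finset {ι : Type*} (s : Finset ι) (f : ι → upSeries R) (hf : ∀ i, i ∉ s → f i = 0) :
    IsSum f (∑ i ∈ s, f i) := by
  refine ⟨fun N => s.finite_toSet.subset ?_, fun j => ?_⟩
  · rintro i ⟨j, -, hi⟩
    by_contra h
    exact hi (by rw [hf i h, zero_coeff])
  · rw [sum_coeff]
    refine finsum_eq_sum_of_support_subset _ fun i hi => ?_
    by_contra h
    exact hi (by simp only; rw [hf i h, zero_coeff])

lemma IsSum.extend {ι κ : Type*} {f : ι → upSeries R} {g : upSeries R} (h : IsSum f g) {e : ι → κ}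
    (he : Function.Injective e) {f' : κ → upSeries R} (hf' : ∀ i, f' (e i) = f i)
    (h0 : ∀ k, k ∉ Set.range e → f' k = 0) : IsSum f' g := by
  refine ⟨fun N => ((h.1 N).image e).subset ?_, fun j => ?_⟩
  · rintro k ⟨j, hj, hk⟩
    by_cases hr : k ∈ Set.range e
    · obtain ⟨i, rfl⟩ := hr
      exact ⟨i, ⟨j, hj, by rwa [hf'] at hk⟩, rfl⟩
    · exact absurd (by rw [h0 k hr, zero_coeff]) hk
  · rw [← h.2 j]
    have e1 : ∑ᶠ i, (f i).1 j = ∑ᶠ i, (f' (e i)).1 j := finsum_congr fun i => by rw [hf']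
    rw [e1, ← finsum_mem_range (f := fun k => (f' k).1 j) he]
    refine finsum_congr fun k => ?_
    by_cases hr : k ∈ Set.range e
    · simp [hr]
    · simp [hr, h0 k hr]

lemma IsSum.unique {ι : Type*} {f : ι → upSeries R} {g g' : upSeries R} (h : IsSum f g)
    (h' : IsSum f g') : g = g' :=
  upSeries.ext fun j => (h.2 j).symm.trans (h'.2 j)

lemma IsSum.mul_right {ι : Type*} (d : Derivation ℤ R R) {f : ι → upSeries R} {g : upSeries R}
    (h : IsSum f g) (F : upSeries R) : IsSum (fun i => leibniz d (f i) F) (leibniz d g F) := by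
  obtain ⟨M, hM⟩ := exists_ordLE F
  have hvan : ∀ i j, (∀ l, j - M ≤ l → (f i).1 l = 0) → (leibniz d (f i) F).1 j = 0 := by
    intro i j hi
    have := Op.mul_coeff_congr (d := d) (A := ⟨f i⟩) (B := 0) (F := ⟨F⟩) (j := j) hM hi
    rw [zero_mul] at this
    exact this
  refine ⟨fun N => (h.1 (N - M)).subset ?_, fun j => ?_⟩
  · rintro i ⟨j, hj, hi⟩
    by_contra hc
    refine hi (hvan i j fun l hl => ?_)
    by_contra hl0
    exact hc ⟨l, by omega, hl0⟩
  · obtain ⟨s, hs⟩ := h.coeff_eq_sum (j - M)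
    have hs0 := h.1 (j - M)
    classical
    -- The finite set has to represent `g` in the relevant degrees and also contain every index
    -- whose product reaches degree j; the union does both.
    have e1 : ∑ᶠ i, (leibniz d (f i) F).1 j =
        ∑ i ∈ s ∪ hs0.toFinset, (leibniz d (f i) F).1 j := by
      refine finsum_eq_sum_of_support_subset _ fun i hi => ?_
      rw [Finset.coe_union]
      refine Or.inr ?_
      rw [Set.Finite.coe_toFinset]
      by_contra hc
      refine hi (hvan i j fun l hl => ?_)
      by_contra hl0
      exact hc ⟨l, hl, hl0⟩
    have e2 := Op.mul_coeff_congr (d := d) (A := ⟨g⟩)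
      (B := ∑ i ∈ s ∪ hs0.toFinset, ⟨f i⟩) (F := ⟨F⟩) (j := j) hM fun l hl => by
        rw [Op.sum_ser, sum_coeff]
        exact hs _ Finset.subset_union_left l hl
    rw [Finset.sum_mul, Op.sum_ser, sum_coeff] at e2
    rw [e1]
    exact e2.symm

/-! ### Expansions in a basis of operators -/

/-- A series with bounded coefficients that vanishes to high order along a triangular family with
invertible leading coefficients has vanishing top coefficients. -/
lemma eq_zero_of_triangular {M : ℤ → upSeries R} (hM : ∀ n, OrdLE (M n) n)
    (hu : ∀ n, IsUnit ((M n).1 n)) {x : ℤ → R} {N n : ℤ} (hx : ∀ m, N < m → x m = 0)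
    (h : ∀ j, n ≤ j → ∑ᶠ m, x m * (M m).1 j = 0) : ∀ m, n ≤ m → x m = 0 := by
  -- Descending induction from N: at z^m the terms with l < m have too small an order, and those
  -- with l > m have already been shown to vanish.
  have key : ∀ k : ℕ, ∀ m, n ≤ m → N - k < m → x m = 0 := by
    intro k
    induction k with
    | zero => exact fun m _ hm => hx m (by simpa using hm)
    | succ k ih =>
      intro m hnm hm
      by_cases h1 : N - k < m
      · exact ih m hnm h1
      · have h2 := h m hnm
        rw [finsum_eq_single _ m] at h2
        · exact (hu m).mul_left_eq_zero.1 h2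
        · intro l hl
          by_cases hlm : l < m
          · rw [hM l m hlm, mul_zero]
          · rw [ih l (by omega) (by push_cast at hm; omega), zero_mul]
  exact fun m hm => key (N - m + 1).toNat m hm (by omega)

/-- Every series of order at most `N` is uniquely a sum over a family with leading terms
`z^N, z^{N-1}, …`. -/
lemma exists_expansion {P : ℕ → upSeries R} {N : ℤ} (hP : ∀ k : ℕ, OrdLE (P k) (N - k))
    (h1 : ∀ k : ℕ, (P k).1 (N - k) = 1) {A : upSeries R} (hA : OrdLE A N) :
    ∃ x : ℕ → R, IsSum (fun k => x k • P k) A := by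
  -- `B k` is the remainder after the first k terms; its coefficient at z^{N-k} is the next one of
  -- the expansion.
  let B : ℕ → upSeries R := fun k => Nat.rec A (fun k B => B - B.1 (N - k) • P k) k
  have hB0 : B 0 = A := rfl
  have hBs : ∀ k, B (k + 1) = B k - (B k).1 (N - k) • P k := fun _ => rfl
  have hB : ∀ k : ℕ, OrdLE (B k) (N - k) := by
    intro k
    induction k with
    | zero => simpa [hB0] using hA
    | succ k ih =>
      intro j hj
      rw [hBs, sub_coeff, smul_coeff]
      obtain rfl | h : j = N - k ∨ N - k < j := by push_cast at hj; omega
      · rw [h1, mul_one, sub_self]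
      · rw [ih j h, hP k j h, mul_zero, sub_self]
  have hsum : ∀ (k : ℕ) j, A.1 j = ∑ i ∈ Finset.range k, (B i).1 (N - i) * (P i).1 j +
      (B k).1 j := by
    intro k j
    induction k with
    | zero => simp [hB0]
    | succ k ih =>
      rw [ih, Finset.sum_range_succ, hBs, sub_coeff, smul_coeff]
      ring
  refine ⟨fun k => (B k).1 (N - k), fun a => ?_, fun j => ?_⟩
  · refine (Finset.range ((N - a).toNat + 1)).finite_toSet.subset ?_
    rintro k ⟨j, hj, hk⟩
    by_contra hc
    simp only [Finset.coe_range, Set.mem_Iio, not_lt] at hc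
    exact hk (by rw [smul_coeff, hP k j (by omega), mul_zero])
  · rw [hsum ((N - j).toNat + 1) j, hB ((N - j).toNat + 1) j (by push_cast; omega), add_zero]
    refine finsum_eq_sum_of_support_subset _ fun k hk => ?_
    by_contra hc
    simp only [Finset.coe_range, Set.mem_Iio, not_lt] at hc
    exact hk (by simp only; rw [smul_coeff, hP k j (by omega), mul_zero])

/-- By strong induction the coefficient of z^{N-k} sees only the k-th difference: earlier
differences vanish and later terms have smaller order. -/
lemma expansion_unique {P : ℕ → upSeries R} {N : ℤ} (hP : ∀ k : ℕ, OrdLE (P k) (N - k))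
    (h1 : ∀ k : ℕ, (P k).1 (N - k) = 1) {A : upSeries R} {x y : ℕ → R}
    (hx : IsSum (fun k => x k • P k) A) (hy : IsSum (fun k => y k • P k) A) : x = y := by
  have hd : IsSum (fun k => (x k - y k) • P k) 0 := by
    refine (hx.add (hy.smul (-1))).congr (fun k => ?_) ?_
    · refine upSeries.ext fun j => ?_
      simp only [add_coeff, smul_coeff]
      ring
    · refine upSeries.ext fun j => ?_
      simp only [add_coeff, smul_coeff, zero_coeff]
      ring
  have h0 : ∀ k, x k - y k = 0 := by
    intro k
    induction k using Nat.strong_induction_on with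
    | _ k ih =>
      have h := hd.2 (N - k)
      rw [finsum_eq_single _ k] at h
      · rwa [smul_coeff, h1, mul_one] at h
      · intro l hl
        rw [smul_coeff]
        obtain h2 | h2 := Nat.lt_or_gt_of_ne hl
        · rw [ih l h2, zero_mul]
        · rw [hP l _ (by omega), mul_zero]
  exact funext fun k => sub_eq_zero.1 (h0 k)

namespace Op
variable {d : Derivation ℤ R R}

/-- The operators z^{-N-k} A have leading terms z^{-k}. The coefficients of the expansion of 1 in
this family are the coefficients of a left inverse. -/
lemma exists_left_inverse {A : Op d} {N : ℤ} (hA : Monic A N) :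
    ∃ B : Op d, Monic B (-N) ∧ B * A = 1 := by
  have hP : ∀ k : ℕ, Monic (z d (-N - k) * A) (0 - k) := fun k => by
    have h := (monic_z (d := d) (-N - k)).mul hA
    rwa [show -N - k + N = (0 - k : ℤ) by ring] at h
  obtain ⟨x, hx⟩ := exists_expansion (fun k => (hP k).1) (fun k => (hP k).2)
    (monic_one (d := d)).1
  have hB : ∀ j, -N < j → (if j ≤ -N then x (-N - j).toNat else 0) = 0 := fun j hj => by
    rw [if_neg (by omega)]
  let B : Op d := ⟨⟨fun j => if j ≤ -N then x (-N - j).toNat else 0, -N, hB⟩⟩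
  have hsum : IsSum (fun k : ℕ => x k • (z d (-N - k)).ser) B.ser := by
    refine ⟨fun a => (Finset.range ((-N - a).toNat + 1)).finite_toSet.subset ?_, fun j => ?_⟩
    · rintro k ⟨j, hj, hk⟩
      by_contra hc
      simp only [Finset.coe_range, Set.mem_Iio, not_lt] at hc
      exact hk (by rw [smul_coeff, ord_z _ j (by omega), mul_zero])
    · change _ = if j ≤ -N then x (-N - j).toNat else 0
      rw [finsum_eq_single _ (-N - j).toNat]
      · rw [smul_coeff]
        change _ * (DoubleKP.mono _ 1).1 j = _
        rw [mono_coeff]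
        by_cases h : j ≤ -N
        · rw [if_pos h, if_pos (by omega), mul_one]
        · rw [if_neg h, if_neg (by omega), mul_zero]
      · intro k hk
        change _ * (DoubleKP.mono (-N - k : ℤ) (1 : R)).1 j = _
        rw [mono_coeff, if_neg (by omega), mul_zero]
  have hBA : B * A = 1 := by
    refine Op.ext (IsSum.unique (hsum.mul_right d A.ser) (hx.congr (fun k => ?_) rfl))
    have h := congrArg Op.ser (smul_mul_assoc (x k) (z d (-N - k)) A)
    exact h.symm
  refine ⟨B, ⟨hB, ?_⟩, hBA⟩
  have h := mul_lead (A := B) hB hA.1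
  rw [hBA, hA.2, mul_one, neg_add_cancel] at h
  rw [← h]
  exact (monic_one (d := d)).2

/-- Operators with leading coefficient one are invertible. -/
lemma Monic.exists_inverse {A : Op d} {N : ℤ} (hA : Monic A N) :
    ∃ B : Op d, Monic B (-N) ∧ B * A = 1 ∧ A * B = 1 := by
  obtain ⟨B, hB, hBA⟩ := exists_left_inverse hA
  -- The left inverse is itself monic and so has a left inverse, which must be `A`.
  obtain ⟨B', -, hB'⟩ := exists_left_inverse hB
  refine ⟨B, hB, hBA, ?_⟩
  rwa [left_inv_eq_right_inv hB' hBA] at hB'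

end Op
end DoubleKP
end

noncomputable section
namespace DoubleKP

variable {R : Type*} [CommRing R]

namespace Op
variable {d : Derivation ℤ R R}

/-! ### Expansions in Darboux orbits -/

variable (d) in
/-- `(D - ∂ ln u_{n-k})⁻¹ ⋯ (D - ∂ ln u_{n-1})⁻¹`. -/
def wordOp (u : ℤ → R) (n : ℤ) : ℕ → Op d
  | 0 => 1
  | k + 1 => darbouxInv d (u (n - (k + 1))) * wordOp u n k

/-- A Darboux orbit `F_{n+1} = u_n ∂ (F_n / u_n)`. -/
def IsOrbit (u : ℤ → R) (F : ℤ → Op d) : Prop := ∀ n, F (n + 1) = darboux d (u n) * F n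

variable {u : ℤ → R}

lemma monic_wordOp (hu : ∀ n, IsUnit (u n)) (n : ℤ) (k : ℕ) : Monic (wordOp d u n k) (-k) := by
  induction k with
  | zero => exact monic_one
  | succ k ih =>
    have h := (monic_darbouxInv (d := d) (hu (n - (k + 1)))).mul ih
    rwa [show (-1 + -(k : ℤ)) = -((k + 1 : ℕ) : ℤ) by push_cast; ring] at h

/-- Each factor of the word undoes one Darboux step, so a word is a shift by k sites on any orbit.
-/
lemma wordOp_mul (hu : ∀ n, IsUnit (u n)) {F : ℤ → Op d} (hF : IsOrbit u F) (n : ℤ) (k : ℕ) :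
    wordOp d u n k * F n = F (n - k) := by
  induction k with
  | zero => rw [wordOp, one_mul, Nat.cast_zero, sub_zero]
  | succ k ih =>
    have h := hF (n - (k + 1))
    rw [show n - ((k : ℤ) + 1) + 1 = n - k by ring] at h
    rw [wordOp, mul_assoc, ih, h, ← mul_assoc, darbouxInv_mul_darboux (hu _), one_mul]
    push_cast
    rfl

lemma IsOrbit.monic (hu : ∀ n, IsUnit (u n)) {F : ℤ → Op d} (hF : IsOrbit u F)
    (h0 : Monic (F 0) 0) (n : ℤ) : Monic (F n) n := by
  induction n with
  | zero => exact h0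
  | succ n ih =>
    rw [hF, add_comm (n : ℤ)]
    exact (monic_darboux (hu _)).mul ih
  | pred n ih =>
    have h := wordOp_mul hu hF (-n) 1
    rw [Nat.cast_one] at h
    rw [← h, sub_eq_add_neg, add_comm (-(n : ℤ))]
    exact (monic_wordOp hu _ 1).mul ih

/-- An orbit is determined by its initial value. -/
lemma IsOrbit.eq_mul (hu : ∀ n, IsUnit (u n)) {V F : ℤ → Op d} (hV : IsOrbit u V)
    (h0 : V 0 = 1) (hF : IsOrbit u F) (n : ℤ) : F n = V n * F 0 := by
  induction n with
  | zero => rw [h0, one_mul]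
  | succ n ih => rw [hF, hV, ih, mul_assoc]
  | pred n ih =>
    have h1 := wordOp_mul hu hF (-n) 1
    have h2 := wordOp_mul hu hV (-n) 1
    rw [Nat.cast_one] at h1 h2
    rw [← h1, ← h2, ih, mul_assoc]

/-- To the right the Darboux operators are multiplied up, to the left the words starting at site 0
are used. -/
lemma exists_orbit (hu : ∀ n, IsUnit (u n)) : ∃ V : ℤ → Op d, IsOrbit u V ∧ V 0 = 1 := by
  let P : ℕ → Op d := fun k => Nat.rec 1 (fun k A => darboux d (u k) * A) k
  let N : ℕ → Op d := fun k => wordOp d u 0 k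
  refine ⟨fun n => if 0 ≤ n then P n.toNat else N (-n).toNat, fun n => ?_, rfl⟩
  obtain ⟨k, rfl | rfl⟩ := n.eq_nat_or_neg
  · simp only [Int.toNat_natCast, Nat.cast_nonneg, if_true]
    rw [if_pos (by omega), show ((k : ℤ) + 1).toNat = k + 1 by omega]
  · cases k with
    | zero => rfl
    | succ k =>
      have e : (if 0 ≤ (-((k + 1 : ℕ) : ℤ) + 1) then P (-((k + 1 : ℕ) : ℤ) + 1).toNat
          else N (-(-((k + 1 : ℕ) : ℤ) + 1)).toNat) = N k := by
        cases k with
        | zero => rfl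
        | succ k =>
          rw [if_neg (by push_cast; omega)]
          congr 1
      simp only
      rw [e, if_neg (by push_cast; omega), show (-(-((k + 1 : ℕ) : ℤ))).toNat = k + 1 by omega]
      change wordOp d u 0 k = darboux d (u (-((k + 1 : ℕ) : ℤ))) *
        (darbouxInv d (u (0 - ((k : ℤ) + 1))) * wordOp d u 0 k)
      rw [show (0 - ((k : ℤ) + 1)) = -((k + 1 : ℕ) : ℤ) by push_cast; ring, ← mul_assoc,
        darboux_mul_darbouxInv (hu _), one_mul]

variable (u) in
/-- `L = D + ∑_{k ≥ 1} a_k (D - ∂ ln u_{n-k})⁻¹ ⋯ (D - ∂ ln u_{n-1})⁻¹`. -/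
def IsWordExpansion (n : ℤ) (L : Op d) (a : ℕ → R) : Prop :=
  IsSum (fun k : ℕ => a (k + 1) • (wordOp d u n (k + 1)).ser) (L - z d 1).ser

lemma exists_wordExpansion (hu : ∀ n, IsUnit (u n)) (n : ℤ) {L : Op d}
    (hL : Ord (L - z d 1) (-1)) : ∃ a, IsWordExpansion u n L a := by
  have hP : ∀ k : ℕ, Monic (wordOp d u n (k + 1)) (-1 - k) := fun k => by
    have h := monic_wordOp (d := d) hu n (k + 1)
    rwa [show -((k + 1 : ℕ) : ℤ) = -1 - k by push_cast; ring] at h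
  obtain ⟨x, hx⟩ := exists_expansion (fun k => (hP k).1) (fun k => (hP k).2) hL
  -- The expansion is numbered from 0 and `a` from 1; `a 0` is a default value that enters no term.
  exact ⟨fun k => x (k - 1), hx⟩

lemma IsWordExpansion.unique (hu : ∀ n, IsUnit (u n)) {n : ℤ} {L : Op d} {a a' : ℕ → R}
    (h : IsWordExpansion u n L a) (h' : IsWordExpansion u n L a') {k : ℕ} (hk : 1 ≤ k) :
    a' k = a k := by
  have hP : ∀ k : ℕ, Monic (wordOp d u n (k + 1)) (-1 - k) := fun k => by
    have h := monic_wordOp (d := d) hu n (k + 1)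
    rwa [show -((k + 1 : ℕ) : ℤ) = -1 - k by push_cast; ring] at h
  have := congrFun (expansion_unique (x := fun k => a' (k + 1)) (y := fun k => a (k + 1))
    (fun k => (hP k).1) (fun k => (hP k).2) h' h) (k - 1)
  simpa only [Nat.sub_add_cancel hk] using this

variable (d u) in
/-- The matrix of the operators `L(n)` in a Darboux orbit. -/
def orbitMatrix (a : ℤ → ℕ → R) : Matrix ℤ ℤ R := fun n m =>
  if m = n + 1 then 1
  else if m = n then d (u n) * Ring.inverse (u n)
  else if m < n then a n (n - m).toNat
  else 0

/-- The words in the expansion of L shift F_n to the sites n - k, and D F_n = F_{n+1} + (∂ ln u_n)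
F_n. Nothing about the flows enters, so the lemma applies to Q and, after reflection of the sites,
to Q̄. -/
lemma isSum_orbitMatrix (hu : ∀ n, IsUnit (u n)) {F : ℤ → Op d} (hF : IsOrbit u F)
    {L : Op d} {a : ℤ → ℕ → R} {n : ℤ} (ha : IsWordExpansion u n L (a n)) :
    IsSum (fun m => orbitMatrix d u a n m • (F m).ser) (L * F n).ser := by
  have h1 := ha.mul_right d (F n).ser
  have h2 : IsSum (fun k : ℕ => a n (k + 1) • (F (n - (k + 1))).ser)
      ((L - z d 1) * F n).ser := by
    refine h1.congr (fun k => ?_) rfl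
    have h3 := wordOp_mul hu hF n (k + 1)
    have h4 := congrArg Op.ser (smul_mul_assoc (a n (k + 1)) (wordOp d u n (k + 1)) (F n))
    rw [h3] at h4
    push_cast at h4
    exact h4
  have h3 : IsSum (fun m => if m < n then a n (n - m).toNat • (F m).ser else 0)
      ((L - z d 1) * F n).ser := by
    refine h2.extend (e := fun k : ℕ => n - (k + 1)) (fun x y h => ?_) (fun k => ?_) fun m hm => ?_
    · simp only at h
      omega
    · rw [if_pos (by omega)]
      congr 2
      omega
    · rw [if_neg]
      intro hmn
      exact hm ⟨(n - m - 1).toNat, by simp only; omega⟩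
  have h4 := h3.add (isSum_finset {n, n + 1}
    (fun m => if m = n + 1 then (F m).ser else if m = n then (d (u n) * Ring.inverse (u n)) •
      (F m).ser else 0) fun m hm => by
        simp only [Finset.mem_insert, Finset.mem_singleton, not_or] at hm
        rw [if_neg hm.2, if_neg hm.1])
  refine h4.congr (fun m => ?_) ?_
  · simp only [orbitMatrix]
    by_cases c1 : m = n + 1
    · rw [if_pos c1, if_pos c1, if_neg (by omega), one_smul, zero_add]
    · rw [if_neg c1, if_neg c1]
      by_cases c2 : m = n
      · rw [if_pos c2, if_pos c2, if_neg (by omega), zero_add]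
      · rw [if_neg c2, if_neg c2, add_zero]
        split_ifs
        · rfl
        · rw [zero_smul]
  · rw [Finset.sum_pair (by omega), if_neg (by omega), if_pos rfl, if_pos rfl, hF,
      darboux_mul (hu n), sub_mul]
    have : ∀ A B C : upSeries R, A - B + (C + (B - C)) = A := fun A B C => by abel
    exact this _ _ _

variable (d u) in
/-- `orbitMatrix` as an element of the ring of matrices bounded above. -/
def orbitMat (a : ℤ → ℕ → R) : UBMat R := ⟨orbitMatrix d u a, 1, fun n m h => by
  rw [orbitMatrix, if_neg (by omega), if_neg (by omega), if_neg (by omega)]⟩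

end Op

/-! ### Families of series as matrices -/

/-- The orders of the rows increase with n and the diagonal is invertible, so each row of A is
recovered from its combination of the `M n` from the top down. -/
lemma rows_cancel {M : ℤ → upSeries R} (hM : ∀ n, OrdLE (M n) n)
    (hu : ∀ n, IsUnit ((M n).1 n)) {A : UBMat R} (h : A * rows M hM = 0) : A = 0 := by
  obtain ⟨r, hr⟩ := A.ub
  ext n m
  refine eq_zero_of_triangular hM hu (x := fun m => A.1 n m) (N := n + r) (n := m)
    (fun l hl => hr n l hl) (fun j _ => ?_) m le_rfl
  exact congrArg (fun B : UBMat R => B.1 n j) h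

lemma rows_mul_rep (d : Derivation ℤ R R) {M : ℤ → upSeries R} (hM : ∀ n, OrdLE (M n) n)
    (A : Op d) (n j : ℤ) :
    (rows M hM * rep d A.ser).1 n j = (leibniz d (M n) A.ser).1 j :=
  (leibniz_coeff d (M n) A.ser j).symm

lemma rep_pow (d : Derivation ℤ R R) (A : Op d) (r : ℕ) :
    rep d (A ^ r).ser = rep d A.ser ^ r := by
  induction r with
  | zero => rw [pow_zero, pow_zero, Op.rep_one]
  | succ r ih => rw [pow_succ, pow_succ, Op.rep_mul, ih]

lemma pow_mul_eq {S : Type*} [Ring S] {Q V L : S} (h : Q * V = V * L) (r : ℕ) :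
    Q ^ r * V = V * L ^ r := by
  induction r with
  | zero => rw [pow_zero, pow_zero, one_mul, mul_one]
  | succ r ih => rw [pow_succ', mul_assoc, ih, ← mul_assoc, h, mul_assoc, pow_succ']

lemma rep_deriv {d e : Derivation ℤ R R} (he : ∀ f, e (d f) = d (e f)) (A : Op d) :
    (rep d A.ser).deriv e = rep d (A.deriv e).ser := by
  ext i j
  exact Op.zpowMul_coeffDeriv he i A.ser j

lemma rep_sub (d : Derivation ℤ R R) (A B : Op d) :
    rep d (A - B).ser = rep d A.ser - rep d B.ser := by
  rw [eq_sub_iff_add_eq, ← rep_add, ← Op.add_ser, sub_add_cancel]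

/-- If two bounded combinations of a triangular family agree in the coefficients of `z^j`,
`j ≥ n`, their coefficients from `n` on agree. -/
lemma eq_of_triangular {M : ℤ → upSeries R} (hM : ∀ n, OrdLE (M n) n)
    (hu : ∀ n, IsUnit ((M n).1 n)) {x y : ℤ → R} {N n : ℤ} (hx : ∀ m, N < m → x m = 0)
    (hy : ∀ m, N < m → y m = 0)
    (h : ∀ j, n ≤ j → ∑ᶠ m, x m * (M m).1 j = ∑ᶠ m, y m * (M m).1 j) :
    ∀ m, n ≤ m → x m = y m := by
  have hfin : ∀ {x : ℤ → R}, (∀ m, N < m → x m = 0) → ∀ j,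
      ∑ᶠ m, x m * (M m).1 j = ∑ m ∈ Finset.Icc j N, x m * (M m).1 j := fun hx j => by
    refine finsum_eq_sum_Icc j N fun m hm => ⟨?_, ?_⟩
    · by_contra hc
      exact hm (by rw [hM m j (by omega), mul_zero])
    · by_contra hc
      exact hm (by rw [hx m (by omega), zero_mul])
  have hd : ∀ m, N < m → x m - y m = 0 := fun m hm => by rw [hx m hm, hy m hm, sub_self]
  intro m hm
  refine sub_eq_zero.1 (eq_zero_of_triangular hM hu (x := fun m => x m - y m) hd (fun j hj => ?_)
    m hm)
  rw [hfin hd, ← sub_eq_zero.2 (h j hj), hfin hx, hfin hy, ← Finset.sum_sub_distrib]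
  simp only [sub_mul]

/-! ### Spans -/

/-- The map obeys a Leibniz rule instead of being linear, so the generators must lie in N as well as
their images. -/
lemma map_mem_of_span {M : Type*} [AddCommGroup M] [Module R M] {δ : R → R} (f : M →+ M)
    (hf : ∀ (a : R) x, f (a • x) = a • f x + δ a • x) {s : Set M} {N : Submodule R M}
    (hs : s ⊆ N) (h : ∀ x ∈ s, f x ∈ N) {x : M} (hx : x ∈ Submodule.span R s) : f x ∈ N := by
  induction hx using Submodule.span_induction with
  | mem x hx => exact h x hx
  | zero => rw [map_zero]; exact N.zero_mem
  | add x y _ _ hx hy => rw [map_add]; exact N.add_mem hx hy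
  | smul a x hx ih =>
    rw [hf]
    exact N.add_mem (N.smul_mem a ih) (N.smul_mem _ (Submodule.span_le.2 hs hx))

end DoubleKP
end

noncomputable section
namespace DoubleKP

variable {R : Type*} [CommRing R]

namespace Op
variable {d : Derivation ℤ R R}

/-! ### Differential operators -/

/-- Only nonnegative powers of `D` occur. -/
def IsDiff (A : Op d) : Prop := ∀ j < 0, A.ser.1 j = 0

/-- The differential part. -/
def plus (A : Op d) : Op d := ⟨plusPart A.ser⟩

lemma plus_coeff (A : Op d) (j : ℤ) : A.plus.ser.1 j = if 0 ≤ j then A.ser.1 j else 0 := rfl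

lemma isDiff_plus (A : Op d) : IsDiff A.plus := fun j hj => by
  rw [plus_coeff, if_neg (by omega)]

lemma ord_sub_plus (A : Op d) : Ord (A - A.plus) (-1) := fun j hj => by
  rw [sub_ser, sub_coeff, plus_coeff, if_pos (by omega), sub_self]

lemma IsDiff.eq_plus {E A : Op d} (hE : IsDiff E) (h : Ord (E - A) (-1)) : E = A.plus := by
  refine Op.ext (upSeries.ext fun j => ?_)
  rw [plus_coeff]
  split_ifs with hj
  · exact sub_eq_zero.1 (h j (by omega))
  · exact hE j (by omega)

lemma isDiff_c (f : R) : IsDiff (c d f) := fun j hj => by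
  change (DoubleKP.mono 0 f).1 j = 0
  rw [mono_coeff, if_neg (by omega)]

lemma isDiff_z (k : ℕ) : IsDiff (z d k) := fun j hj => by
  change (DoubleKP.mono (k : ℤ) (1 : R)).1 j = 0
  rw [mono_coeff, if_neg (by omega)]

lemma IsDiff.mul {A B : Op d} (hA : IsDiff A) (hB : IsDiff B) : IsDiff (A * B) := by
  have h : ∀ k : ℕ, ∀ j < 0, (zpowMul d k B.ser).1 j = 0 := by
    intro k
    induction k with
    | zero => intro j hj; rw [Nat.cast_zero, zpowMul_zero]; exact hB j hj
    | succ k ih =>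
      intro j hj
      rw [Nat.cast_succ, zpowMul_succ]
      change d ((zpowMul d k B.ser).1 j) + (zpowMul d k B.ser).1 (j - (1 : ℕ)) = 0
      rw [ih j hj, ih _ (by push_cast; omega), map_zero, add_zero]
  intro j hj
  rw [mul_coeff]
  refine (finsum_congr fun i => ?_).trans finsum_zero
  by_cases hi : i < 0
  · rw [hA i hi, zero_mul]
  · obtain ⟨k, rfl⟩ := Int.eq_ofNat_of_zero_le (not_lt.1 hi)
    rw [h k j hj, mul_zero]

lemma IsDiff.sub {A B : Op d} (hA : IsDiff A) (hB : IsDiff B) : IsDiff (A - B) := fun j hj => by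
  rw [sub_ser, sub_coeff, hA j hj, hB j hj, sub_self]

lemma applyFun_eq_sum {A : Op d} {K : ℕ} (hA : Ord A (K - 1)) (f : R) :
    applyFun d A.ser f = ∑ i ∈ Finset.range K, A.ser.1 i * (⇑d)^[i] f := by
  refine finsum_eq_sum_of_support_subset _ fun i hi => ?_
  by_contra hc
  simp only [Finset.coe_range, Set.mem_Iio, not_lt] at hc
  exact hi (by simp only; rw [hA _ (by omega), zero_mul])

lemma applyFun_zero (A : Op d) : applyFun d A.ser 0 = 0 :=
  (finsum_congr fun i => by rw [iterate_zero', mul_zero]).trans finsum_zero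

/-- In D^i ∘ f the power D^0 comes only from the term in which all i derivatives fall on f. -/
lemma mul_c_coeff_zero {B : Op d} (hB : IsDiff B) (f : R) :
    (B * c d f).ser.1 0 = applyFun d B.ser f := by
  rw [mul_coeff]
  have h1 : ∀ i ∉ Set.range (fun k : ℕ => (k : ℤ)), B.ser.1 i = 0 := fun i hi => by
    refine hB i ?_
    by_contra h
    exact hi ⟨i.toNat, by simp only; omega⟩
  have h2 : ∀ k : ℕ, (zpowMul d k (c d f).ser).1 0 = (⇑d)^[k] f := fun k => by
    refine (finsum_eq_single _ k fun l hl => ?_).trans ?_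
    · change _ • (⇑d)^[l] ((DoubleKP.mono 0 f).1 _) = _
      rw [mono_coeff, if_neg (by omega), iterate_zero', smul_zero]
    · change _ • (⇑d)^[k] ((DoubleKP.mono 0 f).1 _) = _
      rw [mono_coeff, if_pos (by omega), Ring.choose_natCast, Nat.choose_self, Nat.cast_one,
        one_smul]
  have h3 : ∑ᶠ i, B.ser.1 i * (zpowMul d i (c d f).ser).1 0 =
      ∑ᶠ (i : ℤ) (_ : i ∈ Set.range (fun k : ℕ => (k : ℤ))),
        B.ser.1 i * (zpowMul d i (c d f).ser).1 0 := by
    classical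
    refine finsum_congr fun i => ?_
    by_cases hi : i ∈ Set.range (fun k : ℕ => (k : ℤ))
    · rw [finsum_eq_if, if_pos hi]
    · rw [finsum_eq_if, if_neg hi, h1 i hi, zero_mul]
  rw [h3, finsum_mem_range Nat.cast_injective]
  exact finsum_congr fun k => by rw [h2]

/-- `Res (D⁻¹ Ψ B)`, which is `B^*(Ψ)` for a differential operator `B`. -/
def adjRes (B : Op d) (ψ : R) : R := (z d (-1) * c d ψ * B).ser.1 (-1)

/-- D times the negative part of D⁻¹ψB is the difference of ψB and a differential operator, and its
order is at most 0. It is therefore a function, and the negative part is D⁻¹ times that function. -/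
lemma eq_plus_add (B : Op d) (hB : IsDiff B) (ψ : R) :
    z d (-1) * c d ψ * B = (z d (-1) * c d ψ * B).plus + z d (-1) * c d (adjRes B ψ) := by
  set A := z d (-1) * c d ψ * B with hA
  have h0 := ord_sub_plus A
  have h1 : z d 1 * (A - A.plus) = c d ψ * B - z d 1 * A.plus := by
    rw [mul_sub, hA, mul_assoc (z d (-1)), ← mul_assoc (z d 1), z_mul_z, add_neg_cancel, z_zero,
      one_mul]
  have h2 : IsDiff (z d 1 * (A - A.plus)) := by
    rw [h1]
    exact ((isDiff_c ψ).mul hB).sub ((isDiff_z 1).mul (isDiff_plus A))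
  have h3 : Ord (z d 1 * (A - A.plus)) 0 := (ord_z 1).mul h0
  have h4 : z d 1 * (A - A.plus) = c d ((z d 1 * (A - A.plus)).ser.1 0) := by
    refine Op.ext (upSeries.ext fun j => ?_)
    change _ = (DoubleKP.mono 0 _).1 j
    rw [mono_coeff]
    obtain h | rfl | h := lt_trichotomy j 0
    · rw [if_neg h.ne, h2 j h]
    · rw [if_pos rfl]
    · rw [if_neg h.ne', h3 j h]
  have h5 : (z d 1 * (A - A.plus)).ser.1 0 = adjRes B ψ := by
    have h := mul_lead (ord_z (d := d) 1) h0
    rw [(monic_z 1).2, one_mul] at h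
    refine h.trans ?_
    rw [sub_ser, sub_coeff, plus_coeff, if_neg (by omega), sub_zero]
    rfl
  rw [h5] at h4
  have h6 : A - A.plus = z d (-1) * c d (adjRes B ψ) := by
    rw [← h4, ← mul_assoc, z_mul_z, neg_add_cancel, z_zero, one_mul]
  rw [← h6, add_sub_cancel]

lemma coeff_adj_mul {B : Op d} (hB : IsDiff B) (ψ f : R) :
    (z d (-1) * c d ψ * B * c d f).ser.1 (-1) = adjRes B ψ * f := by
  rw [eq_plus_add B hB, add_mul, add_ser, add_coeff,
    ((isDiff_plus _).mul (isDiff_c f)) (-1) (by omega), zero_add, mul_assoc, c_mul_c]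
  have h := mul_lead (ord_z (d := d) (-1)) (ord_c (adjRes B ψ * f))
  rw [(monic_z (-1)).2, one_mul] at h
  refine h.trans ?_
  exact mono_self _ _

/-- The negative part D⁻¹g of D⁻¹ψB contributes g-terms D⁻¹ g f D⁻¹ of order -2 and no residue. So
the evolution of a potential ∂⁻¹(Φ_kΨ_j) is one differential operator, independent of k, applied to
Φ_k. -/
lemma coeff_pot {B : Op d} (hB : IsDiff B) (ψ f : R) :
    (z d (-1) * c d ψ * (B * (c d f * z d (-1)))).ser.1 (-1) =
      applyFun d (z d (-1) * c d ψ * B).plus.ser f := by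
  rw [show z d (-1) * c d ψ * (B * (c d f * z d (-1))) = z d (-1) * c d ψ * B * c d f * z d (-1) by
    simp only [mul_assoc], mul_z_coeff, sub_self, ← mul_c_coeff_zero (isDiff_plus _)]
  nth_rw 1 [eq_plus_add B hB]
  rw [add_mul, add_ser, add_coeff, add_eq_left]
  exact (((ord_z (-1)).mul (ord_c _)).mul (ord_c f)) 0 (by omega)

/-- The derivative of the potential `Res (D⁻¹ Ψ B Φ D⁻¹)`. -/
lemma deriv_coeff_pot {B : Op d} (hB : IsDiff B) (ψ f : R) :
    d ((z d (-1) * c d ψ * (B * (c d f * z d (-1)))).ser.1 (-1)) =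
      ψ * applyFun d B.ser f - adjRes B ψ * f := by
  set Z := z d (-1) * c d ψ * (B * (c d f * z d (-1))) with hZ
  have h1 : z d 1 * Z = ψ • (B * c d f * z d (-1)) := by
    rw [hZ, ← c_mul]
    calc _ = (z d 1 * z d (-1)) * (c d ψ * (B * (c d f * z d (-1)))) := by simp only [mul_assoc]
      _ = _ := by rw [z_mul_z, add_neg_cancel, z_zero, one_mul]; simp only [mul_assoc]
  have h2 : Z * z d 1 = z d (-1) * c d ψ * B * c d f := by
    rw [hZ]
    calc _ = z d (-1) * c d ψ * B * c d f * (z d (-1) * z d 1) := by simp only [mul_assoc]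
      _ = _ := by rw [z_mul_z, neg_add_cancel, z_zero, mul_one]
  -- The derivative of the residue of Z is the residue of [D, Z]; DZ and ZD each lose one outer D⁻¹.
  have h3 := congrArg (fun A : Op d => A.ser.1 (-1)) (z_one_mul_sub Z)
  simp only [sub_ser, sub_coeff] at h3
  refine Eq.trans (Eq.symm h3) ?_
  rw [h1, h2, coeff_adj_mul hB, smul_ser, smul_coeff, mul_z_coeff, sub_self, mul_c_coeff_zero hB]

lemma plus_pow_one {L : Op d} (hL : Ord (L - z d 1) (-1)) : (L ^ 1).plus = z d 1 := by
  rw [pow_one]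
  exact ((isDiff_z 1).eq_plus (by simpa using hL.neg)).symm

lemma coeff_pot_z (ψ f : R) :
    (z d (-1) * c d ψ * (z d 1 * (c d f * z d (-1)))).ser.1 (-1) = f * ψ := by
  have h1 : c d ψ * z d 1 = z d 1 * c d ψ - c d (d ψ) := by
    have := z_one_mul_sub (c d ψ)
    rw [deriv_c] at this
    rw [← this]
    abel
  have h2 : z d (-1) * c d ψ * (z d 1 * (c d f * z d (-1))) =
      (c d (f * ψ) - z d (-1) * c d (d ψ) * c d f) * z d (-1) := by
    calc _ = z d (-1) * (c d ψ * z d 1) * c d f * z d (-1) := by simp only [mul_assoc]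
      _ = (z d (-1) * z d 1 * c d ψ - z d (-1) * c d (d ψ)) * c d f * z d (-1) := by
        rw [h1]; noncomm_ring
      _ = _ := by rw [z_mul_z, neg_add_cancel, z_zero, one_mul, sub_mul, c_mul_c, mul_comm f]
  rw [h2, mul_z_coeff, sub_self, sub_ser, sub_coeff,
    (((ord_z (-1)).mul (ord_c _)).mul (ord_c f)) 0 (by omega), sub_zero]
  exact mono_self _ _

end Op
end DoubleKP
end

/-! ### The pairs (V_n, χ_n), the potential pairs, and the stability of their span. -/

noncomputable section
namespace DoubleKP

variable {R : Type*} [CommRing R]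

/-- The hypotheses on the orbit of KP data, with the Darboux orbit `V` of the identity. -/
structure GhostOrbit (dt dtb : ℕ → Derivation ℤ R R) (X : ℤ → KPData R) (V : ℤ → Op (dt 1)) :
    Prop where
  comm : ∀ r, 1 ≤ r → ∀ f, dt r (dt 1 f) = dt 1 (dt r f)
  comm_ghost : ∀ s, 1 ≤ s → ∀ f, dtb s (dt 1 f) = dt 1 (dtb s f)
  kp : IsGhostKP dt dtb (X 0)
  unit : ∀ n, IsUnit ((X n).Φ 1)
  db : ∀ n, IsDB (dt 1) (X n) (X (n + 1))
  orbit : Op.IsOrbit (fun n => (X n).Φ 1) V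
  zero : V 0 = 1

/-- The series `∑_{k ≥ 1} Φ_k z^{1-k-n}`. -/
def chi (X : ℤ → KPData R) (n : ℤ) : upSeries R :=
  ⟨fun i => if i ≤ -n then (X n).Φ (1 - n - i).toNat else 0, -n, fun j hj => if_neg (by omega)⟩

/-- The series `z^{j-n} + ∑_{k ≥ 1} S_{kj} z^{1-k-n}`. -/
def sig (X : ℤ → KPData R) (n : ℤ) (j : ℕ) : upSeries R :=
  ⟨fun i => if i ≤ -n then (X n).S (1 - n - i).toNat j else if i = j - n then 1 else 0,
    max (-n) (j - n), fun i hi => by simp only; rw [if_neg (by omega), if_neg (by omega)]⟩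

lemma chi_coeff (X : ℤ → KPData R) (n i : ℤ) :
    (chi X n).1 i = if i ≤ -n then (X n).Φ (1 - n - i).toNat else 0 := rfl

lemma sig_coeff (X : ℤ → KPData R) (n : ℤ) (j : ℕ) (i : ℤ) : (sig X n j).1 i =
    if i ≤ -n then (X n).S (1 - n - i).toNat j else if i = j - n then 1 else 0 := rfl

lemma ordLE_chi (X : ℤ → KPData R) (n : ℤ) : OrdLE (chi X n) (-n) := fun j hj => by
  rw [chi_coeff, if_neg (by omega)]

lemma chi_lead (X : ℤ → KPData R) (n : ℤ) : (chi X n).1 (-n) = (X n).Φ 1 := by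
  rw [chi_coeff, if_pos le_rfl]
  congr 1
  omega

/-- The pairs of operators and series on which all flows act. -/
abbrev PairSpace (d : Derivation ℤ R R) := Op d × upSeries R

/-- Composition with `D` in both components. -/
def pairD (d : Derivation ℤ R R) : PairSpace d →+ PairSpace d :=
  AddMonoidHom.mk' (fun x => (Op.z d 1 * x.1, coeffDeriv d x.2)) fun _ _ =>
    Prod.ext (mul_add _ _ _) (upSeries.ext fun _ => map_add d _ _)

/-- The flow `∂ + · B` on operators and `∂ + t` on series. -/
def nabla {d : Derivation ℤ R R} (e : Derivation ℤ R R) (B : Op d)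
    (t : upSeries R →ₗ[R] upSeries R) : PairSpace d →+ PairSpace d :=
  AddMonoidHom.mk' (fun x => (x.1.deriv e + x.1 * B, coeffDeriv e x.2 + t x.2)) fun x y =>
    Prod.ext (by
      simp only [Prod.fst_add, Op.deriv_add, add_mul]
      abel) (upSeries.ext fun _ => by
      simp only [Prod.snd_add, map_add, add_coeff, coeffDeriv_coeff]
      ring)

/-- Multiplication by `λ^s` as a linear map. -/
def lamLin (s : ℕ) : upSeries R →ₗ[R] upSeries R where
  toFun := lam s
  map_add' _ _ := rfl
  map_smul' _ _ := rfl

lemma pairD_smul {d : Derivation ℤ R R} (a : R) (x : PairSpace d) :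
    pairD d (a • x) = a • pairD d x + d a • x :=
  Prod.ext (Op.z_one_mul_smul a x.1) (upSeries.ext fun j => by
    change d (a * x.2.1 j) = a * d (x.2.1 j) + d a * x.2.1 j
    rw [Derivation.leibniz, smul_eq_mul, smul_eq_mul]
    ring)

lemma nabla_smul {d : Derivation ℤ R R} (e : Derivation ℤ R R) (B : Op d)
    (t : upSeries R →ₗ[R] upSeries R) (a : R) (x : PairSpace d) :
    nabla e B t (a • x) = a • nabla e B t x + e a • x :=
  Prod.ext (by
    change (a • x.1).deriv e + a • x.1 * B = a • (x.1.deriv e + x.1 * B) + e a • x.1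
    rw [Op.deriv_smul, smul_mul_assoc, smul_add]
    abel) (upSeries.ext fun j => by
    change e (a * x.2.1 j) + (t (a • x.2)).1 j = a * (e (x.2.1 j) + (t x.2).1 j) + e a * x.2.1 j
    rw [Derivation.leibniz, smul_eq_mul, smul_eq_mul, map_smul, smul_coeff]
    ring)

/-- D multiplies from the left and B from the right, and e commutes with ∂. -/
lemma nabla_pairD {d e : Derivation ℤ R R} (he : ∀ f, e (d f) = d (e f)) (B : Op d)
    {t : upSeries R →ₗ[R] upSeries R} (ht : ∀ y, t (coeffDeriv d y) = coeffDeriv d (t y))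
    (x : PairSpace d) : nabla e B t (pairD d x) = pairD d (nabla e B t x) :=
  Prod.ext (by
    change (Op.z d 1 * x.1).deriv e + Op.z d 1 * x.1 * B = Op.z d 1 * (x.1.deriv e + x.1 * B)
    rw [Op.deriv_mul he, Op.deriv_z, zero_mul, zero_add, mul_add, mul_assoc])
    (upSeries.ext fun j => by
    change e (d (x.2.1 j)) + (t (coeffDeriv d x.2)).1 j = d (e (x.2.1 j) + (t x.2).1 j)
    rw [ht, map_add, he]
    rfl)

namespace GhostOrbit

variable {dt dtb : ℕ → Derivation ℤ R R} {X : ℤ → KPData R} {V : ℤ → Op (dt 1)}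

/-- The pair `(V_n, χ_n)`. -/
def pair (X : ℤ → KPData R) (V : ℤ → Op (dt 1)) (n : ℤ) : PairSpace (dt 1) := (V n, chi X n)

/-- The pair `(D⁻¹ Ψ_j V_n, σ_{j,n})`. -/
def potPair (X : ℤ → KPData R) (V : ℤ → Op (dt 1)) (n : ℤ) (j : ℕ) : PairSpace (dt 1) :=
  (Op.z (dt 1) (-1) * Op.c (dt 1) ((X n).Ψ j) * V n, sig X n j)

variable (h : GhostOrbit dt dtb X V)
include h

lemma monic (n : ℤ) : Op.Monic (V n) n :=
  h.orbit.monic h.unit (by rw [h.zero]; exact Op.monic_one) n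

/-- Both components obey the same Darboux recursion. The exponents 1 - k - n are chosen so that the
passage from Φ_{k+1} at n to Φ_k at n + 1 preserves the power of z. -/
lemma pairD_pair (n : ℤ) : pairD (dt 1) (pair X V n) =
    pair X V (n + 1) + (dt 1 ((X n).Φ 1) * Ring.inverse ((X n).Φ 1)) • pair X V n := by
  refine Prod.ext ?_ (upSeries.ext fun i => ?_)
  · change Op.z (dt 1) 1 * V n = V (n + 1) + _ • V n
    rw [h.orbit, Op.darboux_mul (h.unit n), sub_add_cancel]
  · change dt 1 ((chi X n).1 i) = (chi X (n + 1)).1 i + _ * (chi X n).1 i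
    have hu := Ring.mul_inverse_cancel _ (h.unit n)
    rw [chi_coeff, chi_coeff]
    obtain hi | rfl | hi : i < -n ∨ i = -n ∨ -n < i := by omega
    · rw [if_pos (by omega), if_pos (by omega), (h.db n).phi _ (by omega),
        show (1 - (n + 1) - i).toNat + 1 = (1 - n - i).toNat by omega, Derivation.leibniz,
        smul_eq_mul, smul_eq_mul]
      linear_combination (-(dt 1 ((X n).Φ (1 - n - i).toNat))) * hu -
        ((X n).Φ (1 - n - i).toNat) * mul_deriv_inverse (dt 1) (h.unit n)
    · rw [if_pos le_rfl, if_neg (by omega), show (1 - n - -n).toNat = 1 by omega]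
      linear_combination (-(dt 1 ((X n).Φ 1))) * hu
    · rw [if_neg (by omega), if_neg (by omega), map_zero, mul_zero, add_zero]

/-- In the first component D⁻¹ (1/Φ_1) cancels the left factors of T_n = Φ_1 D Φ_1⁻¹; in the second,
`phi_back` writes the potentials with Ψ_1 as the quotients Φ_{k+1}/Φ_1. -/
lemma potPair_one (n : ℤ) :
    potPair X V (n + 1) 1 = Ring.inverse ((X n).Φ 1) • pair X V n := by
  have hu := Ring.mul_inverse_cancel _ (h.unit n)
  have hu' := Ring.inverse_mul_cancel _ (h.unit n)
  refine Prod.ext ?_ (upSeries.ext fun i => ?_)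
  · change Op.z (dt 1) (-1) * Op.c (dt 1) ((X (n + 1)).Ψ 1) * V (n + 1) = _ • V n
    rw [h.orbit, (h.db n).psi_one, Op.darboux_eq, ← Op.c_mul]
    calc _ = Op.z (dt 1) (-1) * (Op.c (dt 1) (Ring.inverse ((X n).Φ 1)) *
          Op.c (dt 1) ((X n).Φ 1)) * Op.z (dt 1) 1 *
          (Op.c (dt 1) (Ring.inverse ((X n).Φ 1)) * V n) := by simp only [mul_assoc]
      _ = _ := by rw [Op.c_mul_c, hu', Op.c_one, mul_one, Op.z_mul_z, neg_add_cancel, Op.z_zero,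
        one_mul]
  · change (sig X (n + 1) 1).1 i = _ * (chi X n).1 i
    rw [sig_coeff, chi_coeff]
    obtain hi | rfl | hi : i < -n ∨ i = -n ∨ -n < i := by omega
    · have hp := (h.db n).phi_back (1 - (n + 1) - i).toNat (by omega)
      rw [(h.db n).psi_one, Ring.inverse_inverse (h.unit n),
        show (1 - (n + 1) - i).toNat + 1 = (1 - n - i).toNat by omega] at hp
      rw [if_pos (by omega), if_pos (by omega), hp, ← mul_assoc, hu', one_mul]
    -- In degree -n the extra monomial of `sig` supplies the coefficient 1 = Φ_1/Φ_1, which no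
    -- potential provides.
    · rw [if_neg (by omega), if_pos (by push_cast; omega), if_pos le_rfl,
        show (1 - n - -n).toNat = 1 by omega, hu']
    · rw [if_neg (by omega), if_neg (by push_cast; omega), if_neg (by omega), mul_zero]

/-- Integration by parts: D⁻¹ p D = p - D⁻¹ p' with p = Ψ_{j+1} at site n + 1, together with
`psi_back` for the remaining D⁻¹ term. -/
lemma potPair_succ (n : ℤ) {j : ℕ} (hj : 1 ≤ j) : potPair X V (n + 1) (j + 1) =
    potPair X V n j + (X (n + 1)).Ψ (j + 1) • pair X V n := by
  have hu := Ring.mul_inverse_cancel _ (h.unit n)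
  have hu' := Ring.inverse_mul_cancel _ (h.unit n)
  refine Prod.ext ?_ (upSeries.ext fun i => ?_)
  · change Op.z (dt 1) (-1) * Op.c (dt 1) ((X (n + 1)).Ψ (j + 1)) * V (n + 1) =
      Op.z (dt 1) (-1) * Op.c (dt 1) ((X n).Ψ j) * V n + (X (n + 1)).Ψ (j + 1) • V n
    rw [h.orbit, Op.darboux_mul (h.unit n), (h.db n).psi_back j hj, (h.db n).psi_one,
      Ring.inverse_inverse (h.unit n)]
    set p := (X (n + 1)).Ψ (j + 1)
    set f := (X n).Φ 1
    set g := Ring.inverse f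
    have e1 := Op.z_one_mul_sub (Op.c (dt 1) p)
    rw [Op.deriv_c] at e1
    have e2 : Op.c (dt 1) p * Op.z (dt 1) 1 = Op.z (dt 1) 1 * Op.c (dt 1) p -
      Op.c (dt 1) (dt 1 p) := by rw [← e1]; abel
    have e3 : -(g * dt 1 (p * f)) = -(dt 1 p + p * (dt 1 f * g)) := by
      rw [Derivation.leibniz, smul_eq_mul, smul_eq_mul]
      linear_combination (-(dt 1 p)) * hu'
    have e4 : Op.c (dt 1) (-(dt 1 p + p * (dt 1 f * g))) = -(Op.c (dt 1) (dt 1 p) +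
        Op.c (dt 1) p * Op.c (dt 1) (dt 1 f * g)) := by
      rw [Op.c_mul_c, Op.c_eq, Op.c_eq, Op.c_eq, neg_smul, add_smul]
    have e5 : Op.z (dt 1) (-1) * Op.z (dt 1) 1 = 1 := by
      rw [Op.z_mul_z, neg_add_cancel, Op.z_zero]
    rw [e3, e4, ← Op.c_mul, ← Op.c_mul]
    calc _ = Op.z (dt 1) (-1) * (Op.c (dt 1) p * Op.z (dt 1) 1 -
          Op.c (dt 1) p * Op.c (dt 1) (dt 1 f * g)) * V n := by
            simp only [mul_sub, sub_mul, mul_assoc]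
      _ = Op.z (dt 1) (-1) * -(Op.c (dt 1) (dt 1 p) +
          Op.c (dt 1) p * Op.c (dt 1) (dt 1 f * g)) * V n +
          (Op.z (dt 1) (-1) * Op.z (dt 1) 1) * Op.c (dt 1) p * V n := by rw [e2]; noncomm_ring
      _ = _ := by rw [e5, one_mul]
  · change (sig X (n + 1) (j + 1)).1 i = (sig X n j).1 i + _ * (chi X n).1 i
    rw [sig_coeff, sig_coeff, chi_coeff, (h.db n).psi j hj]
    obtain hi | rfl | hi : i < -n ∨ i = -n ∨ -n < i := by omega
    · rw [if_pos (by omega), if_pos (by omega), if_pos (by omega),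
        (h.db n).pot _ j (by omega) hj,
        show (1 - (n + 1) - i).toNat + 1 = (1 - n - i).toNat by omega]
      ring
    · rw [if_neg (by omega), if_neg (by push_cast; omega), if_pos le_rfl, if_pos le_rfl,
        show (1 - n - -n).toNat = 1 by omega]
      linear_combination ((X n).S 1 j) * hu'
    · have e : i = ((j + 1 : ℕ) : ℤ) - (n + 1) ↔ i = j - n := by push_cast; omega
      rw [if_neg (by omega), if_neg (not_le.2 hi), if_neg (not_le.2 hi), mul_zero, add_zero]
      simp only [e]

/-! ### Stability of the span of the pairs -/

lemma potPair_mem (n : ℤ) {j : ℕ} (hj : 1 ≤ j) :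
    potPair X V n j ∈ Submodule.span R (Set.range (pair X V)) := by
  induction j, hj using Nat.le_induction generalizing n with
  | base =>
    rw [← sub_add_cancel n 1, h.potPair_one]
    exact Submodule.smul_mem _ _ (Submodule.subset_span ⟨_, rfl⟩)
  | succ j hj ih =>
    rw [← sub_add_cancel n 1, h.potPair_succ _ hj]
    exact Submodule.add_mem _ (ih _) (Submodule.smul_mem _ _ (Submodule.subset_span ⟨_, rfl⟩))

lemma pair_mem_of_eq (n : ℤ) {N : Submodule R (PairSpace (dt 1))}
    (hN : ∀ j, 1 ≤ j → potPair X V (n + 1) j ∈ N) : pair X V n ∈ N := by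
  have e : pair X V n = (X n).Φ 1 • potPair X V (n + 1) 1 := by
    rw [h.potPair_one, smul_smul, Ring.mul_inverse_cancel _ (h.unit n), one_smul]
  rw [e]
  exact N.smul_mem _ (hN 1 le_rfl)

/-- D only leads to higher sites. Going down, the two recursions for potential pairs are solved for
the pairs at the lower site, ending with combinations of potential pairs at site 0, where the flows
are known. -/
lemma pair_neg_mem (k : ℕ) : pair X V (-(k + 1)) ∈
    Submodule.span R {x | ∃ j, 1 ≤ j ∧ x = potPair X V 0 j} := by
  have key : ∀ k : ℕ, ∀ j, 1 ≤ j → potPair X V (-k) j ∈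
      Submodule.span R {x | ∃ j, 1 ≤ j ∧ x = potPair X V 0 j} := by
    intro k
    induction k with
    | zero => exact fun j hj => Submodule.subset_span ⟨j, hj, by simp⟩
    | succ k ih =>
      intro j hj
      have e1 : (-((k + 1 : ℕ) : ℤ)) + 1 = -k := by push_cast; ring
      have h2 := h.potPair_succ (-((k + 1 : ℕ) : ℤ)) hj
      rw [e1] at h2
      rw [← sub_eq_iff_eq_add] at h2
      rw [← h2]
      exact Submodule.sub_mem _ (ih _ (by omega)) (Submodule.smul_mem _ _
        (h.pair_mem_of_eq _ (by rw [e1]; exact ih)))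
  refine h.pair_mem_of_eq _ ?_
  rw [show (-((k : ℤ) + 1)) + 1 = -k by ring]
  exact key k

lemma pairD_mem {x : PairSpace (dt 1)} (hx : x ∈ Submodule.span R (Set.range (pair X V))) :
    pairD (dt 1) x ∈ Submodule.span R (Set.range (pair X V)) := by
  refine map_mem_of_span (pairD (dt 1)) pairD_smul Submodule.subset_span ?_ hx
  rintro _ ⟨n, rfl⟩
  rw [h.pairD_pair]
  exact Submodule.add_mem _ (Submodule.subset_span ⟨_, rfl⟩)
    (Submodule.smul_mem _ _ (Submodule.subset_span ⟨_, rfl⟩))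

lemma iterate_pairD_mem (i : ℕ) :
    (pairD (dt 1))^[i] (pair X V 0) ∈ Submodule.span R (Set.range (pair X V)) := by
  induction i with
  | zero => exact Submodule.subset_span ⟨0, rfl⟩
  | succ i ih =>
    rw [Function.iterate_succ_apply']
    exact h.pairD_mem ih

/-- A flow that commutes with `D` and maps the initial pairs into the span preserves the span. -/
lemma nabla_mem {e : Derivation ℤ R R} (he : ∀ f, e (dt 1 f) = dt 1 (e f)) {B : Op (dt 1)}
    {t : upSeries R →ₗ[R] upSeries R} (ht : ∀ y, t (coeffDeriv (dt 1) y) = coeffDeriv (dt 1) (t y))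
    (h0 : nabla e B t (pair X V 0) ∈ Submodule.span R (Set.range (pair X V)))
    (hq : ∀ j, 1 ≤ j → nabla e B t (potPair X V 0 j) ∈ Submodule.span R (Set.range (pair X V)))
    (n : ℤ) : nabla e B t (pair X V n) ∈ Submodule.span R (Set.range (pair X V)) := by
  obtain hn | hn := le_or_gt 0 n
  · obtain ⟨k, rfl⟩ := Int.eq_ofNat_of_zero_le hn
    clear hn
    induction k with
    | zero => exact h0
    | succ k ih =>
      -- The pair at k + 1 is expressed through D and the pair at k, and the flow passes through D.
      have e1 := h.pairD_pair k
      rw [← sub_eq_iff_eq_add] at e1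
      rw [Nat.cast_succ, ← e1, map_sub, nabla_pairD he B ht, nabla_smul]
      exact Submodule.sub_mem _ (h.pairD_mem ih) (Submodule.add_mem _
        (Submodule.smul_mem _ _ ih) (Submodule.smul_mem _ _ (Submodule.subset_span ⟨_, rfl⟩)))
  · obtain ⟨k, rfl⟩ : ∃ k : ℕ, n = -(k + 1) := ⟨(-n - 1).toNat, by omega⟩
    refine map_mem_of_span (nabla e B t) (nabla_smul e B t) ?_ ?_ (h.pair_neg_mem k)
    · rintro _ ⟨j, hj, rfl⟩
      exact h.potPair_mem 0 hj
    · rintro _ ⟨j, hj, rfl⟩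
      exact hq j hj

/-- The orbit of the initial pair under differential operators lies in the span. -/
lemma mem_of_isDiff {E : Op (dt 1)} (hE : E.IsDiff) {y : upSeries R}
    (hy : ∀ i, y.1 i = applyFun (dt 1) E.ser ((chi X 0).1 i)) :
    (E, y) ∈ Submodule.span R (Set.range (pair X V)) := by
  obtain ⟨N, hN⟩ := E.exists_ord
  have hK : Op.Ord E (((N + 1).toNat : ℤ) - 1) := hN.mono (by omega)
  have e1 : ∀ i, ((pairD (dt 1))^[i] (pair X V 0)) =
      (Op.z (dt 1) i, (coeffDeriv (dt 1))^[i] (chi X 0)) := by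
    intro i
    induction i with
    | zero => exact Prod.ext h.zero rfl
    | succ i ih =>
      rw [Function.iterate_succ_apply', Function.iterate_succ_apply', ih]
      refine Prod.ext ?_ rfl
      change Op.z (dt 1) 1 * Op.z (dt 1) i = _
      rw [Op.z_mul_z, add_comm, Nat.cast_succ]
  have e2 : ∀ (i : ℕ) (F : upSeries R) j,
      ((coeffDeriv (dt 1))^[i] F).1 j = (⇑(dt 1))^[i] (F.1 j) := by
    intro i F j
    induction i with
    | zero => rfl
    | succ i ih =>
      rw [Function.iterate_succ_apply', Function.iterate_succ_apply', coeffDeriv_coeff, ih]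
  have e3 : (E, y) = ∑ i ∈ Finset.range (N + 1).toNat,
      E.ser.1 i • (pairD (dt 1))^[i] (pair X V 0) := by
    refine Prod.ext ?_ ?_
    · rw [Prod.fst_sum]
      refine Op.ext (upSeries.ext fun j => ?_)
      rw [Op.sum_ser, sum_coeff]
      have e4 : ∀ i ∈ Finset.range (N + 1).toNat,
          (E.ser.1 (i : ℤ) • (pairD (dt 1))^[i] (pair X V 0)).1.ser.1 j =
          E.ser.1 i * if j = i then 1 else 0 := fun i _ => by rw [e1]; rfl
      rw [Finset.sum_congr rfl e4]
      by_cases hj : 0 ≤ j ∧ j ≤ N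
      · rw [Finset.sum_eq_single j.toNat]
        · rw [if_pos (by omega), mul_one, show (j.toNat : ℤ) = j by omega]
        · intro b _ hb
          rw [if_neg (by omega), mul_zero]
        · intro hb
          exact absurd (Finset.mem_range.2 (by omega)) hb
      · rw [Finset.sum_eq_zero]
        · by_cases hj' : j < 0
          · exact hE j hj'
          · exact hN j (by omega)
        · intro b hb
          rw [Finset.mem_range] at hb
          rw [if_neg (by omega), mul_zero]
    · rw [Prod.snd_sum]
      refine upSeries.ext fun j => ?_
      rw [sum_coeff, hy, Op.applyFun_eq_sum hK]
      refine Finset.sum_congr rfl fun i _ => ?_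
      rw [e1]
      change _ = _ * ((coeffDeriv (dt 1))^[i] (chi X 0)).1 j
      rw [e2]
  rw [e3]
  exact Submodule.sum_mem _ fun i _ => Submodule.smul_mem _ _ (h.iterate_pairD_mem i)

end GhostOrbit
end DoubleKP
end

/-! ### The flows of the pairs, computed at the initial site. -/

noncomputable section
namespace DoubleKP

variable {R : Type*} [CommRing R]

namespace GhostOrbit

variable {dt dtb : ℕ → Derivation ℤ R R} {X : ℤ → KPData R} {V : ℤ → Op (dt 1)}

variable (dt) in
/-- The Lax operator at a site. -/
def lax (X : ℤ → KPData R) (n : ℤ) : Op (dt 1) := ⟨(X n).L⟩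

variable (dt) in
/-- `M_s` at the initial site. -/
def ghostOp (X : ℤ → KPData R) (s : ℕ) : Op (dt 1) := ⟨(X 0).M (dt 1) s⟩

lemma ghostOp_eq (s : ℕ) : ghostOp dt X s = ∑ j ∈ Finset.Icc 1 s,
    (X 0).Φ (s + 1 - j) • (Op.z (dt 1) (-1) * Op.c (dt 1) ((X 0).Ψ j)) := by
  refine Op.ext ?_
  rw [Op.sum_ser, ghostOp, KPData.M]
  dsimp only
  refine Finset.sum_congr rfl fun j _ => ?_
  rw [← Op.c_mul, ← mul_assoc]
  rfl

lemma plus_lax_pow (n : ℤ) (r : ℕ) :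
    ((lax dt X n) ^ r).plus.ser = plusPart (pow (dt 1) (X n).L r) := by
  rw [Op.plus, Op.pow_ser]
  rfl

variable (h : GhostOrbit dt dtb X V)
include h

lemma ord_lax_zero : Op.Ord (lax dt X 0 - Op.z (dt 1) 1) (-1) := fun j hj => by
  obtain ⟨h1, h0, h2⟩ := h.kp.lead
  change (X 0).L.1 j - (DoubleKP.mono 1 1).1 j = 0
  rw [mono_coeff]
  obtain rfl | rfl | hj' : j = 0 ∨ j = 1 ∨ 1 < j := by omega
  · rw [h0, if_neg (by omega), sub_zero]
  · rw [h1, if_pos rfl, sub_self]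
  · rw [h2 j hj', if_neg (by omega), sub_zero]

lemma eigen {r k : ℕ} (hr : 1 ≤ r) (hk : 1 ≤ k) :
    dt r ((X 0).Φ k) = applyFun (dt 1) ((lax dt X 0) ^ r).plus.ser ((X 0).Φ k) := by
  rw [h.kp.eigen r k hr hk, plus_lax_pow]

lemma pot {r k j : ℕ} (hr : 1 ≤ r) (hk : 1 ≤ k) (hj : 1 ≤ j) : dt r ((X 0).S k j) =
    (Op.z (dt 1) (-1) * Op.c (dt 1) ((X 0).Ψ j) * (((lax dt X 0) ^ r).plus *
      (Op.c (dt 1) ((X 0).Φ k) * Op.z (dt 1) (-1)))).ser.1 (-1) := by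
  rw [h.kp.pot r k j hr hk hj, ← plus_lax_pow]
  rfl

lemma deriv_pot {k j : ℕ} (hk : 1 ≤ k) (hj : 1 ≤ j) :
    dt 1 ((X 0).S k j) = (X 0).Φ k * (X 0).Ψ j := by
  rw [h.pot le_rfl hk hj, Op.plus_pow_one h.ord_lax_zero, Op.coeff_pot_z]

/-- Differentiating the flow of S_{1j} in x gives the flow of Φ_1Ψ_j. Subtracting that of Φ_1 and
cancelling the unit Φ_1 leaves the flow of Ψ_j in the form of a residue. -/
lemma adjEigen {r j : ℕ} (hr : 1 ≤ r) (hj : 1 ≤ j) :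
    dt r ((X 0).Ψ j) = -Op.adjRes ((lax dt X 0) ^ r).plus ((X 0).Ψ j) := by
  have e1 := congrArg (dt 1) (h.pot hr le_rfl hj)
  rw [← h.comm r hr, h.deriv_pot le_rfl hj, Op.deriv_coeff_pot (Op.isDiff_plus _),
    ← h.eigen hr le_rfl, Derivation.leibniz, smul_eq_mul, smul_eq_mul] at e1
  refine (h.unit 0).mul_left_cancel ?_
  linear_combination e1

/-! ### The isospectral flows -/

/-- At site 0 the flow turns the pair into a differential operator acting on (1, χ_0), for the pair
itself and for each potential pair. Such elements lie in the D-stable span. -/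
lemma flow_pair_mem {r : ℕ} (hr : 1 ≤ r) (n : ℤ) :
    nabla (dt r) ((lax dt X 0) ^ r).plus 0 (pair X V n) ∈
      Submodule.span R (Set.range (pair X V)) := by
  refine h.nabla_mem (h.comm r hr)
    (fun _ => upSeries.ext fun _ => (map_zero (dt 1)).symm) ?_ (fun j hj => ?_) n
  · have e : nabla (dt r) ((lax dt X 0) ^ r).plus 0 (pair X V 0) =
        (((lax dt X 0) ^ r).plus, coeffDeriv (dt r) (chi X 0)) := by
      refine Prod.ext ?_ ?_
      · change (V 0).deriv (dt r) + V 0 * _ = _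
        rw [h.zero, ← Op.z_zero, Op.deriv_z, zero_add, Op.z_zero, one_mul]
      · change coeffDeriv (dt r) (chi X 0) + 0 = _
        rw [add_zero]
    rw [e]
    refine h.mem_of_isDiff (Op.isDiff_plus _) fun i => ?_
    rw [coeffDeriv_coeff, chi_coeff]
    split_ifs with hi
    · exact h.eigen hr (by omega)
    · rw [Op.applyFun_zero, map_zero]
  -- The derivative of Ψ_j cancels exactly the negative part of A = D⁻¹Ψ_j(L^r)_+, and A_+ also
  -- gives the evolution of the potentials in `sig`.
  · set A := Op.z (dt 1) (-1) * Op.c (dt 1) ((X 0).Ψ j) * ((lax dt X 0) ^ r).plus with hA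
    have e : nabla (dt r) ((lax dt X 0) ^ r).plus 0 (potPair X V 0 j) =
        (A.plus, coeffDeriv (dt r) (sig X 0 j)) := by
      refine Prod.ext ?_ ?_
      · change (Op.z (dt 1) (-1) * Op.c (dt 1) ((X 0).Ψ j) * V 0).deriv (dt r) +
          Op.z (dt 1) (-1) * Op.c (dt 1) ((X 0).Ψ j) * V 0 * _ = _
        have e1 : A = A.plus + _ := Op.eq_plus_add _ (Op.isDiff_plus _) ((X 0).Ψ j)
        rw [h.zero, mul_one, ← hA, Op.deriv_mul (h.comm r hr), Op.deriv_z, zero_mul, zero_add,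
          Op.deriv_c, h.adjEigen hr hj]
        nth_rw 1 [e1]
        rw [Op.c_eq, Op.c_eq, neg_smul, mul_neg]
        abel
      · change coeffDeriv (dt r) (sig X 0 j) + 0 = _
        rw [add_zero]
    rw [e]
    refine h.mem_of_isDiff (Op.isDiff_plus _) fun i => ?_
    rw [coeffDeriv_coeff, chi_coeff, sig_coeff]
    split_ifs with hi hi'
    · rw [h.pot hr (by omega) hj, Op.coeff_pot (Op.isDiff_plus _)]
    · rw [Op.applyFun_zero, Derivation.map_one_eq_zero]
    · rw [Op.applyFun_zero, map_zero]

/-! ### The ghost flows -/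

/-- In degrees ≤ 0 the shift z^s cancels the term -Φ_{k+s} of the ghost flow. The positive powers of
z^s χ_0 are matched by the monomials z^j in `sig`, which are there for this purpose. -/
lemma ghost_pair_zero (s : ℕ) (hs : 1 ≤ s) :
    nabla (dtb s) (ghostOp dt X s) (lamLin s) (pair X V 0) =
      ∑ j ∈ Finset.Icc 1 s, (X 0).Φ (s + 1 - j) • potPair X V 0 j := by
  refine Prod.ext ?_ (upSeries.ext fun i => ?_)
  · change (V 0).deriv (dtb s) + V 0 * _ = _
    rw [h.zero, ← Op.z_zero, Op.deriv_z, zero_add, Op.z_zero, one_mul, ghostOp_eq, Prod.fst_sum]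
    refine Finset.sum_congr rfl fun j _ => ?_
    change _ = (X 0).Φ (s + 1 - j) • (_ * V 0)
    rw [h.zero, mul_one]
  · change dtb s ((chi X 0).1 i) + (chi X 0).1 (i - s) = _
    rw [Prod.snd_sum, sum_coeff]
    change _ = ∑ j ∈ Finset.Icc 1 s, (X 0).Φ (s + 1 - j) * (sig X 0 j).1 i
    simp only [chi_coeff, sig_coeff]
    by_cases hi : i ≤ 0
    · simp only [neg_zero, if_pos hi, if_pos (show i - s ≤ 0 by omega), sub_zero]
      rw [h.kp.ghostEigen s _ hs (by omega), show (1 - (i - (s : ℤ))).toNat = (1 - i).toNat + s by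
        omega, sub_add_cancel]
    · simp only [neg_zero, if_neg hi, sub_zero, map_zero, zero_add]
      by_cases his : i - s ≤ 0
      · rw [if_pos his, Finset.sum_eq_single i.toNat]
        · rw [if_pos (by omega), mul_one]
          congr 1
          omega
        · intro b _ hb
          rw [if_neg (by omega), mul_zero]
        · intro hb
          exact absurd (Finset.mem_Icc.2 (by omega)) hb
      · rw [if_neg his, Finset.sum_eq_zero]
        intro b hb
        rw [Finset.mem_Icc] at hb
        rw [if_neg (by omega), mul_zero]

/-- Since Φ_kΨ_j = [D, S_{kj}], one has D⁻¹Ψ_jΦ_k D⁻¹Ψ_i = S_{kj} D⁻¹Ψ_i - D⁻¹ S_{kj}Ψ_i. The last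
terms cancel against the quadratic part of the ghost flow of Ψ_j. -/
lemma ghost_potPair_zero (s : ℕ) (hs : 1 ≤ s) {j : ℕ} (hj : 1 ≤ j) :
    nabla (dtb s) (ghostOp dt X s) (lamLin s) (potPair X V 0 j) =
      ∑ i ∈ Finset.Icc 1 s, (X 0).S (s + 1 - i) j • potPair X V 0 i + potPair X V 0 (j + s) := by
  refine Prod.ext ?_ (upSeries.ext fun i => ?_)
  · rw [Prod.fst_add, Prod.fst_sum]
    change (Op.z (dt 1) (-1) * Op.c (dt 1) ((X 0).Ψ j) * V 0).deriv (dtb s) +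
      Op.z (dt 1) (-1) * Op.c (dt 1) ((X 0).Ψ j) * V 0 * ghostOp dt X s =
      ∑ i ∈ Finset.Icc 1 s, (X 0).S (s + 1 - i) j •
        (Op.z (dt 1) (-1) * Op.c (dt 1) ((X 0).Ψ i) * V 0) +
        Op.z (dt 1) (-1) * Op.c (dt 1) ((X 0).Ψ (j + s)) * V 0
    have e1 : ∀ i ∈ Finset.Icc 1 s, Op.z (dt 1) (-1) * Op.c (dt 1) ((X 0).Ψ j) *
        (X 0).Φ (s + 1 - i) • (Op.z (dt 1) (-1) * Op.c (dt 1) ((X 0).Ψ i)) =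
        (X 0).S (s + 1 - i) j • (Op.z (dt 1) (-1) * Op.c (dt 1) ((X 0).Ψ i)) -
        Op.z (dt 1) (-1) * Op.c (dt 1) ((X 0).Ψ i * (X 0).S (s + 1 - i) j) := by
      intro i hi
      rw [Finset.mem_Icc] at hi
      set S := (X 0).S (s + 1 - i) j with hS
      have e2 : Op.c (dt 1) ((X 0).Φ (s + 1 - i) * (X 0).Ψ j) =
          Op.z (dt 1) 1 * Op.c (dt 1) S - Op.c (dt 1) S * Op.z (dt 1) 1 := by
        rw [Op.z_one_mul_sub, Op.deriv_c, hS, h.deriv_pot (by omega) hj]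
      have e3 : Op.z (dt 1) (-1) * Op.z (dt 1) 1 = 1 := by
        rw [Op.z_mul_z, neg_add_cancel, Op.z_zero]
      have e4 : Op.z (dt 1) 1 * Op.z (dt 1) (-1) = 1 := by
        rw [Op.z_mul_z, add_neg_cancel, Op.z_zero]
      rw [← Op.c_mul, ← Op.c_mul, mul_comm ((X 0).Ψ i), ← Op.c_mul_c]
      calc _ = Op.z (dt 1) (-1) * (Op.c (dt 1) ((X 0).Ψ j) * Op.c (dt 1) ((X 0).Φ (s + 1 - i))) *
            Op.z (dt 1) (-1) * Op.c (dt 1) ((X 0).Ψ i) := by simp only [mul_assoc]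
        _ = Op.z (dt 1) (-1) * (Op.z (dt 1) 1 * Op.c (dt 1) S - Op.c (dt 1) S * Op.z (dt 1) 1) *
            Op.z (dt 1) (-1) * Op.c (dt 1) ((X 0).Ψ i) := by
          rw [Op.c_mul_c, mul_comm ((X 0).Ψ j), e2]
        _ = (Op.z (dt 1) (-1) * Op.z (dt 1) 1) * Op.c (dt 1) S * Op.z (dt 1) (-1) *
              Op.c (dt 1) ((X 0).Ψ i) -
            Op.z (dt 1) (-1) * Op.c (dt 1) S * (Op.z (dt 1) 1 * Op.z (dt 1) (-1)) *
              Op.c (dt 1) ((X 0).Ψ i) := by noncomm_ring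
        _ = _ := by rw [e3, e4]; noncomm_ring
    have e5 : Op.c (dt 1) (∑ i ∈ Finset.Icc 1 s, (X 0).Ψ i * (X 0).S (s + 1 - i) j) =
        ∑ i ∈ Finset.Icc 1 s, Op.c (dt 1) ((X 0).Ψ i * (X 0).S (s + 1 - i) j) := by
      simp only [Op.c_eq, Finset.sum_smul]
    simp only [h.zero, mul_one]
    rw [Op.deriv_mul (h.comm_ghost s hs), Op.deriv_z, zero_mul, zero_add, Op.deriv_c,
      h.kp.ghostAdj s j hs hj, ghostOp_eq, Finset.mul_sum, Finset.sum_congr rfl e1,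
      Finset.sum_sub_distrib, Op.c_eq, add_smul, ← Op.c_eq, ← Op.c_eq, mul_add, e5,
      Finset.mul_sum]
    abel
  · change dtb s ((sig X 0 j).1 i) + (sig X 0 j).1 (i - s) = _
    rw [Prod.snd_add, add_coeff, Prod.snd_sum, sum_coeff]
    change _ = ∑ l ∈ Finset.Icc 1 s, (X 0).S (s + 1 - l) j * (sig X 0 l).1 i +
      (sig X 0 (j + s)).1 i
    simp only [sig_coeff]
    by_cases hi : i ≤ 0
    · simp only [neg_zero, if_pos hi, if_pos (show i - s ≤ 0 by omega), sub_zero]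
      rw [h.kp.ghostPot s _ j hs (by omega) hj, show (1 - (i - (s : ℤ))).toNat = (1 - i).toNat + s by
        omega]
      ring
    · have e1 : dtb s (if i = (j : ℤ) then (1 : R) else 0) = 0 := by split_ifs <;> simp
      have e2 : i - s = (j : ℤ) ↔ i = ((j + s : ℕ) : ℤ) := by push_cast; omega
      simp only [neg_zero, if_neg hi, sub_zero, e1, zero_add, e2]
      by_cases his : i - s ≤ 0
      · rw [if_pos his, Finset.sum_eq_single i.toNat]
        · rw [if_pos (by omega), mul_one, if_neg (by push_cast; omega), add_zero]
          congr 1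
          omega
        · intro b _ hb
          rw [if_neg (by omega), mul_zero]
        · intro hb
          exact absurd (Finset.mem_Icc.2 (by omega)) hb
      · rw [if_neg his, Finset.sum_eq_zero, zero_add]
        intro b hb
        rw [Finset.mem_Icc] at hb
        rw [if_neg (by omega), mul_zero]

lemma ghost_pair_mem {s : ℕ} (hs : 1 ≤ s) (n : ℤ) :
    nabla (dtb s) (ghostOp dt X s) (lamLin s) (pair X V n) ∈
      Submodule.span R (Set.range (pair X V)) := by
  refine h.nabla_mem (h.comm_ghost s hs) (fun _ => rfl) ?_ (fun j hj => ?_) n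
  · rw [h.ghost_pair_zero s hs]
    refine Submodule.sum_mem _ fun j hj => Submodule.smul_mem _ _ (h.potPair_mem 0 ?_)
    exact (Finset.mem_Icc.1 hj).1
  · rw [h.ghost_potPair_zero s hs hj]
    refine Submodule.add_mem _ (Submodule.sum_mem _ fun i hi => Submodule.smul_mem _ _
      (h.potPair_mem 0 (Finset.mem_Icc.1 hi).1)) (h.potPair_mem 0 (by omega))

end GhostOrbit
end DoubleKP
end

/-! ### Determination of the flow coefficients by comparison of orders. -/

noncomputable section
namespace DoubleKP

variable {R : Type*} [CommRing R]

lemma isSum_finsupp (F : ℤ → upSeries R) (c : ℤ →₀ R) :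
    IsSum (fun m => c m • F m) (c.sum fun m a => a • F m) :=
  isSum_finset c.support (fun m => c m • F m) fun i hi => by
    rw [Finsupp.notMem_support_iff.1 hi, zero_smul]

/-- Q̄ is bounded below the diagonal. Reflecting the sites makes it bounded above, so it fits into
the same matrix ring as Q. -/
lemma matMul_neg_apply (A B : Matrix ℤ ℤ R) (n m : ℤ) :
    matMul (fun n m => A (-n) (-m)) (fun n m => B (-n) (-m)) n m = matMul A B (-n) (-m) :=
  finsum_comp_equiv (Equiv.neg ℤ) (f := fun l => A (-n) l * B l (-m))

lemma matPow_neg_apply (A : Matrix ℤ ℤ R) (r : ℕ) (n m : ℤ) :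
    matPow (fun n m => A (-n) (-m)) r n m = matPow A r (-n) (-m) := by
  induction r generalizing n m with
  | zero =>
    change (1 : Matrix ℤ ℤ R) n m = (1 : Matrix ℤ ℤ R) (-n) (-m)
    simp only [Matrix.one_apply, neg_inj]
  | succ r ih =>
    change matMul _ (matPow (fun n m => A (-n) (-m)) r) n m = matMul A (matPow A r) (-n) (-m)
    rw [show matPow (fun n m => A (-n) (-m)) r = fun n m => matPow A r (-n) (-m) from
      funext fun n => funext fun m => ih n m, matMul_neg_apply]

lemma UBMat.exists_bound (A : UBMat R) (n : ℤ) : ∃ N, ∀ m, N < m → A.1 n m = 0 := by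
  obtain ⟨r, hr⟩ := A.ub
  exact ⟨n + r, fun m hm => hr n m hm⟩

lemma Finsupp.exists_bound (c : ℤ →₀ R) :
    ∃ N : ℤ, (∀ m, N < m → c m = 0) ∧ ∀ m, N < m → c (-m) = 0 := by
  obtain ⟨N, hN⟩ : ∃ N : ℕ, ∀ m ∈ c.support, m.natAbs ≤ N :=
    ⟨c.support.sup Int.natAbs, fun m hm => Finset.le_sup (f := Int.natAbs) hm⟩
  refine ⟨N, fun m hm => ?_, fun m hm => ?_⟩ <;>
  · by_contra h
    have := hN _ (Finsupp.mem_support_iff.2 h)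
    omega

namespace GhostOrbit

variable {dt dtb : ℕ → Derivation ℤ R R} {X : ℤ → KPData R} {V : ℤ → Op (dt 1)}

/-- The coefficients are common to both components; all later comparisons use one component for one
half of the indices and the other for the rest. -/
lemma exists_comb {x : PairSpace (dt 1)} (hx : x ∈ Submodule.span R (Set.range (pair X V))) :
    ∃ c : ℤ →₀ R, x.1 = c.sum (fun m a => a • V m) ∧ IsSum (fun m => c m • (V m).ser) x.1.ser ∧
      IsSum (fun m => c m • chi X m) x.2 := by
  obtain ⟨c, rfl⟩ := Finsupp.mem_span_range_iff_exists_finsupp.1 hx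
  have h1 : (c.sum fun m a => a • pair X V m).1 = c.sum fun m a => a • V m := by
    rw [Finsupp.sum, Prod.fst_sum]
    rfl
  have h2 : (c.sum fun m a => a • pair X V m).2 = c.sum fun m a => a • chi X m := by
    rw [Finsupp.sum, Prod.snd_sum]
    rfl
  have h3 : (c.sum fun m a => a • V m).ser = c.sum fun m a => a • (V m).ser := by
    rw [Finsupp.sum, Op.sum_ser]
    rfl
  refine ⟨c, h1, ?_, ?_⟩
  · rw [h1, h3]
    exact isSum_finsupp _ c
  · rw [h2]
    exact isSum_finsupp _ c

lemma ordLE_chi_neg (X : ℤ → KPData R) (n : ℤ) : OrdLE (chi X (-n)) n := by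
  have h := ordLE_chi X (-n)
  rwa [neg_neg] at h

lemma chi_neg_lead (X : ℤ → KPData R) (n : ℤ) : (chi X (-n)).1 n = (X (-n)).Φ 1 := by
  have h := chi_lead X (-n)
  rwa [neg_neg] at h

/-- Reflected sums over the series `χ_m`. -/
lemma finsum_chi_neg {c : ℤ → R} {y : upSeries R} (hc : IsSum (fun m => c m • chi X m) y) (j : ℤ) :
    ∑ᶠ m, c (-m) * (chi X (-m)).1 j = y.1 j := by
  rw [← hc.2 j]
  exact finsum_comp_equiv (Equiv.neg ℤ) (f := fun m => c m * (chi X m).1 j)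

/-- The coefficients of the series `χ_{-n}`, as a matrix. -/
def chiMat (X : ℤ → KPData R) : UBMat R := rows (fun n => chi X (-n)) (ordLE_chi_neg X)

variable (h : GhostOrbit dt dtb X V)
include h

lemma ordLE (n : ℤ) : OrdLE (V n).ser n := (h.monic n).1

lemma unit_lead (n : ℤ) : IsUnit ((V n).ser.1 n) := by
  rw [(h.monic n).2]
  exact isUnit_one

lemma unit_chi_lead (n : ℤ) : IsUnit ((chi X (-n)).1 n) := by
  rw [chi_neg_lead]
  exact h.unit _

/-- The orders of the χ_m decrease with m, so the low sites are those that would produce high powers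
of z. -/
lemma comb_lower_eq_zero {c : ℤ →₀ R} {y : upSeries R} {n : ℤ}
    (hc : IsSum (fun m => c m • chi X m) y) (hy : OrdLE y (-n)) : ∀ m < n, c m = 0 := by
  obtain ⟨N, -, hN⟩ := Finsupp.exists_bound c
  have h1 := eq_zero_of_triangular (ordLE_chi_neg X) h.unit_chi_lead (x := fun m => c (-m)) hN
    (n := -n + 1) fun j hj => by rw [finsum_chi_neg hc, hy j (by omega)]
  intro m hm
  have h2 := h1 (-m) (by omega)
  rwa [neg_neg] at h2

lemma comb_upper_eq_zero {c : ℤ →₀ R} {y : Op (dt 1)} {n : ℤ}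
    (hc : IsSum (fun m => c m • (V m).ser) y.ser) (hy : Op.Ord y (n - 1)) :
    ∀ m, n ≤ m → c m = 0 := by
  obtain ⟨N, hN, -⟩ := Finsupp.exists_bound c
  exact eq_zero_of_triangular (fun n => (h.monic n).1) h.unit_lead (x := c) hN
    fun j hj => (hc.2 j).trans (hy j (by omega))

/-- `lax n` is conjugate to the initial Lax operator. -/
lemma lax_mul (n : ℤ) : lax dt X n * V n = V n * lax dt X 0 := by
  have key : ∀ n, lax dt X (n + 1) * Op.darboux (dt 1) ((X n).Φ 1) =
      Op.darboux (dt 1) ((X n).Φ 1) * lax dt X n := fun n => Op.ext (h.db n).lax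
  induction n with
  | zero => rw [h.zero, one_mul, mul_one]
  | succ n ih => rw [h.orbit, ← mul_assoc, key, mul_assoc, ih, mul_assoc]
  | pred n ih =>
    have h1 := h.orbit (-(n : ℤ) - 1)
    have h2 := key (-(n : ℤ) - 1)
    rw [sub_add_cancel] at h1 h2
    obtain ⟨A, -, hA, -⟩ := (Op.monic_darboux (d := dt 1) (h.unit (-(n : ℤ) - 1))).exists_inverse
    rw [h1, ← mul_assoc, h2] at ih
    have h3 := congrArg (A * ·) ih
    simp only [← mul_assoc] at h3
    rw [hA, one_mul, one_mul] at h3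
    exact h3

/-- Conjugation gives L(n) - D = (V_n (L(0) - D) - ∂V_n) V_n⁻¹. Both terms in the bracket have order
at most n - 1, the second because V_n is monic. -/
lemma ord_lax (n : ℤ) : Op.Ord (lax dt X n - Op.z (dt 1) 1) (-1) := by
  obtain ⟨A, hA, -, hVA⟩ := (h.monic n).exists_inverse
  have e : lax dt X n - Op.z (dt 1) 1 =
      (V n * (lax dt X 0 - Op.z (dt 1) 1) - (V n).deriv (dt 1)) * A := by
    have e1 : V n * (lax dt X 0 - Op.z (dt 1) 1) - (V n).deriv (dt 1) =
        (lax dt X n - Op.z (dt 1) 1) * V n := by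
      rw [← Op.z_one_mul_sub, sub_mul, h.lax_mul]
      noncomm_ring
    rw [e1, mul_assoc, hVA, mul_one]
  rw [e]
  have h1 : Op.Ord (V n * (lax dt X 0 - Op.z (dt 1) 1) - (V n).deriv (dt 1)) (n + -1) :=
    ((h.monic n).1.mul h.ord_lax_zero).sub ((h.monic n).ord_deriv _)
  exact (h1.mul hA.1).mono (by omega)

/-- The coefficients of the orbit `V_n`, as a matrix. -/
def orbitRows : UBMat R := rows (fun n => (V n).ser) h.ordLE

/-- Ghost flows act on the orbit by strictly lower triangular matrices. -/
lemma exists_ghost_comb {s : ℕ} (hs : 1 ≤ s) (n : ℤ) : ∃ c : ℤ →₀ R, (∀ m, n ≤ m → c m = 0) ∧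
    (V n).deriv (dtb s) + V n * ghostOp dt X s = c.sum (fun m a => a • V m) ∧
    IsSum (fun m => c m • (V m).ser) ((V n).deriv (dtb s) + V n * ghostOp dt X s).ser ∧
    IsSum (fun m => c m • chi X m) (coeffDeriv (dtb s) (chi X n) + lam s (chi X n)) := by
  obtain ⟨c, h0, h1, h2⟩ := exists_comb (h.ghost_pair_mem hs n)
  refine ⟨c, h.comb_upper_eq_zero h1 ?_, h0, h1, h2⟩
  have h3 : Op.Ord (ghostOp dt X s) (-1) := by
    rw [ghostOp_eq]
    intro j hj
    rw [Op.sum_ser, sum_coeff]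
    refine Finset.sum_eq_zero fun i _ => ?_
    exact (((Op.ord_z (-1)).mul (Op.ord_c _)).smul _) j hj
  exact ((h.monic n).ord_deriv _).add ((h.monic n).1.mul h3)

/-- The first ghost flow shifts the site. -/
lemma exists_ghost_comb_one (n : ℤ) : ∃ a : R, (X n).Φ 1 = a * (X (n - 1)).Φ 1 ∧
    (V n).deriv (dtb 1) + V n * ghostOp dt X 1 = a • V (n - 1) ∧
    coeffDeriv (dtb 1) (chi X n) + lam 1 (chi X n) = a • chi X (n - 1) := by
  obtain ⟨c, h1, h0, -, h2⟩ := h.exists_ghost_comb le_rfl n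
  -- The ghost flow admits only m < n. For s = 1 the series has order at most -n + 1, which excludes
  -- m < n - 1 and leaves a single site.
  have hord : OrdLE (coeffDeriv (dtb 1) (chi X n) + lam 1 (chi X n)) (-(n - 1)) := by
    intro j hj
    rw [add_coeff, coeffDeriv_coeff, lam_coeff, ordLE_chi X n j (by omega),
      ordLE_chi X n _ (by push_cast; omega), map_zero, add_zero]
  have h3 := h.comb_lower_eq_zero h2 hord
  have hc : c = Finsupp.single (n - 1) (c (n - 1)) := by
    ext m
    obtain hm | rfl | hm : m < n - 1 ∨ m = n - 1 ∨ n ≤ m := by omega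
    · rw [h3 m hm, Finsupp.single_eq_of_ne (by omega)]
    · rw [Finsupp.single_eq_same]
    · rw [h1 m hm, Finsupp.single_eq_of_ne (by omega)]
  have h4 : coeffDeriv (dtb 1) (chi X n) + lam 1 (chi X n) = c (n - 1) • chi X (n - 1) := by
    refine h2.unique ?_
    have h5 := isSum_finsupp (chi X) c
    exact h5.congr (fun _ => rfl)
      ((congrArg (fun c : ℤ →₀ R => c.sum fun m a => a • chi X m) hc).trans
        (Finsupp.sum_single_index (zero_smul R _)))
  refine ⟨c (n - 1), ?_, ?_, h4⟩
  · have h6 : (coeffDeriv (dtb 1) (chi X n) + lam 1 (chi X n)).1 (-(n - 1)) =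
        (c (n - 1) • chi X (n - 1)).1 (-(n - 1)) := by rw [h4]
    rwa [smul_coeff, chi_lead, add_coeff, coeffDeriv_coeff, lam_coeff, ordLE_chi X n _ (by omega),
      map_zero, zero_add, show -(n - 1) - ((1 : ℕ) : ℤ) = -n by push_cast; ring, chi_lead] at h6
  · exact h0.trans ((congrArg (fun c : ℤ →₀ R => c.sum fun m a => a • V m) hc).trans
      (Finsupp.sum_single_index (zero_smul R _)))

/-- As an operator in D̄ the left-hand side is D̄χ_n, so this is the Darboux recursion on the ghost
side, obtained from the first ghost flow. -/
lemma coeffDeriv_chi (n : ℤ) : coeffDeriv (dtb 1) (chi X n) + lam 1 (chi X n) =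
    ((X n).Φ 1 * Ring.inverse ((X (n - 1)).Φ 1)) • chi X (n - 1) := by
  obtain ⟨a, h1, -, h2⟩ := h.exists_ghost_comb_one n
  rw [h2, h1, mul_assoc, Ring.mul_inverse_cancel _ (h.unit _), mul_one]

/-! ### The matrix `Q` -/

variable {a : ℤ → ℕ → R}
  (ha : ∀ n, Op.IsWordExpansion (fun n => (X n).Φ 1) n (lax dt X n) (a n))
include ha

variable (dt X a) in
omit h ha in
/-- The matrix `Q` in the ring of matrices bounded above. -/
def Q : UBMat R := Op.orbitMat (dt 1) (fun n => (X n).Φ 1) a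

lemma Q_mul : Q dt X a * h.orbitRows = h.orbitRows * rep (dt 1) (lax dt X 0).ser := by
  ext n j
  refine Eq.trans ?_ (rows_mul_rep (dt 1) h.ordLE (lax dt X 0) n j).symm
  change _ = (V n * lax dt X 0).ser.1 j
  rw [← h.lax_mul, ← (Op.isSum_orbitMatrix h.unit h.orbit (ha n)).2 j]
  rfl

lemma Q_pow_mul (r : ℕ) (n j : ℤ) : ∑ᶠ m, (Q dt X a ^ r).1 n m * (V m).ser.1 j =
    (V n * lax dt X 0 ^ r).ser.1 j := by
  have h1 := pow_mul_eq (h.Q_mul ha) r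
  rw [← rep_pow] at h1
  exact (congrArg (fun A : UBMat R => A.1 n j) h1).trans
    (rows_mul_rep (dt 1) h.ordLE (lax dt X 0 ^ r) n j)

/-- The isospectral flows act on the orbit by `(Q^r)₊`. -/
lemma exists_flow_comb {r : ℕ} (hr : 1 ≤ r) (n : ℤ) : ∃ c : ℤ →₀ R,
    (∀ m, c m = matUpper (matPow (matQ (dt 1) X a) r) n m) ∧
    (V n).deriv (dt r) + V n * ((lax dt X 0) ^ r).plus = c.sum (fun m a => a • V m) ∧
    IsSum (fun m => c m • (V m).ser) ((V n).deriv (dt r) + V n * ((lax dt X 0) ^ r).plus).ser ∧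
    IsSum (fun m => c m • chi X m) (coeffDeriv (dt r) (chi X n)) := by
  obtain ⟨c, h0, h1, h2⟩ := exists_comb (h.flow_pair_mem hr n)
  have h2' : IsSum (fun m => c m • chi X m) (coeffDeriv (dt r) (chi X n)) :=
    h2.congr (fun _ => rfl) (add_zero _)
  refine ⟨c, fun m => ?_, h0, h1, h2'⟩
  rw [matUpper]
  split_ifs with hnm
  · have e : (Q dt X a ^ r).1 n m = matPow (matQ (dt 1) X a) r n m := by
      rw [UBMat.pow_val]
      rfl
    rw [← e]
    obtain ⟨N, hN, -⟩ := Finsupp.exists_bound c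
    obtain ⟨N', hN'⟩ := (Q dt X a ^ r).exists_bound n
    -- Above the diagonal only degrees ≥ n matter. There ∂_{t_r}V_n vanishes and (L^r)_+ may be
    -- replaced by L^r, because the differences have order at most n - 1.
    refine eq_of_triangular (fun n => (h.monic n).1) h.unit_lead (x := c)
      (y := fun m => (Q dt X a ^ r).1 n m) (N := max N N') (n := n) (fun m hm => hN m (by omega))
      (fun m hm => hN' m (by omega)) (fun j hj => ?_) m hnm
    rw [h.Q_pow_mul ha]
    refine (h1.2 j).trans ?_
    change ((V n).deriv (dt r) + V n * ((lax dt X 0) ^ r).plus).ser.1 j = _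
    refine sub_eq_zero.1 ?_
    rw [← sub_coeff, ← Op.sub_ser, add_sub_assoc, ← mul_sub]
    have h3 := (h.monic n).ord_deriv (dt r)
    have h4 : Op.Ord ((lax dt X 0 ^ r).plus - lax dt X 0 ^ r) (-1) := by
      simpa using (Op.ord_sub_plus (lax dt X 0 ^ r)).neg
    exact (h3.add ((h.monic n).1.mul h4)) j (by omega)
  -- Below the diagonal the second component decides: the derivative of χ_n still has order at most
  -- -n.
  · exact h.comb_lower_eq_zero h2' (ordLE_coeffDeriv (ordLE_chi X n) _) m (by omega)

end GhostOrbit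
end DoubleKP
end

/-! ### The ghost Lax operators and the matrix Q̄. -/

noncomputable section
namespace DoubleKP

variable {R : Type*} [CommRing R]

lemma word_eq (d : Derivation ℤ R R) (X : ℤ → KPData R) (n : ℤ) (k : ℕ) :
    word d X n k = (Op.wordOp d (fun n => (X n).Φ 1) n k).ser := by
  induction k with
  | zero => rfl
  | succ k ih => rw [word, ih]; rfl

/-- The reflected sequence `Φ̄₁^{(-n)}`. -/
def phiBar (X : ℤ → KPData R) (n : ℤ) : R := Ring.inverse ((X (-n)).Φ 1)

lemma wordBar_eq (d : Derivation ℤ R R) (X : ℤ → KPData R) (n : ℤ) (k : ℕ) :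
    wordBar d X n k = (Op.wordOp d (phiBar X) (-n) k).ser := by
  induction k with
  | zero => rfl
  | succ k ih =>
    rw [wordBar, ih, Op.wordOp, phiBar, show -(-n - ((k : ℤ) + 1)) = n + (k + 1) by ring]
    rfl

lemma isExpansion_iff (dt : ℕ → Derivation ℤ R R) (X : ℤ → KPData R) (a : ℤ → ℕ → R) :
    IsExpansion (dt 1) X a ↔
      ∀ n, Op.IsWordExpansion (fun n => (X n).Φ 1) n (GhostOrbit.lax dt X n) (a n) := by
  refine forall_congr' fun n => ?_
  simp only [word_eq]
  rfl

lemma isExpansionBar_iff (d : Derivation ℤ R R) (X : ℤ → KPData R) (Lb : ℤ → PDO R)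
    (b : ℤ → ℕ → R) : IsExpansionBar d X Lb b ↔
      ∀ n, Op.IsWordExpansion (phiBar X) (-n) (⟨Lb n⟩ : Op d) (b n) := by
  refine forall_congr' fun n => ?_
  simp only [wordBar_eq]
  rfl

/-- After the reflection n ↦ -n the ghost side is an ordinary Darboux orbit for 1/Φ_1. Conjugating
its matrix by the diagonal of the Φ_1 gives Q̄. -/
lemma matQbar_neg {d : Derivation ℤ R R} {X : ℤ → KPData R} (hu : ∀ n, IsUnit ((X n).Φ 1))
    (b : ℤ → ℕ → R) (n m : ℤ) : matQbar d X b (-n) (-m) = (X (-n)).Φ 1 *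
      Op.orbitMatrix d (phiBar X) (fun n => b (-n)) n m * Ring.inverse ((X (-m)).Φ 1) := by
  have h1 := Ring.mul_inverse_cancel _ (hu (-n))
  rw [matQbar, Op.orbitMatrix]
  by_cases c1 : m = n + 1
  · rw [if_pos (by omega), if_pos c1, c1, show -n - 1 = -(n + 1) by ring]
    ring
  · rw [if_neg (by omega), if_neg c1]
    by_cases c2 : m = n
    · rw [if_pos (by omega), if_pos c2, c2, phiBar, Ring.inverse_inverse (hu _)]
      linear_combination (-1 : R) * mul_deriv_inverse d (hu (-n)) -
        ((X (-n)).Φ 1 * d (Ring.inverse ((X (-n)).Φ 1))) * h1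
    · rw [if_neg (by omega), if_neg c2]
      by_cases c3 : m < n
      · rw [if_pos (by omega), if_pos c3, show -m - -n = n - m by ring]
        ring
      · rw [if_neg (by omega), if_neg c3]
        ring

namespace Op
variable {d : Derivation ℤ R R}

lemma monic_Wbar {X : KPData R} (hu : IsUnit (X.Φ 1)) : Monic (⟨X.Wbar⟩ : Op d) 0 := by
  refine ⟨fun j hj => if_neg (by omega), ?_⟩
  change (if (0 : ℤ) ≤ 0 then X.Φ ((-0 : ℤ).toNat + 1) * Ring.inverse (X.Φ 1) else 0) = 1
  rw [if_pos le_rfl, neg_zero, Int.toNat_zero, zero_add, Ring.mul_inverse_cancel _ hu]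

lemma existsUnique_ghostLax {X : ℤ → KPData R} (hu : ∀ n, IsUnit ((X n).Φ 1)) :
    ∃! Lb : ℤ → PDO R, ∀ n, IsGhostLax d (X n) (Lb n) := by
  choose A _ hA hA' using fun n => (monic_Wbar (d := d) (hu n)).exists_inverse
  refine ⟨fun n => ((⟨(X n).Wbar⟩ : Op d) * z d 1 * A n).ser, fun n => ?_, fun Lb hLb => ?_⟩
  · have h : (⟨(X n).Wbar⟩ : Op d) * z d 1 * A n * ⟨(X n).Wbar⟩ = ⟨(X n).Wbar⟩ * z d 1 := by
      rw [mul_assoc, hA, mul_one]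
    exact congrArg Op.ser h
  · funext n
    have h : (⟨Lb n⟩ : Op d) * ⟨(X n).Wbar⟩ = ⟨(X n).Wbar⟩ * z d 1 := Op.ext (hLb n)
    rw [← h, mul_assoc, hA', mul_one]

/-- L̄ - D̄ = -(∂̄W̄) W̄⁻¹, and the derivative of a monic operator loses one order. -/
lemma ord_ghostLax {X : KPData R} (hu : IsUnit (X.Φ 1)) {Lb : PDO R} (hLb : IsGhostLax d X Lb) :
    Ord ((⟨Lb⟩ : Op d) - z d 1) (-1) := by
  obtain ⟨A, hA, -, hWA⟩ := (monic_Wbar (d := d) hu).exists_inverse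
  have h : (⟨Lb⟩ : Op d) * ⟨X.Wbar⟩ = ⟨X.Wbar⟩ * z d 1 := Op.ext hLb
  have e : (⟨Lb⟩ : Op d) - z d 1 = -((⟨X.Wbar⟩ : Op d).deriv d) * A := by
    have e1 : -((⟨X.Wbar⟩ : Op d).deriv d) = ((⟨Lb⟩ : Op d) - z d 1) * ⟨X.Wbar⟩ := by
      rw [← z_one_mul_sub, sub_mul, h]
      abel
    rw [e1, mul_assoc, hWA, mul_one]
  rw [e]
  exact ((monic_Wbar hu).ord_deriv d).neg.mul hA.1

lemma z_pow (r : ℕ) : z d 1 ^ r = z d r := by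
  induction r with
  | zero => rfl
  | succ r ih => rw [pow_succ, ih, z_mul_z, Nat.cast_succ]

/-- Elements of the `D`-orbit of a pair are obtained by differential operators. -/
lemma exists_isDiff_of_mem {V : Op d} {y : upSeries R} {x : PairSpace d}
    (hx : x ∈ Submodule.span R (Set.range fun i : ℕ => (pairD d)^[i] (V, y))) :
    ∃ E : Op d, E.IsDiff ∧ E * V = x.1 ∧ actCoeff d E.ser y = x.2 := by
  obtain ⟨a, rfl⟩ := Finsupp.mem_span_range_iff_exists_finsupp.1 hx
  have e1 : ∀ i : ℕ, (pairD d)^[i] (V, y) = (z d i * V, (coeffDeriv d)^[i] y) := by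
    intro i
    induction i with
    | zero => exact Prod.ext (by rw [Nat.cast_zero, z_zero, one_mul]; rfl) rfl
    | succ i ih =>
      rw [Function.iterate_succ_apply', Function.iterate_succ_apply', ih]
      refine Prod.ext ?_ rfl
      change z d 1 * (z d i * V) = _
      rw [← mul_assoc, z_mul_z, add_comm, Nat.cast_succ]
  have e2 : ∀ j, (∑ i ∈ a.support, a i • z d i).ser.1 j =
      ∑ i ∈ a.support, a i * if j = i then 1 else 0 := fun j => by
    rw [sum_ser, sum_coeff]
    rfl
  have e3 : ∀ k : ℕ, (∑ i ∈ a.support, a i • z d i).ser.1 k = a k := fun k => by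
    rw [e2, Finset.sum_eq_single k]
    · rw [if_pos rfl, mul_one]
    · intro i _ hi
      rw [if_neg (by omega), mul_zero]
    · intro hk
      rw [Finsupp.notMem_support_iff.1 hk, zero_mul]
  refine ⟨∑ i ∈ a.support, a i • z d i, fun j hj => ?_, ?_, ?_⟩
  · rw [e2]
    exact Finset.sum_eq_zero fun i _ => by rw [if_neg (by omega), mul_zero]
  · rw [Finsupp.sum, Prod.fst_sum, Finset.sum_mul]
    refine Finset.sum_congr rfl fun i _ => ?_
    rw [e1, smul_mul_assoc]
    rfl
  · rw [Finsupp.sum, Prod.snd_sum, actCoeff]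
    rw [finsum_eq_sum_of_support_subset (s := a.support)]
    · refine Finset.sum_congr rfl fun i _ => ?_
      rw [e1, e3]
      rfl
    · intro i hi
      by_contra hc
      refine hi ?_
      simp only
      rw [e3, Finsupp.notMem_support_iff.1 hc, zero_smul]

end Op

namespace GhostOrbit

variable {dt dtb : ℕ → Derivation ℤ R R} {X : ℤ → KPData R} {V : ℤ → Op (dt 1)}

/-- The normalized series `χ_{-n} / Φ₁^{(-n)}` as operators in `D̄`. -/
def barOrbit (d : Derivation ℤ R R) (X : ℤ → KPData R) (n : ℤ) : Op d :=
  ⟨phiBar X n • chi X (-n)⟩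

/-- The dressing operators of all sites, each multiplied by z^{-n}, form the one family of
normalized series χ_n. -/
lemma Wbar_mul_z (d : Derivation ℤ R R) (X : ℤ → KPData R) (n : ℤ) :
    (⟨(X n).Wbar⟩ : Op d) * Op.z d (-n) = barOrbit d X (-n) := by
  refine Op.ext (upSeries.ext fun j => ?_)
  rw [Op.mul_z_coeff]
  change (if j - -n ≤ 0 then _ else 0) = phiBar X (-n) * (chi X (- -n)).1 j
  rw [chi_coeff, phiBar, neg_neg]
  by_cases hj : j ≤ -n
  · rw [if_pos hj, if_pos (by omega), show (1 - n - j).toNat = (-(j - -n)).toNat + 1 by omega,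
      mul_comm]
  · rw [if_neg hj, if_neg (by omega), mul_zero]

lemma ghostLax_mul {d : Derivation ℤ R R} {n : ℤ} {Lb : PDO R} (hLb : IsGhostLax d (X n) Lb) :
    (⟨Lb⟩ : Op d) * barOrbit d X (-n) = barOrbit d X (-n) * Op.z d 1 := by
  have h1 : (⟨Lb⟩ : Op d) * ⟨(X n).Wbar⟩ = ⟨(X n).Wbar⟩ * Op.z d 1 := Op.ext hLb
  rw [← Wbar_mul_z, ← mul_assoc, h1, mul_assoc, mul_assoc, Op.z_mul_z, Op.z_mul_z, add_comm]

variable (h : GhostOrbit dt dtb X V)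
include h

lemma unit_phiBar (n : ℤ) : IsUnit (phiBar X n) := (h.unit (-n)).ringInverse

lemma monic_barOrbit (d : Derivation ℤ R R) (n : ℤ) : Op.Monic (barOrbit d X n) n := by
  refine ⟨(ordLE_chi_neg X n).smul _, ?_⟩
  change phiBar X n * (chi X (-n)).1 n = 1
  rw [chi_neg_lead, phiBar, Ring.inverse_mul_cancel _ (h.unit _)]

lemma isOrbit_bar : Op.IsOrbit (phiBar X) (barOrbit (dtb 1) X) := by
  intro n
  have e1 : Op.c (dtb 1) (Ring.inverse (phiBar X n)) * barOrbit (dtb 1) X n =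
      ⟨chi X (-n)⟩ := by
    rw [Op.c_mul]
    refine Op.ext ((smul_smul _ _ _).trans ?_)
    rw [Ring.inverse_mul_cancel _ (h.unit_phiBar n), one_smul]
  rw [Op.darboux_eq, mul_assoc, e1, mul_assoc, Op.z_one_mul, Op.c_mul]
  have e2 := h.coeffDeriv_chi (-n)
  refine Op.ext (Eq.symm ?_)
  change phiBar X n • (coeffDeriv (dtb 1) (chi X (-n)) + lam 1 (chi X (-n))) =
    phiBar X (n + 1) • chi X (-(n + 1))
  rw [e2, smul_smul, phiBar, ← mul_assoc, Ring.inverse_mul_cancel _ (h.unit _), one_mul, phiBar,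
    show -n - 1 = -(n + 1) by ring]

variable {Lb : ℤ → PDO R} (hLb : ∀ n, IsGhostLax (dtb 1) (X n) (Lb n)) {b : ℤ → ℕ → R}
  (hb : IsExpansionBar (dtb 1) X Lb b)

omit h in
variable (dtb X b) in
/-- The reflected matrix `Q̄` in the ring of matrices bounded above. -/
def Qbar : UBMat R := ⟨fun n m => matQbar (dtb 1) X b (-n) (-m), 1, fun n m hnm => by
  change matQbar (dtb 1) X b (-n) (-m) = 0
  rw [matQbar, if_neg (by omega), if_neg (by omega), if_neg (by omega)]⟩

include hb in
lemma isSum_bar {F : ℤ → Op (dtb 1)} (hF : Op.IsOrbit (phiBar X) F) (n : ℤ) :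
    IsSum (fun m => (Ring.inverse ((X n).Φ 1) * matQbar (dtb 1) X b n m * (X m).Φ 1) • (F (-m)).ser)
      ((⟨Lb n⟩ : Op (dtb 1)) * F (-n)).ser := by
  have h1 := Op.isSum_orbitMatrix h.unit_phiBar hF (n := -n) (a := fun n => b (-n))
    (L := ⟨Lb n⟩) (by
      simp only [neg_neg]
      exact (isExpansionBar_iff _ _ _ _).1 hb n)
  refine h1.extend neg_injective (fun m => ?_) fun m hm => absurd ⟨-m, neg_neg m⟩ hm
  have e := matQbar_neg (d := dtb 1) h.unit b (-n) m
  rw [neg_neg] at e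
  have e1 := Ring.inverse_mul_cancel _ (h.unit n)
  have e2 := Ring.inverse_mul_cancel _ (h.unit (-m))
  rw [e, neg_neg]
  congr 1
  linear_combination (Op.orbitMatrix (dtb 1) (phiBar X) (fun n => b (-n)) (-n) m) * e2 +
    (Op.orbitMatrix (dtb 1) (phiBar X) (fun n => b (-n)) (-n) m *
      (Ring.inverse ((X (-m)).Φ 1) * (X (-m)).Φ 1)) * e1

include hLb hb in
-- The operators L̄(n) act on the normalized χ_n as right multiplication by z, and their expansions
-- give the same action as sums over sites. The diagonal conjugation in Q̄ removes the
-- normalization.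
lemma Qbar_mul : Qbar dtb X b * chiMat X = chiMat X * rep (dtb 1) (Op.z (dtb 1) 1).ser := by
  ext n j
  refine Eq.trans ?_ (rows_mul_rep (dtb 1) (ordLE_chi_neg X) (Op.z (dtb 1) 1) n j).symm
  have h1 := (h.isSum_bar hb h.isOrbit_bar (-n)).smul ((X (-n)).Φ 1)
  rw [neg_neg] at h1
  have h2 := ghostLax_mul (hLb (-n))
  rw [neg_neg] at h2
  rw [h2] at h1
  have h3 := h1.2 j
  rw [smul_coeff, ← finsum_comp_equiv (Equiv.neg ℤ)] at h3
  have e1 : ∀ m : ℤ, (((X (-n)).Φ 1) • ((Ring.inverse ((X (-n)).Φ 1) *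
      matQbar (dtb 1) X b (-n) (-m) * (X (-m)).Φ 1) • (barOrbit (dtb 1) X (- -m)).ser)).1 j =
      matQbar (dtb 1) X b (-n) (-m) * (chi X (-m)).1 j := by
    intro m
    change (X (-n)).Φ 1 * (Ring.inverse ((X (-n)).Φ 1) *
      matQbar (dtb 1) X b (-n) (-m) * (X (-m)).Φ 1 * (phiBar X (- -m) * (chi X (- - -m)).1 j)) = _
    rw [neg_neg, phiBar]
    have e1 := Ring.mul_inverse_cancel _ (h.unit (-n))
    have e2 := Ring.mul_inverse_cancel _ (h.unit (-m))
    calc _ = ((X (-n)).Φ 1 * Ring.inverse ((X (-n)).Φ 1)) * ((X (-m)).Φ 1 *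
          Ring.inverse ((X (-m)).Φ 1)) * (matQbar (dtb 1) X b (-n) (-m) * (chi X (-m)).1 j) := by
            ring
      _ = _ := by rw [e1, e2, one_mul, one_mul]
  refine Eq.trans (finsum_congr fun m => (e1 m).symm) (h3.trans ?_)
  rw [Op.mul_z_coeff]
  change _ = ((⟨chi X (-n)⟩ : Op (dtb 1)) * Op.z (dtb 1) 1).ser.1 j
  rw [Op.mul_z_coeff]
  change _ * (phiBar X n * (chi X (-n)).1 (j - 1)) = _
  rw [phiBar, ← mul_assoc, Ring.mul_inverse_cancel _ (h.unit _), one_mul]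

include hLb hb in
lemma Qbar_pow_mul (s : ℕ) (n j : ℤ) : ∑ᶠ m, (Qbar dtb X b ^ s).1 n m * (chi X (-m)).1 j =
    (lam s (chi X (-n))).1 j := by
  have h1 := pow_mul_eq (h.Qbar_mul hLb hb) s
  rw [← rep_pow, Op.z_pow] at h1
  refine ((congrArg (fun A : UBMat R => A.1 n j) h1).trans
    (rows_mul_rep (dtb 1) (ordLE_chi_neg X) (Op.z (dtb 1) s) n j)).trans ?_
  exact Op.mul_z_coeff ⟨chi X (-n)⟩ s j

omit h in
lemma Qbar_pow_apply (s : ℕ) (n m : ℤ) :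
    (Qbar dtb X b ^ s).1 n m = matPow (matQbar (dtb 1) X b) s (-n) (-m) := by
  rw [UBMat.pow_val]
  exact matPow_neg_apply (matQbar (dtb 1) X b) s n m

include hLb hb in
/-- The ghost flows act on the orbit by `(Q̄^s)₋`. -/
lemma exists_ghost_comb' {s : ℕ} (hs : 1 ≤ s) (n : ℤ) : ∃ c : ℤ →₀ R,
    (∀ m, c m = matLower (matPow (matQbar (dtb 1) X b) s) n m) ∧
    (V n).deriv (dtb s) + V n * ghostOp dt X s = c.sum (fun m a => a • V m) ∧
    IsSum (fun m => c m • (V m).ser) ((V n).deriv (dtb s) + V n * ghostOp dt X s).ser ∧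
    IsSum (fun m => c m • chi X m) (coeffDeriv (dtb s) (chi X n) + lam s (chi X n)) := by
  obtain ⟨c, h0, h1, h2, h3⟩ := h.exists_ghost_comb hs n
  refine ⟨c, fun m => ?_, h1, h2, h3⟩
  rw [matLower]
  split_ifs with hnm
  · have e : (Qbar dtb X b ^ s).1 (-n) (-m) = matPow (matQbar (dtb 1) X b) s n m := by
      rw [Qbar_pow_apply, neg_neg, neg_neg]
    rw [← e]
    obtain ⟨N, -, hN⟩ := Finsupp.exists_bound c
    obtain ⟨N', hN'⟩ := (Qbar dtb X b ^ s).exists_bound (-n)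
    -- In degrees > -n the derivative of χ_n vanishes and only z^s χ_n is left, whose coefficients
    -- over the χ_m are the row of Q̄^s.
    have key := eq_of_triangular (ordLE_chi_neg X) h.unit_chi_lead (x := fun m => c (-m))
      (y := fun m => (Qbar dtb X b ^ s).1 (-n) m) (N := max N N') (n := -n + 1)
      (fun m hm => hN m (by omega)) (fun m hm => hN' m (by omega)) (fun j hj => by
        rw [finsum_chi_neg h3, h.Qbar_pow_mul hLb hb, neg_neg, add_coeff, coeffDeriv_coeff,
          ordLE_chi X n j (by omega), map_zero, zero_add]) (-m) (by omega)
    simpa only [neg_neg] using key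
  · exact h0 m (by omega)

end GhostOrbit
end DoubleKP
end

noncomputable section
namespace DoubleKP

variable {R : Type*} [CommRing R]

/-! ### Wronskians -/

lemma exists_iterate_mul (d : Derivation ℤ R R) (u : R) (k : ℕ) : ∃ c : ℕ → R, c k = u ∧
    (∀ i, k < i → c i = 0) ∧
    ∀ f, (⇑d)^[k] (u * f) = ∑ i ∈ Finset.range (k + 1), c i * (⇑d)^[i] f := by
  induction k with
  | zero => exact ⟨fun i => if i = 0 then u else 0, if_pos rfl, fun i hi => if_neg (by omega),
      fun f => by simp⟩
  | succ k ih =>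
    obtain ⟨c, hk, hc, hf⟩ := ih
    refine ⟨fun i => d (c i) + if i = 0 then 0 else c (i - 1), ?_, fun i hi => ?_, fun f => ?_⟩
    · simp only
      rw [hc (k + 1) (by omega), map_zero, zero_add, if_neg (by omega), Nat.add_sub_cancel, hk]
    · simp only
      rw [hc i (by omega), if_neg (by omega), hc (i - 1) (by omega), map_zero, add_zero]
    · rw [Function.iterate_succ_apply', hf, map_sum]
      simp only [Derivation.leibniz, smul_eq_mul, add_mul, Finset.sum_add_distrib]
      rw [Finset.sum_range_succ (fun i => d (c i) * (⇑d)^[i] f), hc (k + 1) (by omega), map_zero,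
        zero_mul, add_zero, Finset.sum_range_succ' (fun i => (if i = 0 then 0 else c (i - 1)) *
          (⇑d)^[i] f), if_pos rfl, zero_mul, add_zero, add_comm]
      congr 1
      · exact Finset.sum_congr rfl fun i _ => mul_comm _ _
      · refine Finset.sum_congr rfl fun i _ => ?_
        rw [if_neg (by omega), Nat.add_sub_cancel, Function.iterate_succ_apply']

/-- By the Leibniz rule the derivatives of u f are obtained from those of f by a lower triangular
matrix with u on the diagonal. -/
lemma wronskian_mul (d : Derivation ℤ R R) (u : R) (f : ℕ → R) (k : ℕ) :
    wronskian d (fun l => u * f l) k = u ^ k * wronskian d f k := by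
  choose c hc h0 hf using exists_iterate_mul d u
  have e : (Matrix.of fun α β : Fin k => (⇑d)^[(α : ℕ)] (u * f ((β : ℕ) + 1))) =
      (Matrix.of fun α β : Fin k => c α β) *
      (Matrix.of fun α β : Fin k => (⇑d)^[(α : ℕ)] (f ((β : ℕ) + 1))) := by
    ext α β
    rw [Matrix.mul_apply]
    simp only [Matrix.of_apply]
    rw [hf, Fin.sum_univ_eq_sum_range (fun i => c α i * (⇑d)^[i] (f ((β : ℕ) + 1)))]
    refine Finset.sum_subset (Finset.range_subset_range.2 α.2) fun i _ hi => ?_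
    rw [h0 _ _ (by simpa using hi), zero_mul]
  rw [wronskian, e, Matrix.det_mul, Matrix.det_of_isLowerTriangular]
  · simp [hc, wronskian]
  · intro i j hij
    exact h0 _ _ hij

lemma wronskian_congr (d : Derivation ℤ R R) {f g : ℕ → R} (h : ∀ l, 1 ≤ l → f l = g l) (k : ℕ) :
    wronskian d f k = wronskian d g k := by
  rw [wronskian, wronskian]
  congr 2
  ext α β
  rw [h _ (by omega)]

lemma wronskian_succ_of_one (d : Derivation ℤ R R) {f : ℕ → R} (h : f 1 = 1) (k : ℕ) :
    wronskian d f (k + 1) = wronskian d (fun l => d (f (l + 1))) k := by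
  rw [wronskian, Matrix.det_succ_column_zero, Fin.sum_univ_succ, Finset.sum_eq_zero, add_zero]
  · simp only [Fin.val_zero, pow_zero, one_mul, Matrix.of_apply, Function.iterate_zero, id, zero_add,
      h, wronskian]
    congr 1
  · intro i _
    simp only [Matrix.of_apply, Fin.val_succ, Fin.val_zero, zero_add, h,
      Function.iterate_succ_apply, Derivation.map_one_eq_zero, iterate_zero', mul_zero, zero_mul]

lemma wronskian_succ (d : Derivation ℤ R R) {f : ℕ → R} (hu : IsUnit (f 1)) (k : ℕ) :
    wronskian d f (k + 1) =
      f 1 * wronskian d (fun l => f 1 * d (f (l + 1) * Ring.inverse (f 1))) k := by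
  have e : ∀ l, 1 ≤ l → f l = f 1 * (f l * Ring.inverse (f 1)) := fun l _ => by
    rw [mul_comm, mul_assoc, Ring.inverse_mul_cancel _ hu, mul_one]
  rw [wronskian_congr d e, wronskian_mul d (f 1) (fun l => f l * Ring.inverse (f 1)),
    wronskian_mul d (f 1) (fun l => d (f (l + 1) * Ring.inverse (f 1))),
    wronskian_succ_of_one d (Ring.mul_inverse_cancel _ hu), pow_succ', mul_assoc]

lemma matComm_eq_of_sub {A B C : UBMat R} (h : C = A * B - B * A) :
    C.1 = matComm A.1 B.1 := by
  rw [h]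
  ext n m
  rw [UBMat.sub_apply]
  rfl

lemma UB.of_le {A B : Matrix ℤ ℤ R} (hA : UB A) (h : ∀ n m, A n m = 0 → B n m = 0) : UB B := by
  obtain ⟨r, hr⟩ := hA
  exact ⟨r, fun n m hnm => h n m (hr n m hnm)⟩

namespace GhostOrbit

variable {dt dtb : ℕ → Derivation ℤ R R} {X : ℤ → KPData R} {V : ℤ → Op (dt 1)}
variable (h : GhostOrbit dt dtb X V)
include h

/-- Dividing by Φ_1 makes the first column (1, 0, …, 0), and the remaining minor is the Wronskian at
the next site. Iterating, W_k is the product of Φ_1 over the sites n, …, n + k - 1. -/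
lemma wronskian_phi (n : ℤ) (k : ℕ) : wronskian (dt 1) (X n).Φ (k + 1) =
    wronskian (dt 1) (X n).Φ k * (X (n + k)).Φ 1 := by
  have key : ∀ n k, wronskian (dt 1) (X n).Φ (k + 1) =
      (X n).Φ 1 * wronskian (dt 1) (X (n + 1)).Φ k := fun n k => by
    rw [wronskian_succ _ (h.unit n), wronskian_congr (dt 1) (h.db n).phi]
  induction k generalizing n with
  | zero =>
    rw [key]
    simp [wronskian]
  | succ k ih =>
    rw [key, ih, key, show n + 1 + k = n + (k + 1 : ℕ) by push_cast; ring, mul_assoc]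

lemma isUnit_wronskian (n : ℤ) (k : ℕ) : IsUnit (wronskian (dt 1) (X n).Φ k) := by
  induction k with
  | zero => simp [wronskian]
  | succ k ih =>
    rw [h.wronskian_phi]
    exact ih.mul (h.unit _)

lemma matQbar_wronskian (b : ℤ → ℕ → R) (n : ℤ) {k : ℕ} (hk : 1 ≤ k) :
    matQbar (dtb 1) X b n (n + k) = b n k * (X n).Φ 1 * wronskian (dt 1) (X n).Φ k *
      Ring.inverse (wronskian (dt 1) (X n).Φ (k + 1)) := by
  rw [matQbar, if_neg (by omega), if_neg (by omega), if_pos (by omega), add_sub_cancel_left,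
    Int.toNat_natCast]
  have h1 := Ring.mul_inverse_cancel _ (h.isUnit_wronskian n (k + 1))
  have h2 := Ring.inverse_mul_cancel _ (h.unit (n + k))
  rw [h.wronskian_phi] at h1
  rw [h.wronskian_phi]
  linear_combination (-(b n k * (X n).Φ 1 * Ring.inverse ((X (n + k)).Φ 1))) * h1 +
    (b n k * (X n).Φ 1 * wronskian (dt 1) (X n).Φ k *
      Ring.inverse (wronskian (dt 1) (X n).Φ k * (X (n + k)).Φ 1)) * h2

/-! ### Orbits of eigenfunctions -/

/-- Right multiplication by F_0 carries the flow of V_n to any orbit. The correction term vanishes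
for ghost flows of eigenfunctions and becomes multiplication by λ^r for the Baker–Akhiezer function.
-/
lemma deriv_orbit {e : Derivation ℤ R R} (he : ∀ f, e (dt 1 f) = dt 1 (e f)) {F : ℤ → Op (dt 1)}
    (hF : Op.IsOrbit (fun n => (X n).Φ 1) F) {B : Op (dt 1)} {n : ℤ} {c : ℤ →₀ R}
    (hc : (V n).deriv e + V n * B = c.sum fun m a => a • V m) :
    (F n).deriv e + V n * (B * F 0 - (F 0).deriv e) = c.sum fun m a => a • F m := by
  have hV := hF |> h.orbit.eq_mul h.unit h.zero
  have e1 : (c.sum fun m a => a • F m) = (c.sum fun m a => a • V m) * F 0 := by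
    rw [Finsupp.sum, Finsupp.sum, Finset.sum_mul]
    refine Finset.sum_congr rfl fun m _ => ?_
    rw [smul_mul_assoc, ← hV]
  rw [e1, ← hc, hV n, Op.deriv_mul he]
  noncomm_ring

omit h in
lemma isSum_ser (F : ℤ → Op (dt 1)) (c : ℤ →₀ R) :
    IsSum (fun m => c m • (F m).ser) (c.sum fun m a => a • F m).ser := by
  have h3 : (c.sum fun m a => a • F m).ser = c.sum fun m a => a • (F m).ser := by
    rw [Finsupp.sum, Op.sum_ser]
    rfl
  rw [h3]
  exact isSum_finsupp _ c

/-- The ghost flows of a generic eigenfunction are generated by the ghost Lax operators. -/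
lemma ghost_flow_eq {F : ℤ → Op (dt 1)} (hF : Op.IsOrbit (fun n => (X n).Φ 1) F)
    (hg : ∀ s, 1 ≤ s → (F 0).deriv (dtb s) = ghostOp dt X s * F 0) {Lb : ℤ → PDO R}
    (hLb : ∀ n, IsGhostLax (dtb 1) (X n) (Lb n)) (n : ℤ) {s : ℕ} (hs : 1 ≤ s) :
    coeffDeriv (dtb s) (Ring.inverse ((X n).Φ 1) • (F n).ser) =
      actCoeff (dtb 1) (plusPart (pow (dtb 1) (Lb n) s)) (Ring.inverse ((X n).Φ 1) • (F n).ser) := by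
  -- Pairing F/Φ_1 with the normalized χ_n lets the latter identify the differential operator in D̄
  -- that moves both.
  let g : ℤ → PairSpace (dtb 1) := fun n =>
    (barOrbit (dtb 1) X (-n), Ring.inverse ((X n).Φ 1) • (F n).ser)
  have hg' : ∀ n, (X n).Φ 1 • g n = (⟨chi X n⟩, (F n).ser) := fun n => by
    refine Prod.ext ?_ ?_
    · change (X n).Φ 1 • barOrbit (dtb 1) X (-n) = _
      refine Op.ext ((smul_smul _ _ _).trans ?_)
      rw [phiBar, neg_neg, Ring.mul_inverse_cancel _ (h.unit n), one_smul]
    · change (X n).Φ 1 • Ring.inverse ((X n).Φ 1) • (F n).ser = _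
      rw [smul_smul, Ring.mul_inverse_cancel _ (h.unit n), one_smul]
  have hg1 : ∀ n, g n = Ring.inverse ((X n).Φ 1) • (⟨chi X n⟩, (F n).ser) := fun n => by
    rw [← hg', smul_smul, Ring.inverse_mul_cancel _ (h.unit n), one_smul]
  set P : Submodule R (PairSpace (dtb 1)) :=
    Submodule.span R (Set.range fun i : ℕ => (pairD (dtb 1))^[i] (g n)) with hP
  have hPD : ∀ x ∈ P, pairD (dtb 1) x ∈ P := fun x hx =>
    map_mem_of_span (pairD (dtb 1)) pairD_smul Submodule.subset_span (by
      rintro _ ⟨i, rfl⟩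
      exact Submodule.subset_span ⟨i + 1, Function.iterate_succ_apply' _ _ _⟩) hx
  -- each pair is obtained from the next one by a Darboux transformation
  have hstep : ∀ m, g (m - 1) = pairD (dtb 1) (g m) -
      ((X m).Φ 1 * dtb 1 (Ring.inverse ((X m).Φ 1))) • g m := fun m => by
    obtain ⟨a, h1, h2, h3⟩ := h.exists_ghost_comb_one m
    have h4 := (h.deriv_orbit (h.comm_ghost 1 le_rfl) hF (c := Finsupp.single (m - 1) a) (h2.trans
      (Finsupp.sum_single_index (h := fun m a => a • V m) (zero_smul R _)).symm)).trans
        (Finsupp.sum_single_index (h := fun m a => a • F m) (zero_smul R _))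
    rw [hg 1 le_rfl, sub_self, mul_zero, add_zero] at h4
    have h5 : pairD (dtb 1) (⟨chi X m⟩, (F m).ser) = a • (⟨chi X (m - 1)⟩, (F (m - 1)).ser) := by
      refine Prod.ext ?_ (congrArg Op.ser h4)
      change Op.z (dtb 1) 1 * ⟨chi X m⟩ = _
      rw [Op.z_one_mul]
      exact Op.ext h3
    have hu := Ring.inverse_mul_cancel _ (h.unit m)
    have hu' := Ring.inverse_mul_cancel _ (h.unit (m - 1))
    rw [hg1 m, pairD_smul, h5, hg1 (m - 1), smul_smul, smul_smul, add_sub_assoc]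
    have e1 : Ring.inverse ((X m).Φ 1) * a = Ring.inverse ((X (m - 1)).Φ 1) := by
      linear_combination (-Ring.inverse ((X m).Φ 1) * a) * hu' +
        (-Ring.inverse ((X m).Φ 1) * Ring.inverse ((X (m - 1)).Φ 1)) * h1 +
        Ring.inverse ((X (m - 1)).Φ 1) * hu
    have e2 : (X m).Φ 1 * dtb 1 (Ring.inverse ((X m).Φ 1)) * Ring.inverse ((X m).Φ 1) =
        dtb 1 (Ring.inverse ((X m).Φ 1)) := by
      linear_combination (dtb 1 (Ring.inverse ((X m).Φ 1))) * hu
    rw [e1, e2, sub_self, add_zero]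
  have hmem : ∀ k : ℕ, g (n - k) ∈ P := by
    intro k
    induction k with
    | zero =>
      rw [Nat.cast_zero, sub_zero]
      exact Submodule.subset_span ⟨0, rfl⟩
    | succ k ih =>
      rw [Nat.cast_succ, ← sub_sub, hstep]
      exact Submodule.sub_mem _ (hPD _ ih) (Submodule.smul_mem _ _ ih)
  have hmem' : ∀ m ≤ n, (⟨chi X m⟩, (F m).ser) ∈ P := fun m hm => by
    rw [← hg', show m = n - ((n - m).toNat : ℤ) by omega]
    exact P.smul_mem _ (hmem _)
  -- the flow of the pair at `n`
  obtain ⟨c, h1, h2, -, h3⟩ := h.exists_ghost_comb hs n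
  have h4 := h.deriv_orbit (h.comm_ghost s hs) hF h2
  rw [hg s hs, sub_self, mul_zero, add_zero] at h4
  have h5 : nabla (dtb s) 0 0 (⟨chi X n⟩, (F n).ser) +
      ((⟨lam s (chi X n)⟩, 0) : PairSpace (dtb 1)) ∈ P := by
    have e : nabla (dtb s) 0 0 (⟨chi X n⟩, (F n).ser) +
        ((⟨lam s (chi X n)⟩, 0) : PairSpace (dtb 1)) =
        ∑ m ∈ c.support, c m • ((⟨chi X m⟩, (F m).ser) : PairSpace (dtb 1)) := by
      refine Prod.ext ?_ ?_
      · rw [Prod.fst_sum]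
        refine Op.ext ?_
        rw [Op.sum_ser]
        change coeffDeriv (dtb s) (chi X n) + ((⟨chi X n⟩ : Op (dtb 1)) * 0).ser +
          lam s (chi X n) = ∑ m ∈ c.support, c m • chi X m
        rw [mul_zero, Op.zero_ser, add_zero]
        exact h3.unique (isSum_finsupp _ c)
      · rw [Prod.snd_sum]
        change coeffDeriv (dtb s) (F n).ser + 0 + 0 = ∑ m ∈ c.support, c m • (F m).ser
        rw [add_zero, add_zero]
        refine (congrArg Op.ser h4).trans ?_
        rw [Finsupp.sum, Op.sum_ser]
        rfl
    rw [e]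
    refine Submodule.sum_mem _ fun m hm => P.smul_mem _ (hmem' m ?_)
    by_contra hc
    exact Finsupp.mem_support_iff.1 hm (h1 m (by omega))
  have h6 : nabla (dtb s) 0 0 (g n) +
      ((barOrbit (dtb 1) X (-n) * Op.z (dtb 1) s, 0) : PairSpace (dtb 1)) ∈ P := by
    have e : nabla (dtb s) 0 0 (g n) +
        ((barOrbit (dtb 1) X (-n) * Op.z (dtb 1) s, 0) : PairSpace (dtb 1)) =
        Ring.inverse ((X n).Φ 1) • (nabla (dtb s) 0 0 (⟨chi X n⟩, (F n).ser) +
          ((⟨lam s (chi X n)⟩, 0) : PairSpace (dtb 1))) +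
        dtb s (Ring.inverse ((X n).Φ 1)) • (⟨chi X n⟩, (F n).ser) := by
      have e1 : ((barOrbit (dtb 1) X (-n) * Op.z (dtb 1) s, 0) : PairSpace (dtb 1)) =
          Ring.inverse ((X n).Φ 1) • ((⟨lam s (chi X n)⟩, 0) : PairSpace (dtb 1)) := by
        refine Prod.ext ?_ (smul_zero _).symm
        rw [Op.mul_z_nat]
        refine Op.ext ?_
        change lam s (phiBar X (-n) • chi X (- -n)) = Ring.inverse ((X n).Φ 1) • lam s (chi X n)
        rw [phiBar, neg_neg]
        rfl
      rw [hg1 n, nabla_smul, e1, smul_add]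
      abel
    rw [e]
    exact P.add_mem (P.smul_mem _ h5) (P.smul_mem _ (hmem' n le_rfl))
  -- The flow at n involves only sites below n, all reached from `g n` by D̄. Hence one differential
  -- operator E produces both components.
  obtain ⟨E, hE, hE1, hE2⟩ := Op.exists_isDiff_of_mem h6
  have hE1' : E * barOrbit (dtb 1) X (-n) = (barOrbit (dtb 1) X (-n)).deriv (dtb s) +
      barOrbit (dtb 1) X (-n) * Op.z (dtb 1) s := by
    rw [hE1]
    change (barOrbit (dtb 1) X (-n)).deriv (dtb s) + barOrbit (dtb 1) X (-n) * 0 + _ = _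
    rw [mul_zero, add_zero]
  have hpow : (⟨Lb n⟩ : Op (dtb 1)) ^ s * barOrbit (dtb 1) X (-n) =
      barOrbit (dtb 1) X (-n) * Op.z (dtb 1) s := by
    rw [pow_mul_eq (ghostLax_mul (hLb n)), Op.z_pow]
  -- E and L̄^s differ on the normalized χ_n only by its derivative, which has lower order; so E is
  -- the differential part of L̄^s.
  have hord : Op.Ord (E - (⟨Lb n⟩ : Op (dtb 1)) ^ s) (-1) := by
    have hm := h.monic_barOrbit (dtb 1) (-n)
    obtain ⟨A, hA, -, hA'⟩ := hm.exists_inverse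
    have e : E - (⟨Lb n⟩ : Op (dtb 1)) ^ s = (barOrbit (dtb 1) X (-n)).deriv (dtb s) * A := by
      have e1 : (E - (⟨Lb n⟩ : Op (dtb 1)) ^ s) * barOrbit (dtb 1) X (-n) =
          (barOrbit (dtb 1) X (-n)).deriv (dtb s) := by
        rw [sub_mul, hE1', hpow, add_sub_cancel_right]
      rw [← e1, mul_assoc, hA', mul_one]
    rw [e]
    exact ((hm.ord_deriv _).mul hA.1).mono (by omega)
  have hEp : E.ser = plusPart (pow (dtb 1) (Lb n) s) :=
    (congrArg Op.ser (hE.eq_plus hord)).trans (by rw [Op.plus, Op.pow_ser])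
  rw [← hEp]
  refine Eq.trans ?_ hE2.symm
  change _ = coeffDeriv (dtb s) (Ring.inverse ((X n).Φ 1) • (F n).ser) + 0 + 0
  rw [add_zero, add_zero]

/-! ### The Lax equations -/

variable {a : ℤ → ℕ → R}
  (ha : ∀ n, Op.IsWordExpansion (fun n => (X n).Φ 1) n (lax dt X n) (a n))

include ha in
-- The matrix of coefficients of the V_n dresses Q to the matrix of L(0), whose evolution is
-- generated by the same B that enters the flow of V_n.
lemma toda_Q {e : Derivation ℤ R R} (he : ∀ f, e (dt 1 f) = dt 1 (e f)) {B : Op (dt 1)}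
    {N : Matrix ℤ ℤ R} (hN : UB N)
    (hV : ∀ n, IsSum (fun m => N n m • (V m).ser) ((V n).deriv e + V n * B).ser)
    (hL : (lax dt X 0).deriv e = B * lax dt X 0 - lax dt X 0 * B) :
    (matQ (dt 1) X a).map e = matComm N (matQ (dt 1) X a) := by
  refine matComm_eq_of_sub (A := ⟨N, hN⟩) (B := Q dt X a) (C := (Q dt X a).deriv e)
    (UBMat.lax_of_dressing e (h.Q_mul ha) (B := rep (dt 1) B.ser) ?_ ?_
      fun A hA => rows_cancel h.ordLE h.unit_lead hA)
  · rw [eq_sub_iff_add_eq]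
    ext n j
    refine Eq.trans ?_ ((hV n).2 j).symm
    rw [UBMat.add_apply]
    exact congrArg₂ (· + ·) rfl (rows_mul_rep (dt 1) h.ordLE B n j)
  · rw [rep_deriv he, hL, rep_sub, Op.rep_mul, Op.rep_mul]

variable {Lb : ℤ → PDO R} (hLb : ∀ n, IsGhostLax (dtb 1) (X n) (Lb n)) {b : ℤ → ℕ → R}
  (hb : IsExpansionBar (dtb 1) X Lb b)

include hLb hb in
-- Here the dressed matrix is the constant one of right multiplication by z, so B need only commute
-- with z: it is z^s for the ghost flows and 0 for the isospectral ones.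
lemma toda_Qbar {e : Derivation ℤ R R} {B : Op (dtb 1)} {N : Matrix ℤ ℤ R}
    (hN : UB fun n m => N (-n) (-m))
    (hV : ∀ n, IsSum (fun m => N n m • chi X m)
      (coeffDeriv e (chi X n) + ((⟨chi X n⟩ : Op (dtb 1)) * B).ser))
    (hB : B * Op.z (dtb 1) 1 = Op.z (dtb 1) 1 * B) :
    (matQbar (dtb 1) X b).map e = matComm N (matQbar (dtb 1) X b) := by
  have key := UBMat.lax_of_dressing e (N := ⟨fun n m => N (-n) (-m), hN⟩)
    (h.Qbar_mul hLb hb) (B := rep (dtb 1) B.ser) (by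
      rw [eq_sub_iff_add_eq]
      ext n j
      have h1 := hV (-n)
      have h2 : ∑ᶠ m, N (-n) (-m) * (chi X (-m)).1 j = _ :=
        finsum_chi_neg (c := fun m => N (-n) m) h1 j
      refine Eq.trans ?_ h2.symm
      rw [UBMat.add_apply]
      exact congrArg₂ (· + ·) rfl (rows_mul_rep (dtb 1) (ordLE_chi_neg X) B n j)) (by
      rw [← Op.rep_mul, ← Op.rep_mul, hB, sub_self]
      ext i j
      change e ((zpowMul (dtb 1) i (mono 1 1)).1 j) = 0
      rw [zpowMul_mono, mono_coeff]
      split_ifs <;> simp)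
    fun A hA => rows_cancel (ordLE_chi_neg X) h.unit_chi_lead hA
  ext n m
  have h1 := congrArg (fun A : UBMat R => A.1 (-n) (-m)) key
  simp only [UBMat.sub_apply] at h1
  have h2 : e (matQbar (dtb 1) X b (- -n) (- -m)) = _ := h1
  rw [UBMat.mul_val, UBMat.mul_val] at h2
  have h3 := matMul_neg_apply N (matQbar (dtb 1) X b) (-n) (-m)
  have h4 := matMul_neg_apply (matQbar (dtb 1) X b) N (-n) (-m)
  rw [neg_neg, neg_neg] at h2 h3 h4
  exact h2.trans (congrArg₂ (· - ·) h3 h4)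

end GhostOrbit
end DoubleKP
end

/-! ### The Toda linear system and Lax equations, and the main theorem. -/

noncomputable section
namespace DoubleKP

variable {R : Type*} [CommRing R]

namespace GhostOrbit

variable {dt dtb : ℕ → Derivation ℤ R R} {X : ℤ → KPData R} {V : ℤ → Op (dt 1)}

lemma isOrbit_of_db {F : ℤ → Osc R} (hF : ∀ n, F (n + 1) = act (dt 1) ((X n).T (dt 1)) (F n)) :
    Op.IsOrbit (d := dt 1) (fun n => (X n).Φ 1) fun n => ⟨F n⟩ :=
  fun n => Op.ext (hF n)

lemma isOrbit_of_db_bar {Lb : ℤ → PDO R} {G : ℤ → Osc R} (hG : IsGenericEFBar dtb X Lb G) :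
    Op.IsOrbit (d := dtb 1) (phiBar X) fun n => ⟨G (-n)⟩ := fun n => Op.ext (by
  have h1 := hG.db (-n)
  rw [← neg_add'] at h1
  exact h1)

variable (h : GhostOrbit dt dtb X V)
include h

variable {a : ℤ → ℕ → R}
  (ha : ∀ n, Op.IsWordExpansion (fun n => (X n).Φ 1) n (lax dt X n) (a n))
  {Lb : ℤ → PDO R} (hLb : ∀ n, IsGhostLax (dtb 1) (X n) (Lb n)) {b : ℤ → ℕ → R}
  (hb : IsExpansionBar (dtb 1) X Lb b)

lemma matQbar_pred (b : ℤ → ℕ → R) (n : ℤ) :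
    matQbar (dtb 1) X b n (n - 1) = (X n).Φ 1 * (X n).Ψ 1 := by
  have h1 := (h.db (n - 1)).psi_one
  rw [sub_add_cancel] at h1
  rw [matQbar, if_pos rfl, h1]

include ha hLb hb in
/-- The linear system for the orbit of a Baker–Akhiezer function. -/
lemma isSum_bakerAkhiezer {ψ : ℤ → Osc R} (hψ : IsBakerAkhiezer dt dtb X ψ) (n : ℤ) :
    IsSum (fun m => matQ (dt 1) X a n m • ψ m) (lam 1 (ψ n)) ∧
    (∀ r, 1 ≤ r → IsSum (fun m => matUpper (matPow (matQ (dt 1) X a) r) n m • ψ m)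
      (oscDeriv (dt r) r (ψ n))) ∧
    (∀ s, 1 ≤ s → IsSum (fun m => matLower (matPow (matQbar (dtb 1) X b) s) n m • ψ m)
      (coeffDeriv (dtb s) (ψ n))) := by
  obtain ⟨⟨W, -, hW, hWr, hWs, h0⟩, hdb⟩ := hψ
  have hF := isOrbit_of_db hdb
  set F : ℤ → Op (dt 1) := fun n => ⟨ψ n⟩ with hFdef
  have hFV := h.orbit.eq_mul h.unit h.zero hF
  have hF0 : F 0 = ⟨W⟩ := (Op.ext h0).trans (mul_one (⟨W⟩ : Op (dt 1)))
  have hz : lax dt X 0 * F 0 = F 0 * Op.z (dt 1) 1 := by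
    rw [hF0]
    exact Op.ext hW
  refine ⟨?_, fun r hr => ?_, fun s hs => ?_⟩
  · refine (Op.isSum_orbitMatrix h.unit hF (ha n)).congr (fun _ => rfl) ?_
    rw [hFV n, ← mul_assoc, h.lax_mul, mul_assoc, hz, ← mul_assoc, ← hFV n]
    exact congrArg Op.ser (Op.mul_z_nat (F n) 1)
  · obtain ⟨c, hc, h1, -, -⟩ := h.exists_flow_comb ha hr n
    have h2 := h.deriv_orbit (h.comm r hr) hF h1
    have h3 : (F 0).deriv (dt r) = -((lax dt X 0 ^ r - (lax dt X 0 ^ r).plus) * F 0) := by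
      rw [hF0]
      refine Op.ext ((hWr r hr).trans ?_)
      rw [minusPart, ← plus_lax_pow]
      change -leibniz (dt 1) (pow (dt 1) (lax dt X 0).ser r - _) W = _
      rw [← Op.pow_ser]
      rfl
    have h4 : (lax dt X 0 ^ r).plus * F 0 - (F 0).deriv (dt r) = F 0 * Op.z (dt 1) r := by
      -- The Sato equation completes (L^r)_+ to L^r, and L^r W = W D^r. This is the factor λ^r from
      -- differentiating the exponential.
      rw [h3, sub_neg_eq_add, sub_mul, add_sub_cancel, pow_mul_eq hz, Op.z_pow]
    rw [h4, ← mul_assoc, ← hFV n, Op.mul_z_nat] at h2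
    refine (isSum_ser F c).congr (fun m => by rw [← hc]) ?_
    rw [← h2]
    rfl
  · obtain ⟨c, hc, h1, -, -⟩ := h.exists_ghost_comb' hLb hb hs n
    have h2 := h.deriv_orbit (h.comm_ghost s hs) hF h1
    have h3 : (F 0).deriv (dtb s) = ghostOp dt X s * F 0 := by
      rw [hF0]
      exact Op.ext (hWs s hs)
    rw [h3, sub_self, mul_zero, add_zero] at h2
    refine (isSum_ser F c).congr (fun m => by rw [← hc]) ?_
    rw [← h2]
    rfl

include ha hLb hb in
/-- The Lax equations of the 2D Toda lattice. -/
lemma toda_lax :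
    (∀ r, 1 ≤ r → (matQ (dt 1) X a).map (dt r) =
      matComm (matUpper (matPow (matQ (dt 1) X a) r)) (matQ (dt 1) X a)) ∧
    (∀ s, 1 ≤ s → (matQ (dt 1) X a).map (dtb s) =
      matComm (matLower (matPow (matQbar (dtb 1) X b) s)) (matQ (dt 1) X a)) ∧
    (∀ s, 1 ≤ s → (matQbar (dtb 1) X b).map (dtb s) =
      matComm (matLower (matPow (matQbar (dtb 1) X b) s)) (matQbar (dtb 1) X b)) ∧
    (∀ r, 1 ≤ r → (matQbar (dtb 1) X b).map (dt r) =
      matComm (matUpper (matPow (matQ (dt 1) X a) r)) (matQbar (dtb 1) X b)) := by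
  refine ⟨fun r hr => ?_, fun s hs => ?_, fun s hs => ?_, fun r hr => ?_⟩
  · refine h.toda_Q ha (h.comm r hr) (B := (lax dt X 0 ^ r).plus) ?_ (fun n => ?_) ?_
    · refine UB.of_le (Q dt X a ^ r).ub fun n m hnm => ?_
      rw [UBMat.pow_val] at hnm
      rw [matUpper]
      split_ifs
      · exact hnm
      · rfl
    · obtain ⟨c, hc, -, h1, -⟩ := h.exists_flow_comb ha hr n
      exact h1.congr (fun m => by rw [← hc]) rfl
    · refine Op.ext ((h.kp.lax r hr).trans ?_)
      rw [← plus_lax_pow]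
      rfl
  · refine h.toda_Q ha (h.comm_ghost s hs) (B := ghostOp dt X s) ?_ (fun n => ?_)
      (Op.ext (h.kp.ghost s hs))
    · exact ⟨0, fun n m hnm => if_neg (by omega)⟩
    · obtain ⟨c, hc, -, h1, -⟩ := h.exists_ghost_comb' hLb hb hs n
      exact h1.congr (fun m => by rw [← hc]) rfl
  · refine h.toda_Qbar hLb hb (B := Op.z (dtb 1) s) ?_ (fun n => ?_) ?_
    · refine UB.of_le (Qbar dtb X b ^ s).ub fun n m hnm => ?_
      rw [Qbar_pow_apply] at hnm
      simp only [matLower]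
      split_ifs
      · exact hnm
      · rfl
    · obtain ⟨c, hc, -, -, h1⟩ := h.exists_ghost_comb' hLb hb hs n
      refine h1.congr (fun m => by rw [← hc]) ?_
      rw [Op.mul_z_nat]
    · rw [Op.z_mul_z, Op.z_mul_z, add_comm]
  · refine h.toda_Qbar hLb hb (B := 0) ?_ (fun n => ?_) (by rw [zero_mul, mul_zero])
    · exact ⟨0, fun n m hnm => if_neg (by omega)⟩
    · obtain ⟨c, hc, -, -, h1⟩ := h.exists_flow_comb ha hr n
      refine h1.congr (fun m => by rw [← hc]) ?_
      rw [mul_zero, Op.zero_ser, add_zero]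

end GhostOrbit
end DoubleKP
end

theorem mainTheorem8 {R : Type*} [CommRing R] (dt dtb : ℕ → Derivation ℤ R R)
    (hcomm : ∀ r r', 1 ≤ r → 1 ≤ r' → ∀ f, dt r (dt r' f) = dt r' (dt r f))
    (hcomm' : ∀ s s', 1 ≤ s → 1 ≤ s' → ∀ f, dtb s (dtb s' f) = dtb s' (dtb s f))
    (hcomm'' : ∀ r s, 1 ≤ r → 1 ≤ s → ∀ f, dt r (dtb s f) = dtb s (dt r f))
    (X : ℤ → KPData R)
    (hX : IsGhostKP dt dtb (X 0))
    (hunit : ∀ n, IsUnit ((X n).Φ 1))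
    (hDB : ∀ n, IsDB (dt 1) (X n) (X (n + 1))) :
    (∃! Lb : ℤ → PDO R, ∀ n, IsGhostLax (dtb 1) (X n) (Lb n)) ∧
    ∀ Lb : ℤ → PDO R, (∀ n, IsGhostLax (dtb 1) (X n) (Lb n)) →
    ∃ a b : ℤ → ℕ → R,
      -- the coefficients `a_k(n)`, `b_k(n)` exist and are unique
      (IsExpansion (dt 1) X a ∧
        ∀ a', IsExpansion (dt 1) X a' → ∀ n k, 1 ≤ k → a' n k = a n k) ∧
      (IsExpansionBar (dtb 1) X Lb b ∧
        ∀ b', IsExpansionBar (dtb 1) X Lb b' → ∀ n k, 1 ≤ k → b' n k = b n k) ∧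
      -- other forms of the entries of `Q̄`
      (∀ n, matQbar (dtb 1) X b n (n - 1) = (X n).Φ 1 * (X n).Ψ 1) ∧
      (∀ (n : ℤ) (k : ℕ), 1 ≤ k → IsUnit (wronskian (dt 1) (X n).Φ (k + 1)) ∧
        matQbar (dtb 1) X b n (n + k) = b n k * (X n).Φ 1 * wronskian (dt 1) (X n).Φ k *
          Ring.inverse (wronskian (dt 1) (X n).Φ (k + 1))) ∧
      -- action on generic eigenfunctions
      (∀ F, IsGenericEF dt dtb X F → ∀ n,
        IsSum (fun m => matQ (dt 1) X a n m • F m) (act (dt 1) (X n).L (F n))) ∧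
      (∀ G, IsGenericEFBar dtb X Lb G → ∀ n,
        IsSum (fun m => (Ring.inverse ((X n).Φ 1) * matQbar (dtb 1) X b n m * (X m).Φ 1) • G m)
          (act (dtb 1) (Lb n) (G n))) ∧
      -- `L̄(n)` generates the ghost flows: `∂(F/Φ₁)/∂t̄_s = (L̄(n)^s)₊ (F/Φ₁)`
      (∀ F, IsGenericEF dt dtb X F → ∀ n s, 1 ≤ s →
        coeffDeriv (dtb s) (Ring.inverse ((X n).Φ 1) • F n) =
          actCoeff (dtb 1) (plusPart (pow (dtb 1) (Lb n) s)) (Ring.inverse ((X n).Φ 1) • F n)) ∧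
      -- linear system of the 2D Toda lattice hierarchy
      (∀ ψ, IsBakerAkhiezer dt dtb X ψ → ∀ n,
        IsSum (fun m => matQ (dt 1) X a n m • ψ m) (lam 1 (ψ n)) ∧
        (∀ r, 1 ≤ r → IsSum (fun m => matUpper (matPow (matQ (dt 1) X a) r) n m • ψ m)
          (oscDeriv (dt r) r (ψ n))) ∧
        (∀ s, 1 ≤ s → IsSum (fun m => matLower (matPow (matQbar (dtb 1) X b) s) n m • ψ m)
          (coeffDeriv (dtb s) (ψ n)))) ∧
      -- Lax equations of the 2D Toda lattice hierarchy
      (∀ r, 1 ≤ r → (matQ (dt 1) X a).map (dt r) =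
        matComm (matUpper (matPow (matQ (dt 1) X a) r)) (matQ (dt 1) X a)) ∧
      (∀ s, 1 ≤ s → (matQ (dt 1) X a).map (dtb s) =
        matComm (matLower (matPow (matQbar (dtb 1) X b) s)) (matQ (dt 1) X a)) ∧
      (∀ s, 1 ≤ s → (matQbar (dtb 1) X b).map (dtb s) =
        matComm (matLower (matPow (matQbar (dtb 1) X b) s)) (matQbar (dtb 1) X b)) ∧
      (∀ r, 1 ≤ r → (matQbar (dtb 1) X b).map (dt r) =
        matComm (matUpper (matPow (matQ (dt 1) X a) r)) (matQbar (dtb 1) X b)) := by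
  obtain ⟨V, hV, hV0⟩ := Op.exists_orbit (d := dt 1) hunit
  have h : GhostOrbit dt dtb X V :=
    ⟨fun r hr => hcomm r 1 hr le_rfl,
      fun s hs f => (hcomm'' 1 s le_rfl hs f).symm, hX, hunit, hDB, hV, hV0⟩
  refine ⟨Op.existsUnique_ghostLax hunit, fun Lb hLb => ?_⟩
  choose a ha using fun n => Op.exists_wordExpansion h.unit n (h.ord_lax n)
  choose b hb using fun n =>
    Op.exists_wordExpansion h.unit_phiBar (-n) (Op.ord_ghostLax (hunit n) (hLb n))
  have hb' : IsExpansionBar (dtb 1) X Lb b := (isExpansionBar_iff _ _ _ _).2 hb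
  refine ⟨a, b, ⟨(isExpansion_iff _ _ _).2 ha, fun a' ha' n k hk => ?_⟩,
    ⟨hb', fun b' hb' n k hk => ?_⟩, h.matQbar_pred b,
    fun n k hk => ⟨h.isUnit_wronskian n (k + 1), h.matQbar_wronskian b n hk⟩,
    fun F hF n => Op.isSum_orbitMatrix h.unit (GhostOrbit.isOrbit_of_db hF.db) (ha n),
    fun G hG n => ?_,
    fun F hF n s hs => h.ghost_flow_eq (GhostOrbit.isOrbit_of_db hF.db)
      (fun s hs => Op.ext (hF.ghost s hs)) hLb n hs,
    fun ψ hψ => h.isSum_bakerAkhiezer ha hLb hb' hψ, h.toda_lax ha hLb hb'⟩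
  · exact (ha n).unique h.unit ((isExpansion_iff _ _ _).1 ha' n) hk
  · exact (hb n).unique h.unit_phiBar ((isExpansionBar_iff _ _ _ _).1 hb' n) hk
  · have h1 := h.isSum_bar hb' (GhostOrbit.isOrbit_of_db_bar hG) n
    simp only [neg_neg] at h1
    exact h1
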